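/- **Setting.** Let a Lie group $G$ act smoothly, freely and properly on a manifold $Q$, let $\pi:Q\to\overline Q=Q/G$ be the quotient map, $n=\dim\overline Q$, and $V_q=\ker T_q\pi$. Let $(L,\mathcal D)$ be a (generalized) Chaplygin nonholonomic system: $L:TQ\to\mathbb R$ is a smooth regular $G$-invariant Lagrangian and $\mathcal D\subseteq TQ$ is a smooth $G$-invariant distribution with $T_qQ=\mathcal D_q\oplus V_q$ for all $q$. Let $F:TQ\to T^*Q$ be a cyclic (that is, $G$-equivariant) force. The forced nonholonomic dynamics $\Gamma_{nh}$ of $(L,\mathcal D,F)$ assigns to $v\in\mathcal D$ a second-order vector in $T_v\mathcal D$ along which $\frac{d}{dt}\frac{\partial L}{\partial\dot q}-\frac{\partial L}{\partial q}-F$ annihilates $\mathcal D$; nonholonomic trajectories are its integral curves. The reduced Lagrangian and the reduced force are $l(X)=L(X^H)$ and $f(X)(Y)=F(X^H)(Y^H)$, where $X^H$ is the lift to $\mathcal D$ of a tangent vector $X$ of $\overline Q$. Assume that in a chart $\varphi$ of $\overline Q$ whose image contains $0$, with induced coordinates $(q,\dot q)$ on $T\overline Q$, and for some symmetric positive definite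 real matrices $M,K$ and some $b>0$, $$l=\tfrac12\dot q^TM\dot q-\tfrac12q^TKq,\qquad f=-b\,\dot q^i\,dq^i,$$ and the reduced dynamics of the unforced system $(L,\mathcal D)$ is that of the mechanical system with Lagrangian $l$, i.e. $\ddot q=-M^{-1}Kq$. Let $\mathcal{EP}\subseteq\mathcal D$ be the set of equilibrium points (zeros of $\Gamma_{nh}$) of $(L,\mathcal D,F)$ lying over the domain of $\varphi$. For $\varepsilon\in\mathbb R$ such that $\mathbb G_\varepsilon=\begin{bmatrix}K&b\varepsilon I_n\\ b\varepsilon I_n&M\end{bmatrix}$ is positive definite, a *horizontal lift* of $\mathbb G_\varepsilon$ is a smooth Riemannian metric $\mathcal G$ on $TQ$ such that at every $v\in\mathcal D$ over the domain of $\varphi$ $$\mathcal G(X^H,Y^H)=\mathbb G_\varepsilon(X,Y),\qquad \mathcal G(X^H,Z)=0,$$ for all tangent vectors $X,Y$ of $T\overline Q$ at $T\pi(v)$ and all $Z\in T_vTQ$ with $T(T\pi)Z=0$; here $X^H$ is the unique vector of $T_v\mathcal D$ that projects to $X$ under $T(T\pi)$ and whose projection to $TQ$ lies in $\mathcal D$.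 Let $d_{\mathcal G}$ be the Riemannian distance on $TQ$, and $d^{\mathcal D}_{\mathcal G}$ the Riemannian distance of $\mathcal D$ with the metric induced by $\mathcal G$ (infimum of lengths of $C^1$ curves in $\mathcal D$). **Theorem.** There exist a tubular neighbourhood $\mathcal U$ of $\mathcal{EP}$ in $\mathcal D$ and a rate $\lambda>0$ with the following properties. From every point of $\mathcal U$ there starts a nonholonomic trajectory defined for all $t\ge0$. For every $\varepsilon$ with $\mathbb G_\varepsilon$ positive definite there is a constant $C>0$ such that for every horizontal lift $\mathcal G$ of $\mathbb G_\varepsilon$, every nonholonomic trajectory $v(t)$ with $v(0)\in\mathcal U$, and every $t\ge0$ at which it is defined, $$d_{\mathcal G}(v(t),\mathcal{EP})\le Ce^{-\lambda t}\qquad\text{and}\qquad d^{\mathcal D}_{\mathcal G}(v(t),\mathcal{EP})\le Ce^{-\lambda t}\,d^{\mathcal D}_{\mathcal G}(v(0),\mathcal{EP}).$$ -/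

import Mathlib

open Set Filter Topology Matrix
open scoped Manifold ContDiff ENNReal

noncomputable section

/-! ### Lagrangian mechanics on a manifold `Q` of dimension `N` -/

section Mechanics

variable {N : ℕ} {Q : Type*} [TopologicalSpace Q] [ChartedSpace (EuclideanSpace ℝ (Fin N)) Q]
  [IsManifold (𝓡 N) ∞ Q]

/-- A function `L : TQ → ℝ` read in the natural coordinates `(q, q̇)` of `TQ` around `v`. -/
def coordLagrangian (L : TangentBundle (𝓡 N) Q → ℝ) (v : TangentBundle (𝓡 N) Q) :
    EuclideanSpace ℝ (Fin N) × EuclideanSpace ℝ (Fin N) → ℝ :=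
  fun p => L ((extChartAt (𝓡 N).tangent v).symm p)

/-- The coordinates `(q, q̇)` of `v` itself. -/
def coordPoint (v : TangentBundle (𝓡 N) Q) :
    EuclideanSpace ℝ (Fin N) × EuclideanSpace ℝ (Fin N) :=
  extChartAt (𝓡 N).tangent v v

/-- The fiber Hessian `(∂²L/∂q̇ⁱ∂q̇ʲ) uⁱ wʲ` at `v`. -/
def fiberHessian (L : TangentBundle (𝓡 N) Q → ℝ) (v : TangentBundle (𝓡 N) Q)
    (u w : TangentSpace (𝓡 N) v.proj) : ℝ :=
  fderiv ℝ (fun p => fderiv ℝ (coordLagrangian L v) p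
    ((0 : EuclideanSpace ℝ (Fin N)), (w : EuclideanSpace ℝ (Fin N))))
    (coordPoint v) ((0 : EuclideanSpace ℝ (Fin N)), (u : EuclideanSpace ℝ (Fin N)))

/-- The Euler-Lagrange covector `(d/dt (∂L/∂q̇ⁱ) - ∂L/∂qⁱ) uⁱ`, where `d/dt` is the derivative in
the direction of a second order vector `W ∈ T_v TQ`.  (A tangent vector at `v` is by definition the
vector of its components in the natural coordinates of `TQ` around `v`.) -/
def eulerLagrange (L : TangentBundle (𝓡 N) Q → ℝ) (v : TangentBundle (𝓡 N) Q)
    (W : TangentSpace (𝓡 N).tangent v) (u : TangentSpace (𝓡 N) v.proj) : ℝ :=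
  fderiv ℝ (fun p => fderiv ℝ (coordLagrangian L v) p
    ((0 : EuclideanSpace ℝ (Fin N)), (u : EuclideanSpace ℝ (Fin N))))
    (coordPoint v) (W : EuclideanSpace ℝ (Fin N) × EuclideanSpace ℝ (Fin N))
  - fderiv ℝ (coordLagrangian L v) (coordPoint v)
    ((u : EuclideanSpace ℝ (Fin N)), (0 : EuclideanSpace ℝ (Fin N)))

/-- The tangent map `Tτ_Q` of the projection `τ_Q : TQ → Q`. -/
def tangentProj (v : TangentBundle (𝓡 N) Q) :
    TangentSpace (𝓡 N).tangent v →L[ℝ] TangentSpace (𝓡 N) v.proj :=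
  mfderiv (𝓡 N).tangent (𝓡 N)
    (Bundle.TotalSpace.proj : TangentBundle (𝓡 N) Q → Q) v

/-- A distribution is smooth if every one of its vectors extends to a smooth local section.  (This
is used for distributions of constant rank only.) -/
def IsSmoothDistribution (D : ∀ q : Q, Submodule ℝ (TangentSpace (𝓡 N) q)) : Prop :=
  ∀ q : Q, ∀ w ∈ D q, ∃ (O : Set Q) (X : ∀ p : Q, TangentSpace (𝓡 N) p),
    IsOpen O ∧ q ∈ O ∧ X q = w ∧ (∀ p ∈ O, X p ∈ D p) ∧
    ContMDiffOn (𝓡 N) (𝓡 N).tangent ∞ (fun p => (⟨p, X p⟩ : TangentBundle (𝓡 N) Q)) O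

/-- The distribution `D` as a subset of `TQ`. -/
def constraintSet (D : ∀ q : Q, Submodule ℝ (TangentSpace (𝓡 N) q)) :
    Set (TangentBundle (𝓡 N) Q) :=
  {v | v.2 ∈ D v.proj}

/-- `W ∈ T_v D`: the vector `W ∈ T_v TQ` is the velocity of a curve in the submanifold `D`. -/
def IsTangentToConstraint (D : ∀ q : Q, Submodule ℝ (TangentSpace (𝓡 N) q))
    (v : TangentBundle (𝓡 N) Q) (W : TangentSpace (𝓡 N).tangent v) : Prop :=
  ∃ c : ℝ → TangentBundle (𝓡 N) Q, c 0 = v ∧ (∀ s, c s ∈ constraintSet D) ∧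
    HasMFDerivAt 𝓘(ℝ, ℝ) (𝓡 N).tangent c 0 ((1 : ℝ →L[ℝ] ℝ).smulRight W)

/-- `W = Γ_nh(v)`: at the point `v ∈ D`, the vector `W ∈ T_v D` is of second order and satisfies
the Lagrange-d'Alembert equations of `(L, D)` with the external force `F`, which say that
`d/dt (∂L/∂q̇) - ∂L/∂q - F` is a reaction force, i.e. annihilates `D`. -/
def IsNonholonomicVector (L : TangentBundle (𝓡 N) Q → ℝ)
    (D : ∀ q : Q, Submodule ℝ (TangentSpace (𝓡 N) q))
    (F : ∀ v : TangentBundle (𝓡 N) Q, TangentSpace (𝓡 N) v.proj →L[ℝ] ℝ)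
    (v : TangentBundle (𝓡 N) Q) (W : TangentSpace (𝓡 N).tangent v) : Prop :=
  v ∈ constraintSet D ∧ IsTangentToConstraint D v W ∧ tangentProj v W = v.2 ∧
    ∀ u ∈ D v.proj, eulerLagrange L v W u = F v u

/-- A nonholonomic trajectory on the set of times `J`: an integral curve of `Γ_nh`. -/
def IsNonholonomicTrajectoryOn (L : TangentBundle (𝓡 N) Q → ℝ)
    (D : ∀ q : Q, Submodule ℝ (TangentSpace (𝓡 N) q))
    (F : ∀ v : TangentBundle (𝓡 N) Q, TangentSpace (𝓡 N) v.proj →L[ℝ] ℝ)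
    (γ : ℝ → TangentBundle (𝓡 N) Q) (J : Set ℝ) : Prop :=
  ∀ t ∈ J, ∃ W : TangentSpace (𝓡 N).tangent (γ t), IsNonholonomicVector L D F (γ t) W ∧
    HasMFDerivWithinAt 𝓘(ℝ, ℝ) (𝓡 N).tangent γ J t ((1 : ℝ →L[ℝ] ℝ).smulRight W)

end Mechanics

/-! ### Chaplygin systems -/

section Chaplygin

variable {N n k : ℕ} {Q : Type*} [TopologicalSpace Q]
  [ChartedSpace (EuclideanSpace ℝ (Fin N)) Q] [IsManifold (𝓡 N) ∞ Q]
  {Qbar : Type*} [TopologicalSpace Qbar]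
  [ChartedSpace (EuclideanSpace ℝ (Fin n)) Qbar] [IsManifold (𝓡 n) ∞ Qbar]

/-- `(L, D)` is a (generalized) Chaplygin system for the free and proper action of the Lie group
`G` on `Q`, and `π : Q → Qbar` is the projection to the reduced space `Qbar = Q/G`, with its unique
smooth structure for which `π` is a submersion. -/
structure IsChaplyginSystem (G : Type*) [TopologicalSpace G]
    [ChartedSpace (EuclideanSpace ℝ (Fin k)) G] [Group G] [LieGroup (𝓡 k) ∞ G]
    [MulAction G Q] [ContMDiffSMul (𝓡 k) (𝓡 N) ∞ G Q] [ProperSMul G Q]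
    (π : Q → Qbar) (L : TangentBundle (𝓡 N) Q → ℝ)
    (D : ∀ q : Q, Submodule ℝ (TangentSpace (𝓡 N) q)) : Prop where
  free : ∀ (g : G) (q : Q), g • q = q → g = 1
  proj_smooth : ContMDiff (𝓡 N) (𝓡 n) ∞ π
  proj_surjective : Function.Surjective π
  proj_submersion : ∀ q, Function.Surjective (mfderiv (𝓡 N) (𝓡 n) π q)
  proj_fiber : ∀ p q, π p = π q ↔ p ∈ MulAction.orbit G q
  lagrangian_smooth : ContMDiff (𝓡 N).tangent 𝓘(ℝ, ℝ) ∞ L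
  lagrangian_regular : ∀ (v : TangentBundle (𝓡 N) Q) (u : TangentSpace (𝓡 N) v.proj),
    (∀ w, fiberHessian L v u w = 0) → u = 0
  lagrangian_invariant : ∀ (g : G) (v : TangentBundle (𝓡 N) Q),
    L (tangentMap (𝓡 N) (𝓡 N) (fun q : Q => g • q) v) = L v
  dist_smooth : IsSmoothDistribution D
  dist_invariant : ∀ (g : G) (q : Q),
    (D q).map (mfderiv (𝓡 N) (𝓡 N) (fun p : Q => g • p) q).toLinearMap = D (g • q)
  dist_compl : ∀ q, IsCompl (D q) (LinearMap.ker (mfderiv (𝓡 N) (𝓡 n) π q).toLinearMap)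

/-- A cyclic force: a force map `F : TQ → T*Q` which respects the symmetry. -/
def IsCyclicForce (G : Type*) [Group G] [MulAction G Q]
    (F : ∀ v : TangentBundle (𝓡 N) Q, TangentSpace (𝓡 N) v.proj →L[ℝ] ℝ) : Prop :=
  ∀ (g : G) (v : TangentBundle (𝓡 N) Q) (u : TangentSpace (𝓡 N) v.proj),
    F (tangentMap (𝓡 N) (𝓡 N) (fun q : Q => g • q) v)
      (mfderiv (𝓡 N) (𝓡 N) (fun q : Q => g • q) v.proj u) = F v u

/-- `l : TQbar → ℝ` is the reduced Lagrangian: `l(X) = L(Xᴴ)`, where the horizontal lift `Xᴴ` of `X`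
to a point `q` is the unique vector in `D q` which projects to `X`. -/
def IsReducedLagrangian (π : Q → Qbar) (D : ∀ q : Q, Submodule ℝ (TangentSpace (𝓡 N) q))
    (L : TangentBundle (𝓡 N) Q → ℝ) (l : TangentBundle (𝓡 n) Qbar → ℝ) : Prop :=
  ∀ v ∈ constraintSet D, l (tangentMap (𝓡 N) (𝓡 n) π v) = L v

/-- `f : TQbar → T*Qbar` is the reduced force: `f(X)(Y) = F(Xᴴ)(Yᴴ)`. -/
def IsReducedForce (π : Q → Qbar) (D : ∀ q : Q, Submodule ℝ (TangentSpace (𝓡 N) q))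
    (F : ∀ v : TangentBundle (𝓡 N) Q, TangentSpace (𝓡 N) v.proj →L[ℝ] ℝ)
    (f : ∀ w : TangentBundle (𝓡 n) Qbar, TangentSpace (𝓡 n) w.proj →L[ℝ] ℝ) : Prop :=
  ∀ v ∈ constraintSet D, ∀ u ∈ D v.proj,
    f (tangentMap (𝓡 N) (𝓡 n) π v) (mfderiv (𝓡 N) (𝓡 n) π v.proj u) = F v u

/-- The tangent map `T(Tπ)` of `Tπ : TQ → TQbar` at `v`. -/
def tangentTangentMap (π : Q → Qbar) (v : TangentBundle (𝓡 N) Q) :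
    TangentSpace (𝓡 N).tangent v →L[ℝ]
      TangentSpace (𝓡 n).tangent (tangentMap (𝓡 N) (𝓡 n) π v) :=
  mfderiv (𝓡 N).tangent (𝓡 n).tangent (tangentMap (𝓡 N) (𝓡 n) π) v

/-- Natural coordinates `(q, q̇)` on `TQbar` induced by a chart `φ` of `Qbar`. -/
def phaseCoord (φ : OpenPartialHomeomorph Qbar (EuclideanSpace ℝ (Fin n)))
    (w : TangentBundle (𝓡 n) Qbar) : EuclideanSpace ℝ (Fin n) × EuclideanSpace ℝ (Fin n) :=
  (φ w.proj, mfderiv (𝓡 n) (𝓡 n) φ w.proj w.2)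

/-- The components `(v, v̇)` of a vector in `T_w TQbar` in the coordinates `phaseCoord φ`. -/
def dPhaseCoord (φ : OpenPartialHomeomorph Qbar (EuclideanSpace ℝ (Fin n)))
    (w : TangentBundle (𝓡 n) Qbar) (X : TangentSpace (𝓡 n).tangent w) :
    EuclideanSpace ℝ (Fin n) × EuclideanSpace ℝ (Fin n) :=
  mfderiv (𝓡 n).tangent 𝓘(ℝ, EuclideanSpace ℝ (Fin n) × EuclideanSpace ℝ (Fin n))
    (phaseCoord φ) w X

/-- The Lagrangian `½ q̇ᵀ M q̇ - ½ qᵀ K q`. -/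
def quadraticLagrangian (M K : Matrix (Fin n) (Fin n) ℝ)
    (z : EuclideanSpace ℝ (Fin n) × EuclideanSpace ℝ (Fin n)) : ℝ :=
  (1 / 2) * (z.2.ofLp ⬝ᵥ (M *ᵥ z.2.ofLp)) - (1 / 2) * (z.1.ofLp ⬝ᵥ (K *ᵥ z.1.ofLp))

/-- The block matrix `[[K, bεI], [bεI, M]]`. -/
def contractionMatrix (M K : Matrix (Fin n) (Fin n) ℝ) (b ε : ℝ) :
    Matrix (Fin n ⊕ Fin n) (Fin n ⊕ Fin n) ℝ :=
  Matrix.fromBlocks K ((b * ε) • (1 : Matrix (Fin n) (Fin n) ℝ))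
    ((b * ε) • (1 : Matrix (Fin n) (Fin n) ℝ)) M

/-- The mechanical contraction metric `𝔾_ε(X, Y)`, in coordinates. -/
def contractionMetric (M K : Matrix (Fin n) (Fin n) ℝ) (b ε : ℝ)
    (X Y : EuclideanSpace ℝ (Fin n) × EuclideanSpace ℝ (Fin n)) : ℝ :=
  Sum.elim X.1.ofLp X.2.ofLp ⬝ᵥ (contractionMatrix M K b ε *ᵥ Sum.elim Y.1.ofLp Y.2.ofLp)

/-- The part of the phase space `D` that lies over the domain of the chart `φ`. -/
def constraintSetOver (π : Q → Qbar) (D : ∀ q : Q, Submodule ℝ (TangentSpace (𝓡 N) q))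
    (φ : OpenPartialHomeomorph Qbar (EuclideanSpace ℝ (Fin n))) :
    Set (TangentBundle (𝓡 N) Q) :=
  {v | v ∈ constraintSet D ∧ π v.proj ∈ φ.source}

/-- The (unforced) reduced dynamics `T(Tπ)(Γ_nh)` of `(L, D)` is, in the chart `φ`, the dynamics of
the mechanical system with Lagrangian `½ q̇ᵀ M q̇ - ½ qᵀ K q`, i.e. `q̈ = -M⁻¹ K q`. -/
def HasQuadraticReducedDynamics (π : Q → Qbar) (L : TangentBundle (𝓡 N) Q → ℝ)
    (D : ∀ q : Q, Submodule ℝ (TangentSpace (𝓡 N) q))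
    (φ : OpenPartialHomeomorph Qbar (EuclideanSpace ℝ (Fin n)))
    (M K : Matrix (Fin n) (Fin n) ℝ) : Prop :=
  ∀ v ∈ constraintSetOver π D φ, ∀ W : TangentSpace (𝓡 N).tangent v,
    IsNonholonomicVector L D (fun _ => 0) v W →
    dPhaseCoord φ _ (tangentTangentMap (n := n) π v W) =
      ((phaseCoord φ (tangentMap (𝓡 N) (𝓡 n) π v)).2,
        WithLp.toLp 2 (-(M⁻¹ *ᵥ (K *ᵥ (phaseCoord φ (tangentMap (𝓡 N) (𝓡 n) π v)).1.ofLp))))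

/-- In the chart `φ`, the force `f` on `Qbar` is `-b q̇ⁱ dqⁱ`. -/
def IsDissipativeInChart (φ : OpenPartialHomeomorph Qbar (EuclideanSpace ℝ (Fin n))) (b : ℝ)
    (f : ∀ w : TangentBundle (𝓡 n) Qbar, TangentSpace (𝓡 n) w.proj →L[ℝ] ℝ) : Prop :=
  ∀ w : TangentBundle (𝓡 n) Qbar, w.proj ∈ φ.source → ∀ u : TangentSpace (𝓡 n) w.proj,
    f w u = -b * ((phaseCoord φ w).2.ofLp ⬝ᵥ (phaseCoord φ ⟨w.proj, u⟩).2.ofLp)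

/-- The set `EP` of equilibrium points of the forced nonholonomic system `(L, D, F)`, i.e. of zeros
of `Γ_nh` in `D`, over the domain of the chart `φ`. -/
def equilibriumSet (π : Q → Qbar) (L : TangentBundle (𝓡 N) Q → ℝ)
    (D : ∀ q : Q, Submodule ℝ (TangentSpace (𝓡 N) q))
    (F : ∀ v : TangentBundle (𝓡 N) Q, TangentSpace (𝓡 N) v.proj →L[ℝ] ℝ)
    (φ : OpenPartialHomeomorph Qbar (EuclideanSpace ℝ (Fin n))) :
    Set (TangentBundle (𝓡 N) Q) :=
  {v | v ∈ constraintSetOver π D φ ∧ IsNonholonomicVector L D F v 0}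

/-! ### Horizontal lifts of the contraction metric and their distances -/

/-- Riemannian metrics on the manifold `TQ`. -/
abbrev TangentBundleMetric (N : ℕ) (Q : Type*) [TopologicalSpace Q]
    [ChartedSpace (EuclideanSpace ℝ (Fin N)) Q] [IsManifold (𝓡 N) ∞ Q] :=
  Bundle.ContMDiffRiemannianMetric (𝓡 N).tangent ∞
    (EuclideanSpace ℝ (Fin N) × EuclideanSpace ℝ (Fin N))
    (fun v : TangentBundle (𝓡 N) Q => TangentSpace (𝓡 N).tangent v)

/-- Horizontal vectors on the phase space: `W ∈ T_v D` whose projection to `TQ` lies in `D`.  These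
form the connection on `Tπ : D → TQbar` induced by the connection `TQ = D ⊕ ker Tπ`.  The horizontal
lift of `X ∈ T TQbar` is the horizontal vector which `T(Tπ)` maps to `X`. -/
def IsHorizontalVector (D : ∀ q : Q, Submodule ℝ (TangentSpace (𝓡 N) q))
    (v : TangentBundle (𝓡 N) Q) (W : TangentSpace (𝓡 N).tangent v) : Prop :=
  IsTangentToConstraint D v W ∧ tangentProj v W ∈ D v.proj

/-- `𝒢` is a horizontal lift of `𝔾_ε`: along `D`, over the domain of the chart,
`𝒢(Xᴴ, Yᴴ) = 𝔾_ε(X, Y)` and `𝒢(Xᴴ, Z) = 0` for `Z` in the vertical distribution `ker T(Tπ)`. -/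
def IsHorizontalLiftMetric (π : Q → Qbar) (D : ∀ q : Q, Submodule ℝ (TangentSpace (𝓡 N) q))
    (φ : OpenPartialHomeomorph Qbar (EuclideanSpace ℝ (Fin n)))
    (M K : Matrix (Fin n) (Fin n) ℝ) (b ε : ℝ) (𝒢 : TangentBundleMetric N Q) : Prop :=
  ∀ v ∈ constraintSetOver π D φ, ∀ X : TangentSpace (𝓡 N).tangent v, IsHorizontalVector D v X →
    (∀ Y : TangentSpace (𝓡 N).tangent v, IsHorizontalVector D v Y →
      𝒢.inner v X Y = contractionMetric M K b ε
        (dPhaseCoord φ _ (tangentTangentMap (n := n) π v X))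
        (dPhaseCoord φ _ (tangentTangentMap (n := n) π v Y))) ∧
    (∀ Z : TangentSpace (𝓡 N).tangent v, tangentTangentMap (n := n) π v Z = 0 →
      𝒢.inner v X Z = 0)

/-- The norm on the tangent spaces of `TQ` defined by `𝒢`. -/
abbrev metricENorm (𝒢 : TangentBundleMetric N Q) (v : TangentBundle (𝓡 N) Q) :
    ENorm (TangentSpace (𝓡 N).tangent v) :=
  ⟨fun W => ENNReal.ofReal (Real.sqrt (𝒢.inner v W W))⟩

/-- The Riemannian distance `d_𝒢` on `TQ`. -/
def metricEDist (𝒢 : TangentBundleMetric N Q) (v w : TangentBundle (𝓡 N) Q) : ℝ≥0∞ :=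
  letI : ∀ u : TangentBundle (𝓡 N) Q, ENorm (TangentSpace (𝓡 N).tangent u) := metricENorm 𝒢
  Manifold.riemannianEDist (𝓡 N).tangent v w

/-- The Riemannian distance in the submanifold `D` with the metric induced by `𝒢`: the infimum of
the `𝒢`-lengths of the `C¹` curves which stay in `D`. -/
def constraintEDist (D : ∀ q : Q, Submodule ℝ (TangentSpace (𝓡 N) q))
    (𝒢 : TangentBundleMetric N Q) (v w : TangentBundle (𝓡 N) Q) : ℝ≥0∞ :=
  letI : ∀ u : TangentBundle (𝓡 N) Q, ENorm (TangentSpace (𝓡 N).tangent u) := metricENorm 𝒢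
  ⨅ (c : ℝ → TangentBundle (𝓡 N) Q)
    (_ : c 0 = v ∧ c 1 = w ∧ (∀ s ∈ Icc (0 : ℝ) 1, c s ∈ constraintSet D) ∧
      ContMDiffOn 𝓘(ℝ, ℝ) (𝓡 N).tangent 1 c (Icc 0 1)),
    Manifold.pathELength (𝓡 N).tangent c 0 1

end Chaplygin

/-! ### Tubular neighbourhoods -/

/-- `U` is a tubular neighbourhood of `S` in the submanifold `A` of the manifold `P`, with
trivialised normal bundle `S × F`: `U ⊇ S` is open in `A` and diffeomorphic to `S × ball 0 r` by a
diffeomorphism which is `s ↦ (s, 0)` on `S`. -/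
def IsTubularNeighborhood {E H P : Type*} [NormedAddCommGroup E] [NormedSpace ℝ E]
    [TopologicalSpace H] (I : ModelWithCorners ℝ E H) [TopologicalSpace P] [ChartedSpace H P]
    (F : Type*) [NormedAddCommGroup F] [NormedSpace ℝ F] (A S U : Set P) : Prop :=
  S ⊆ U ∧ (∃ O : Set P, IsOpen O ∧ U = A ∩ O) ∧
  ∃ r : ℝ, 0 < r ∧ ∃ (Ψ : P × F → P) (Θ : P → P × F),
    MapsTo Ψ (S ×ˢ Metric.ball (0 : F) r) U ∧ MapsTo Θ U (S ×ˢ Metric.ball (0 : F) r) ∧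
    LeftInvOn Θ Ψ (S ×ˢ Metric.ball (0 : F) r) ∧ RightInvOn Θ Ψ U ∧
    ContMDiffOn (I.prod 𝓘(ℝ, F)) I ∞ Ψ (S ×ˢ Metric.ball (0 : F) r) ∧
    ContMDiffOn I (I.prod 𝓘(ℝ, F)) ∞ Θ U ∧
    ∀ s ∈ S, Ψ (s, 0) = s

end

/-!
Over the domain of the chart `φ`, the constraint submanifold `D ⊆ TQ` is parametrised by the base
point `q ∈ Q` and the reduced velocity `y ∈ ℝⁿ`, through the horizontal lift `horMap`. The reduced
state of `v ∈ D` has coordinates `phase φ π v = (z, ż)`, and a vector tangent to `D` is determined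
by its projection to `TQ` and its image under the derivative of the phase.

*Dynamics.* The restriction of `L` to `D` is the quadratic Lagrangian, so changing the acceleration
of a second order vector changes the Euler-Lagrange covector through the mass matrix `M`. Hence
`isNonholonomicVector_iff`: the nonholonomic vector at `v` is the second order vector tangent to `D`
over the vector field of the damped oscillator `M z̈ + b ż + K z = 0`. The equilibria are therefore
the zero vectors over the fibre of `π` at the centre of the chart (`mem_equilibriumSet_iff`), and
the trajectories over the chart are the horizontal lifts of the solutions of the oscillator. These
lifts do not escape in finite time, because local lifts can be translated along the fibres by the
group (`exists_horizontalLift_Ici`, `exists_trajectory`).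

*Decay.* The energy with a small cross term is a strict Lyapunov function of the oscillator
(`exists_isLyapunovDecay`). Its sublevel sets keep trajectories inside the chart, and along them the
norm of the phase decays exponentially, with a rate independent of `ε` (`phase_trajectory_decay`).

*Distances.* For a horizontal lift `𝒢` of the contraction metric, both distances to the equilibria
are compared with the norm of the phase. A tangent vector splits orthogonally into a horizontal
vector and one killed by `T(Tπ)`, so the derivative of the phase is non-expanding on `D`, and the
norm of the phase is bounded by the distance in `D` (`ofReal_phase_le_constraintEDist`). Conversely,
the horizontal lift of the segment from the phase to the origin is a path in `D` to an equilibrium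
whose length is that of the segment (`exists_constraintEDist_le`). The constants come from the matrix
of `𝔾_ε` alone, so they do not depend on the choice of `𝒢`.

*Tubular neighbourhood.* The neighbourhood is a tube `phaseTube`, given by a bound on the norm of
the phase. That it is a product of the set of equilibria and a ball is the local triviality of the
principal bundle `π` (`exists_trivialization`), which follows from the inverse function theorem
since the orbit maps of a free action are immersions, and since properness makes the group element
moving one point to another depend continuously on the two points.
-/


noncomputable section

set_option linter.unusedSectionVars false

/-- Euclidean space of dimension `n`. -/
abbrev Euc (n : ℕ) := EuclideanSpace ℝ (Fin n)

/-! ### Velocities of curves -/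

section Velocity

variable {E H M : Type*} [NormedAddCommGroup E] [NormedSpace ℝ E] [TopologicalSpace H]
  {I : ModelWithCorners ℝ E H} [TopologicalSpace M] [ChartedSpace H M]
  {E' H' M' : Type*} [NormedAddCommGroup E'] [NormedSpace ℝ E'] [TopologicalSpace H']
  {I' : ModelWithCorners ℝ E' H'} [TopologicalSpace M'] [ChartedSpace H' M']
  {c : ℝ → M} {J : Set ℝ} {t : ℝ}

/-- The chain rule for a curve followed by a map. The velocity of a curve is encoded by its manifold
derivative `s ↦ s • W`. -/
theorem HasMFDerivAt.comp_velocityWithin {f : M → M'}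
    {f' : TangentSpace I (c t) →L[ℝ] TangentSpace I' (f (c t))} {W : TangentSpace I (c t)}
    (hf : HasMFDerivAt I I' f (c t) f')
    (hc : HasMFDerivWithinAt 𝓘(ℝ, ℝ) I c J t ((1 : ℝ →L[ℝ] ℝ).smulRight W)) :
    HasMFDerivWithinAt 𝓘(ℝ, ℝ) I' (fun s => f (c s)) J t
      ((1 : ℝ →L[ℝ] ℝ).smulRight (f' W)) := by
  have h := HasMFDerivAt.comp_hasMFDerivWithinAt t hf hc
  have e : f'.comp ((1 : ℝ →L[ℝ] ℝ).smulRight W) = (1 : ℝ →L[ℝ] ℝ).smulRight (f' W) := by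
    refine ContinuousLinearMap.ext fun s => ?_
    exact map_smul f' s W
  rw [← e]
  exact h

theorem HasMFDerivAt.comp_velocity {f : M → M'}
    {f' : TangentSpace I (c t) →L[ℝ] TangentSpace I' (f (c t))} {W : TangentSpace I (c t)}
    (hf : HasMFDerivAt I I' f (c t) f')
    (hc : HasMFDerivAt 𝓘(ℝ, ℝ) I c t ((1 : ℝ →L[ℝ] ℝ).smulRight W)) :
    HasMFDerivAt 𝓘(ℝ, ℝ) I' (fun s => f (c s)) t ((1 : ℝ →L[ℝ] ℝ).smulRight (f' W)) := by
  exact hasMFDerivWithinAt_univ.1 (hf.comp_velocityWithin (hasMFDerivWithinAt_univ.2 hc))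

theorem velocityWithin_prodMk {c' : ℝ → M'} {a : TangentSpace I (c t)}
    {b : TangentSpace I' (c' t)}
    (hc : HasMFDerivWithinAt 𝓘(ℝ, ℝ) I c J t ((1 : ℝ →L[ℝ] ℝ).smulRight a))
    (hc' : HasMFDerivWithinAt 𝓘(ℝ, ℝ) I' c' J t ((1 : ℝ →L[ℝ] ℝ).smulRight b)) :
    HasMFDerivWithinAt 𝓘(ℝ, ℝ) (I.prod I') (fun s => (c s, c' s)) J t
      ((1 : ℝ →L[ℝ] ℝ).smulRight ((a, b) : TangentSpace (I.prod I') (c t, c' t))) :=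
  hc.prodMk hc'

theorem velocity_const (x : M) (t : ℝ) : HasMFDerivAt 𝓘(ℝ, ℝ) I (fun _ : ℝ => x) t
    ((1 : ℝ →L[ℝ] ℝ).smulRight (0 : TangentSpace I x)) := by
  have h := hasMFDerivAt_const (I := 𝓘(ℝ, ℝ)) (I' := I) x t
  have e : ((1 : ℝ →L[ℝ] ℝ).smulRight (0 : TangentSpace I x)) = 0 :=
    ContinuousLinearMap.ext fun s => smul_zero (M := ℝ) (A := TangentSpace I x) s
  exact e.symm ▸ h

theorem velocity_unique {W W' : TangentSpace I (c t)}
    (h : HasMFDerivAt 𝓘(ℝ, ℝ) I c t ((1 : ℝ →L[ℝ] ℝ).smulRight W))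
    (h' : HasMFDerivAt 𝓘(ℝ, ℝ) I c t ((1 : ℝ →L[ℝ] ℝ).smulRight W')) : W = W' := by
  have h1 := congrArg (fun f => f (1 : ℝ)) (hasMFDerivAt_unique h h')
  have e : ∀ w : E, ((1 : ℝ →L[ℝ] ℝ).smulRight w) (1 : ℝ) = w := fun w => by simp
  exact (e W).symm.trans (h1.trans (e W'))

theorem hasMFDerivWithinAt_velocity_iff {f : ℝ → E} {b : E} :
    HasMFDerivWithinAt 𝓘(ℝ, ℝ) 𝓘(ℝ, E) f J t ((1 : ℝ →L[ℝ] ℝ).smulRight b) ↔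
      HasDerivWithinAt f b J t := by
  have h : HasFDerivWithinAt f ((1 : ℝ →L[ℝ] ℝ).smulRight b) J t ↔ HasDerivWithinAt f b J t := by
    rw [hasDerivWithinAt_iff_hasFDerivWithinAt, ContinuousLinearMap.smulRight_one_eq_toSpanSingleton]
  exact hasMFDerivWithinAt_iff_hasFDerivWithinAt.trans h

theorem hasMFDerivAt_velocity_iff {f : ℝ → E} {b : E} :
    HasMFDerivAt 𝓘(ℝ, ℝ) 𝓘(ℝ, E) f t ((1 : ℝ →L[ℝ] ℝ).smulRight b) ↔ HasDerivAt f b t := by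
  have h : HasFDerivAt f ((1 : ℝ →L[ℝ] ℝ).smulRight b) t ↔ HasDerivAt f b t := by
    rw [hasDerivAt_iff_hasFDerivAt, ContinuousLinearMap.smulRight_one_eq_toSpanSingleton]
  exact hasMFDerivAt_iff_hasFDerivAt.trans h

theorem eq_of_hasDerivAt_zero {f : ℝ → E} {a b r : ℝ} (h : ∀ t ∈ Ioo a b, HasDerivAt f 0 t)
    (hr : r ∈ Ioo a b) (ht : t ∈ Ioo a b) : f r = f t :=
  (convex_Ioo a b).is_const_of_fderivWithin_eq_zero (𝕜 := ℝ)
    (fun s hs => (h s hs).differentiableAt.differentiableWithinAt) (fun s hs => by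
      rw [fderivWithin_of_isOpen isOpen_Ioo hs]
      simpa using (h s hs).hasFDerivAt.fderiv) hr ht

end Velocity

/-! ### Natural coordinates of the tangent bundle -/

/-- The derivative of the inverse of the preferred chart at `x` is the identity, because tangent
vectors at `x` are by definition expressed in this chart. -/
theorem hasMFDerivAt_extChartAt_symm_self {E H M : Type*} [NormedAddCommGroup E] [NormedSpace ℝ E]
    [TopologicalSpace H] (I : ModelWithCorners ℝ E H) [I.Boundaryless] [TopologicalSpace M]
    [ChartedSpace H M] [IsManifold I ∞ M] (x : M) :
    HasMFDerivAt 𝓘(ℝ, E) I (extChartAt I x).symm (extChartAt I x x)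
      (ContinuousLinearMap.id ℝ E) := by
  have : IsManifold I 1 M := IsManifold.of_le (n := ∞) ENat.LEInfty.out
  have hmd : MDifferentiableAt 𝓘(ℝ, E) I (extChartAt I x).symm (extChartAt I x x) :=
    ((contMDiffOn_extChartAt_symm (n := ∞) x).contMDiffAt
      (extChartAt_target_mem_nhds x)).mdifferentiableAt (by simp)
  have hd : mfderiv 𝓘(ℝ, E) I (extChartAt I x).symm (extChartAt I x x) =
      ContinuousLinearMap.id ℝ E := by
    have := mfderivWithin_range_extChartAt_symm (I := I) (x := x)
    rwa [I.range_eq_univ, mfderivWithin_univ] at this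
  exact hd ▸ hmd.hasMFDerivAt

section TangentCoordinates

variable {N : ℕ} {Q : Type*} [TopologicalSpace Q] [ChartedSpace (EuclideanSpace ℝ (Fin N)) Q]
  [IsManifold (𝓡 N) ∞ Q]

theorem extChartAt_tangent_apply (v w : TangentBundle (𝓡 N) Q) :
    extChartAt (𝓡 N).tangent v w =
      (extChartAt (𝓡 N) v.proj w.proj, tangentCoordChange (𝓡 N) w.proj v.proj w.proj w.2) := rfl

theorem extChartAt_tangent_fiber (v : TangentBundle (𝓡 N) Q) (u : Euc N) :
    extChartAt (𝓡 N).tangent v (⟨v.proj, u⟩ : TangentBundle (𝓡 N) Q) =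
      (extChartAt (𝓡 N) v.proj v.proj, u) := by
  rw [extChartAt_tangent_apply]
  exact Prod.ext rfl (tangentCoordChange_self (mem_extChartAt_source _))

theorem coordPoint_eq (v : TangentBundle (𝓡 N) Q) :
    coordPoint v = (extChartAt (𝓡 N) v.proj v.proj, (v.2 : Euc N)) :=
  extChartAt_tangent_fiber v v.2

theorem mem_extChartAt_tangent_source_iff (v w : TangentBundle (𝓡 N) Q) :
    w ∈ (extChartAt (𝓡 N).tangent v).source ↔ w.proj ∈ (extChartAt (𝓡 N) v.proj).source := by
  rw [extChartAt_source, extChartAt_source]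
  exact TangentBundle.mem_chart_source_iff w v

theorem extChartAt_tangent_symm_fiber (v : TangentBundle (𝓡 N) Q) (u : Euc N) :
    (extChartAt (𝓡 N).tangent v).symm (extChartAt (𝓡 N) v.proj v.proj, u) =
      (⟨v.proj, u⟩ : TangentBundle (𝓡 N) Q) := by
  rw [← extChartAt_tangent_fiber v u]
  exact (extChartAt (𝓡 N).tangent v).left_inv
    ((mem_extChartAt_tangent_source_iff _ _).2 (mem_extChartAt_source _))

theorem contDiffAt_coordLagrangian {L : TangentBundle (𝓡 N) Q → ℝ}
    (hL : ContMDiff (𝓡 N).tangent 𝓘(ℝ, ℝ) ∞ L) (v : TangentBundle (𝓡 N) Q) :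
    ContDiffAt ℝ ∞ (coordLagrangian L v) (coordPoint v) := by
  have h1 : ContMDiffAt 𝓘(ℝ, Euc N × Euc N) (𝓡 N).tangent ∞ (extChartAt (𝓡 N).tangent v).symm
      (coordPoint v) :=
    (contMDiffOn_extChartAt_symm v).contMDiffAt (extChartAt_target_mem_nhds v)
  exact (hL.contMDiffAt.comp _ h1).contDiffAt

/-- A line in the fiber through `v` has, in the natural coordinates around `v`, a velocity whose
base component vanishes. -/
theorem hasMFDerivAt_fiber_line (v : TangentBundle (𝓡 N) Q) (w : TangentSpace (𝓡 N) v.proj) :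
    HasMFDerivAt 𝓘(ℝ, ℝ) (𝓡 N).tangent
      (fun s : ℝ => (⟨v.proj, v.2 + s • w⟩ : TangentBundle (𝓡 N) Q)) 0
      ((1 : ℝ →L[ℝ] ℝ).smulRight (((0 : Euc N), (w : Euc N)) : Euc N × Euc N)) := by
  have aux : ∀ x a c : Euc N, HasMFDerivAt 𝓘(ℝ, ℝ) 𝓘(ℝ, Euc N × Euc N)
      (fun s : ℝ => (x, a + s • c)) 0 ((1 : ℝ →L[ℝ] ℝ).smulRight ((0 : Euc N), c)) := by
    intro x a c
    have h2 : HasDerivAt (fun s : ℝ => a + s • c) c 0 := by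
      simpa using ((hasDerivAt_id (0 : ℝ)).smul_const c).const_add a
    exact ((hasDerivAt_const (0 : ℝ) x).prodMk h2).hasFDerivAt.hasMFDerivAt
  have h1 := aux (extChartAt (𝓡 N) v.proj v.proj) v.2 w
  have h0 : (fun s : ℝ => ((extChartAt (𝓡 N) v.proj v.proj,
        (v.2 + s • w : TangentSpace (𝓡 N) v.proj)) : Euc N × Euc N)) 0 =
        extChartAt (𝓡 N).tangent v v := by
    rw [← coordPoint, coordPoint_eq v]
    simp only [zero_smul, add_zero]
    rfl
  have h2 := hasMFDerivAt_extChartAt_symm_self (𝓡 N).tangent v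
  rw [← h0] at h2
  refine ((HasMFDerivAt.comp (0 : ℝ) h2 h1).congr_of_eventuallyEq ?_)
  filter_upwards with s
  exact (extChartAt_tangent_symm_fiber v _).symm

end TangentCoordinates

/-! ### The reduced coordinates on the tangent bundle -/

section ReducedCoordinates

variable {N n : ℕ} {Q : Type*} [TopologicalSpace Q]
  [ChartedSpace (EuclideanSpace ℝ (Fin N)) Q] [IsManifold (𝓡 N) ∞ Q]
  {Qbar : Type*} [TopologicalSpace Qbar]
  [ChartedSpace (EuclideanSpace ℝ (Fin n)) Qbar] [IsManifold (𝓡 n) ∞ Qbar]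
  {π : Q → Qbar} {φ : OpenPartialHomeomorph Qbar (EuclideanSpace ℝ (Fin n))}

/-- The derivative `T_q Q → ℝⁿ` of `φ ∘ π`. -/
def redVel (φ : OpenPartialHomeomorph Qbar (EuclideanSpace ℝ (Fin n))) (π : Q → Qbar) (q : Q) :
    TangentSpace (𝓡 N) q →L[ℝ] Euc n :=
  (mfderiv (𝓡 n) (𝓡 n) φ (π q)).comp (mfderiv (𝓡 N) (𝓡 n) π q)

/-- The natural coordinates `(z, ż)` of the reduced state `Tπ(v)`. -/
def phase (φ : OpenPartialHomeomorph Qbar (EuclideanSpace ℝ (Fin n))) (π : Q → Qbar)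
    (v : TangentBundle (𝓡 N) Q) : Euc n × Euc n :=
  phaseCoord φ (tangentMap (𝓡 N) (𝓡 n) π v)

theorem phase_eq (v : TangentBundle (𝓡 N) Q) :
    phase φ π v = (φ (π v.proj), redVel φ π v.proj v.2) := rfl

theorem hasMFDerivAt_chart_proj (hπ : ContMDiff (𝓡 N) (𝓡 n) ∞ π)
    (hφ : φ ∈ IsManifold.maximalAtlas (𝓡 n) ∞ Qbar) {q : Q} (hq : π q ∈ φ.source) :
    HasMFDerivAt (𝓡 N) 𝓘(ℝ, Euc n) (fun q => φ (π q)) q (redVel φ π q) := by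
  have h1 : MDifferentiableAt (𝓡 n) (𝓡 n) φ (π q) :=
    (contMDiffAt_of_mem_maximalAtlas hφ hq).mdifferentiableAt (by simp)
  exact HasMFDerivAt.comp q h1.hasMFDerivAt
    ((hπ.mdifferentiable (by simp)) q).hasMFDerivAt

theorem contMDiffAt_chart_proj (hπ : ContMDiff (𝓡 N) (𝓡 n) ∞ π)
    (hφ : φ ∈ IsManifold.maximalAtlas (𝓡 n) ∞ Qbar) {q : Q} (hq : π q ∈ φ.source) :
    ContMDiffAt (𝓡 N) 𝓘(ℝ, Euc n) ∞ (fun q => φ (π q)) q :=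
  ContMDiffAt.comp q (contMDiffAt_of_mem_maximalAtlas hφ hq) hπ.contMDiffAt

theorem mdifferentiable_of_mem_maximalAtlas
    (hφ : φ ∈ IsManifold.maximalAtlas (𝓡 n) ∞ Qbar) : φ.MDifferentiable (𝓡 n) (𝓡 n) :=
  ⟨fun _ hx => ((contMDiffAt_of_mem_maximalAtlas hφ hx).mdifferentiableAt
      (by simp)).mdifferentiableWithinAt,
    fun _ hx => ((contMDiffAt_symm_of_mem_maximalAtlas hφ hx).mdifferentiableAt
      (by simp)).mdifferentiableWithinAt⟩

theorem contMDiffAt_phaseCoord (hφ : φ ∈ IsManifold.maximalAtlas (𝓡 n) ∞ Qbar)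
    {w : TangentBundle (𝓡 n) Qbar} (hw : w.proj ∈ φ.source) :
    ContMDiffAt (𝓡 n).tangent 𝓘(ℝ, Euc n × Euc n) ∞ (phaseCoord φ) w := by
  have h1 : ContMDiffOn (𝓡 n).tangent (𝓡 n).tangent ∞ (tangentMapWithin (𝓡 n) (𝓡 n) φ φ.source)
      (Bundle.TotalSpace.proj ⁻¹' φ.source) :=
    (contMDiffOn_of_mem_maximalAtlas hφ).contMDiffOn_tangentMapWithin (by simp)
      φ.open_source.uniqueMDiffOn
  have hopen : (Bundle.TotalSpace.proj ⁻¹' φ.source : Set (TangentBundle (𝓡 n) Qbar)) ∈ 𝓝 w :=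
    (φ.open_source.preimage (FiberBundle.continuous_proj _ _)).mem_nhds hw
  have h2 := (h1 w hw).contMDiffAt hopen
  have h3 := (contMDiff_tangentBundleModelSpaceHomeomorph (I := 𝓡 n) (n := ∞)).contMDiffAt.comp
    w h2
  have h4 : ContMDiffAt (𝓡 n).tangent 𝓘(ℝ, Euc n × Euc n) ∞
      (fun w => (((tangentMapWithin (𝓡 n) (𝓡 n) φ φ.source w).1,
        (tangentMapWithin (𝓡 n) (𝓡 n) φ φ.source w).2) : Euc n × Euc n)) w := by
    rw [modelWithCornersSelf_prod]
    exact h3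
  refine h4.congr_of_eventuallyEq ?_
  filter_upwards [hopen] with w' hw'
  rw [tangentMapWithin, mfderivWithin_of_isOpen φ.open_source hw']
  rfl

theorem contMDiffAt_phase (hπ : ContMDiff (𝓡 N) (𝓡 n) ∞ π)
    (hφ : φ ∈ IsManifold.maximalAtlas (𝓡 n) ∞ Qbar) {v : TangentBundle (𝓡 N) Q}
    (hv : π v.proj ∈ φ.source) :
    ContMDiffAt (𝓡 N).tangent 𝓘(ℝ, Euc n × Euc n) ∞ (phase φ π) v :=
  ContMDiffAt.comp v (contMDiffAt_phaseCoord hφ (w := tangentMap (𝓡 N) (𝓡 n) π v) hv)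
    (hπ.contMDiff_tangentMap (by simp)).contMDiffAt

/-- The derivative of `phase φ π` at `v`. -/
def dPhase (φ : OpenPartialHomeomorph Qbar (EuclideanSpace ℝ (Fin n))) (π : Q → Qbar)
    (v : TangentBundle (𝓡 N) Q) : TangentSpace (𝓡 N).tangent v →L[ℝ] Euc n × Euc n :=
  mfderiv (𝓡 N).tangent 𝓘(ℝ, Euc n × Euc n) (phase φ π) v

theorem hasMFDerivAt_phase (hπ : ContMDiff (𝓡 N) (𝓡 n) ∞ π)
    (hφ : φ ∈ IsManifold.maximalAtlas (𝓡 n) ∞ Qbar) {v : TangentBundle (𝓡 N) Q}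
    (hv : π v.proj ∈ φ.source) :
    HasMFDerivAt (𝓡 N).tangent 𝓘(ℝ, Euc n × Euc n) (phase φ π) v (dPhase φ π v) :=
  ((contMDiffAt_phase hπ hφ hv).mdifferentiableAt (by simp)).hasMFDerivAt

theorem dPhase_apply (hπ : ContMDiff (𝓡 N) (𝓡 n) ∞ π)
    (hφ : φ ∈ IsManifold.maximalAtlas (𝓡 n) ∞ Qbar) {v : TangentBundle (𝓡 N) Q}
    (hv : π v.proj ∈ φ.source) (W : TangentSpace (𝓡 N).tangent v) :
    dPhase φ π v W = dPhaseCoord φ _ (tangentTangentMap (n := n) π v W) := by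
  have h1 := ((contMDiffAt_phaseCoord hφ (w := tangentMap (𝓡 N) (𝓡 n) π v) hv).mdifferentiableAt
    (by simp)).hasMFDerivAt
  have h2 : MDifferentiableAt (𝓡 N).tangent (𝓡 n).tangent (tangentMap (𝓡 N) (𝓡 n) π) v :=
    ((hπ.contMDiff_tangentMap (m := ∞) (by simp)).mdifferentiable (by simp)) v
  have h3 := (HasMFDerivAt.comp v h1 h2.hasMFDerivAt).mfderiv
  have h4 : dPhase φ π v = (mfderiv (𝓡 n).tangent 𝓘(ℝ, Euc n × Euc n) (phaseCoord φ)
      (tangentMap (𝓡 N) (𝓡 n) π v)).comp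
      (mfderiv (𝓡 N).tangent (𝓡 n).tangent (tangentMap (𝓡 N) (𝓡 n) π) v) := h3
  rw [h4]; rfl

/-- The components of a tangent vector of `TQbar` determine it. -/
theorem eq_zero_of_dPhaseCoord_eq_zero (hφ : φ ∈ IsManifold.maximalAtlas (𝓡 n) ∞ Qbar)
    {w : TangentBundle (𝓡 n) Qbar} (hw : w.proj ∈ φ.source)
    {X : TangentSpace (𝓡 n).tangent w} (hX : dPhaseCoord φ w X = 0) : X = 0 := by
  -- the inverse of `phaseCoord φ` is the tangent map of the inverse chart
  let ψ : Euc n × Euc n → TangentBundle (𝓡 n) Qbar := fun p =>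
    tangentMapWithin (𝓡 n) (𝓡 n) φ.symm φ.target
      ((tangentBundleModelSpaceHomeomorph (𝓡 n)).symm p)
  have hmem : φ w.proj ∈ φ.target := φ.map_source hw
  have h1 : ContMDiffOn (𝓡 n).tangent (𝓡 n).tangent ∞
      (tangentMapWithin (𝓡 n) (𝓡 n) φ.symm φ.target) (Bundle.TotalSpace.proj ⁻¹' φ.target) :=
    (contMDiffOn_symm_of_mem_maximalAtlas hφ).contMDiffOn_tangentMapWithin (by simp)
      φ.open_target.uniqueMDiffOn
  have hopen : (Bundle.TotalSpace.proj ⁻¹' φ.target : Set (TangentBundle (𝓡 n) (Euc n))) ∈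
      𝓝 ((tangentBundleModelSpaceHomeomorph (𝓡 n)).symm (phaseCoord φ w)) :=
    (φ.open_target.preimage (FiberBundle.continuous_proj _ _)).mem_nhds hmem
  have h2 : MDifferentiableAt (𝓡 n).tangent (𝓡 n).tangent
      (tangentMapWithin (𝓡 n) (𝓡 n) φ.symm φ.target)
      ((tangentBundleModelSpaceHomeomorph (𝓡 n)).symm (phaseCoord φ w)) :=
    (h1.contMDiffAt hopen).mdifferentiableAt (by simp)
  have h3 : MDifferentiableAt 𝓘(ℝ, Euc n × Euc n) (𝓡 n).tangent
      (fun p : Euc n × Euc n => (tangentBundleModelSpaceHomeomorph (𝓡 n)).symm p)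
      (phaseCoord φ w) := by
    rw [modelWithCornersSelf_prod]
    exact ((contMDiff_tangentBundleModelSpaceHomeomorph_symm (I := 𝓡 n) (n := ∞)).mdifferentiable
      (by simp)) _
  have h4 : MDifferentiableAt 𝓘(ℝ, Euc n × Euc n) (𝓡 n).tangent ψ (phaseCoord φ w) :=
    MDifferentiableAt.comp _ h2 h3
  have h5 := ((contMDiffAt_phaseCoord hφ hw).mdifferentiableAt (by simp)).hasMFDerivAt
  have h6 := HasMFDerivAt.comp w h4.hasMFDerivAt h5
  have hid : (ψ ∘ phaseCoord φ) =ᶠ[𝓝 w] id := by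
    filter_upwards [(φ.open_source.preimage (FiberBundle.continuous_proj _ _)).mem_nhds hw]
      with w' hw'
    have hw' : w'.proj ∈ φ.source := hw'
    have hm' : φ w'.proj ∈ φ.target := φ.map_source hw'
    have hd := (mdifferentiable_of_mem_maximalAtlas hφ).symm_comp_deriv hw'
    have e1 : φ.symm (φ w'.proj) = w'.proj := φ.left_inv hw'
    have e2 : mfderivWithin (𝓡 n) (𝓡 n) φ.symm φ.target (φ w'.proj)
        (mfderiv (𝓡 n) (𝓡 n) φ w'.proj w'.2) = w'.2 := by
      rw [mfderivWithin_of_isOpen φ.open_target hm']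
      exact congrArg (fun f => f w'.2) hd
    exact Bundle.TotalSpace.ext e1 (heq_of_eq e2)
  have h7 := (hasMFDerivAt_id (I := (𝓡 n).tangent) w).congr_of_eventuallyEq hid
  have h8 := hasMFDerivAt_unique h7 h6
  have h9 := congrArg (fun f => f X) h8
  have h10 : X = (mfderiv 𝓘(ℝ, Euc n × Euc n) (𝓡 n).tangent ψ (phaseCoord φ w))
    (dPhaseCoord φ w X) := h9
  rw [h10, hX]
  exact map_zero _

/-- The kernel of the derivative of the phase is the vertical distribution `ker T(Tπ)`. -/
theorem dPhase_eq_zero_iff (hπ : ContMDiff (𝓡 N) (𝓡 n) ∞ π)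
    (hφ : φ ∈ IsManifold.maximalAtlas (𝓡 n) ∞ Qbar) {v : TangentBundle (𝓡 N) Q}
    (hv : π v.proj ∈ φ.source) (W : TangentSpace (𝓡 N).tangent v) :
    dPhase φ π v W = 0 ↔ tangentTangentMap (n := n) π v W = 0 := by
  rw [dPhase_apply hπ hφ hv]
  refine ⟨fun h => eq_zero_of_dPhaseCoord_eq_zero hφ hv h, fun h => ?_⟩
  rw [h]; exact map_zero _

end ReducedCoordinates

/-! ### Horizontal lifts -/

section HorizontalLift

variable {N n : ℕ} {Q : Type*} [TopologicalSpace Q]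
  [ChartedSpace (EuclideanSpace ℝ (Fin N)) Q] [IsManifold (𝓡 N) ∞ Q]
  {Qbar : Type*} [TopologicalSpace Qbar]
  [ChartedSpace (EuclideanSpace ℝ (Fin n)) Qbar] [IsManifold (𝓡 n) ∞ Qbar]
  {π : Q → Qbar} {D : ∀ q : Q, Submodule ℝ (TangentSpace (𝓡 N) q)}
  {φ : OpenPartialHomeomorph Qbar (EuclideanSpace ℝ (Fin n))}

/-- `D` is the horizontal distribution of a smooth (Ehresmann) connection for the submersion `π`. -/
structure IsHorizontalDistribution (π : Q → Qbar)
    (D : ∀ q : Q, Submodule ℝ (TangentSpace (𝓡 N) q)) : Prop where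
  proj_smooth : ContMDiff (𝓡 N) (𝓡 n) ∞ π
  proj_submersion : ∀ q, Function.Surjective (mfderiv (𝓡 N) (𝓡 n) π q)
  dist_smooth : IsSmoothDistribution D
  dist_compl : ∀ q, IsCompl (D q) (LinearMap.ker (mfderiv (𝓡 N) (𝓡 n) π q).toLinearMap)

theorem IsHorizontalDistribution.existsUnique (hD : IsHorizontalDistribution (n := n) π D)
    (hφ : φ ∈ IsManifold.maximalAtlas (𝓡 n) ∞ Qbar) {q : Q} (hq : π q ∈ φ.source) (y : Euc n) :
    ∃! u, u ∈ D q ∧ redVel φ π q u = y := by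
  have hbij := (mdifferentiable_of_mem_maximalAtlas hφ).mfderiv_bijective hq
  obtain ⟨x, hx⟩ := hbij.2 y
  obtain ⟨a, ha⟩ := hD.proj_submersion q x
  have hc := hD.dist_compl q
  obtain ⟨u, hu, k, hk, huk⟩ := Submodule.mem_sup.1 (hc.sup_eq_top ▸ Submodule.mem_top (x := a))
  have hk0 : mfderiv (𝓡 N) (𝓡 n) π q k = 0 := hk
  have huy : redVel φ π q u = y := by
    have h1 : mfderiv (𝓡 N) (𝓡 n) π q u = x := by
      rw [← ha, ← huk, map_add, hk0, add_zero]
    have h2 : redVel φ π q u = mfderiv (𝓡 n) (𝓡 n) φ (π q) (mfderiv (𝓡 N) (𝓡 n) π q u) := rfl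
    rw [h2, h1]; exact hx
  refine ⟨u, ⟨hu, huy⟩, fun u' hu' => ?_⟩
  have h3 : mfderiv (𝓡 n) (𝓡 n) φ (π q) (mfderiv (𝓡 N) (𝓡 n) π q u') =
      mfderiv (𝓡 n) (𝓡 n) φ (π q) (mfderiv (𝓡 N) (𝓡 n) π q u) := hu'.2.trans huy.symm
  have h4 : u' - u ∈ LinearMap.ker (mfderiv (𝓡 N) (𝓡 n) π q).toLinearMap := by
    rw [LinearMap.mem_ker]
    have : mfderiv (𝓡 N) (𝓡 n) π q (u' - u) = 0 := by
      rw [map_sub, hbij.1 h3, sub_self]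
    exact this
  exact sub_eq_zero.1 ((Submodule.disjoint_def.1 hc.disjoint) _ ((D q).sub_mem hu'.1 hu) h4)

open Classical in
/-- The horizontal lift to `q` of the vector with components `y` in the chart `φ`: the vector of
`D q` which projects to it, and `0` if there is no such vector, which can happen only if `π q` is
not in the domain of the chart. -/
def horLift (D : ∀ q : Q, Submodule ℝ (TangentSpace (𝓡 N) q))
    (φ : OpenPartialHomeomorph Qbar (EuclideanSpace ℝ (Fin n))) (π : Q → Qbar) (q : Q)
    (y : Euc n) : TangentSpace (𝓡 N) q :=
  if h : ∃ u, u ∈ D q ∧ redVel φ π q u = y then h.choose else 0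

theorem horLift_mem (q : Q) (y : Euc n) : horLift D φ π q y ∈ D q := by
  unfold horLift
  split_ifs with h
  · exact h.choose_spec.1
  · exact (D q).zero_mem

theorem redVel_horLift (hD : IsHorizontalDistribution (n := n) π D)
    (hφ : φ ∈ IsManifold.maximalAtlas (𝓡 n) ∞ Qbar) {q : Q} (hq : π q ∈ φ.source) (y : Euc n) :
    redVel φ π q (horLift D φ π q y) = y := by
  have h := (hD.existsUnique hφ hq y).exists
  rw [horLift, dif_pos h]
  exact h.choose_spec.2

theorem eq_horLift (hD : IsHorizontalDistribution (n := n) π D)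
    (hφ : φ ∈ IsManifold.maximalAtlas (𝓡 n) ∞ Qbar) {q : Q} (hq : π q ∈ φ.source)
    {u : TangentSpace (𝓡 N) q} (hu : u ∈ D q) {y : Euc n} (h : redVel φ π q u = y) :
    u = horLift D φ π q y :=
  (hD.existsUnique hφ hq y).unique ⟨hu, h⟩ ⟨horLift_mem q y, redVel_horLift hD hφ hq y⟩

theorem redVel_injOn (hD : IsHorizontalDistribution (n := n) π D)
    (hφ : φ ∈ IsManifold.maximalAtlas (𝓡 n) ∞ Qbar) {q : Q} (hq : π q ∈ φ.source)
    {u : TangentSpace (𝓡 N) q} (hu : u ∈ D q) (h : redVel φ π q u = 0) : u = 0 :=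
  (hD.existsUnique hφ hq 0).unique ⟨hu, h⟩ ⟨(D q).zero_mem, map_zero _⟩

/-- The horizontal lift as a map `Q × ℝⁿ → TQ`; over the chart it parametrises the constraint
submanifold `D`. -/
def horMap (D : ∀ q : Q, Submodule ℝ (TangentSpace (𝓡 N) q))
    (φ : OpenPartialHomeomorph Qbar (EuclideanSpace ℝ (Fin n))) (π : Q → Qbar)
    (p : Q × Euc n) : TangentBundle (𝓡 N) Q :=
  ⟨p.1, horLift D φ π p.1 p.2⟩

theorem horMap_mem (p : Q × Euc n) : horMap D φ π p ∈ constraintSet D := horLift_mem p.1 p.2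

theorem phase_horMap (hD : IsHorizontalDistribution (n := n) π D)
    (hφ : φ ∈ IsManifold.maximalAtlas (𝓡 n) ∞ Qbar) {p : Q × Euc n} (hp : π p.1 ∈ φ.source) :
    phase φ π (horMap D φ π p) = (φ (π p.1), p.2) :=
  Prod.ext rfl (redVel_horLift hD hφ hp p.2)

theorem horMap_phase (hD : IsHorizontalDistribution (n := n) π D)
    (hφ : φ ∈ IsManifold.maximalAtlas (𝓡 n) ∞ Qbar) {v : TangentBundle (𝓡 N) Q}
    (hv : v ∈ constraintSetOver π D φ) :
    horMap D φ π (v.proj, (phase φ π v).2) = v := by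
  have h := eq_horLift hD hφ hv.2 hv.1 (y := (phase φ π v).2) rfl
  exact Bundle.TotalSpace.ext rfl (heq_of_eq h.symm)

/-- The horizontal lift is smooth: near `q` it is a combination of local sections of `D`, whose
coefficients are found by inverting the matrix of the reduced components of these sections. -/
theorem contMDiffAt_horMap (hD : IsHorizontalDistribution (n := n) π D)
    (hφ : φ ∈ IsManifold.maximalAtlas (𝓡 n) ∞ Qbar) {p : Q × Euc n} (hp : π p.1 ∈ φ.source) :
    ContMDiffAt ((𝓡 N).prod 𝓘(ℝ, Euc n)) (𝓡 N).tangent ∞ (horMap D φ π) p := by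
  obtain ⟨q, y⟩ := p
  simp only at hp
  -- local sections of `D` which at `q` are the lifts of the standard basis
  choose O X hO hqO hXq hXD hX using fun i : Fin n =>
    hD.dist_smooth q (horLift D φ π q (EuclideanSpace.single i 1)) (horLift_mem _ _)
  have hXat : ∀ i, ContMDiffAt (𝓡 N) (𝓡 N).tangent ∞
      (fun p => (⟨p, X i p⟩ : TangentBundle (𝓡 N) Q)) q := fun i =>
    (hX i).contMDiffAt ((hO i).mem_nhds (hqO i))
  let x : Fin n → Q → Euc N := fun i p => tangentCoordChange (𝓡 N) p q p (X i p)
  have hx : ∀ i, ContMDiffAt (𝓡 N) 𝓘(ℝ, Euc N) ∞ (x i) q := fun i =>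
    (Bundle.contMDiffAt_totalSpace.1 (hXat i)).2
  let β : Fin n → Q → Euc n := fun i p => redVel φ π p (X i p)
  have hβ : ∀ i, ContMDiffAt (𝓡 N) 𝓘(ℝ, Euc n) ∞ (β i) q := fun i => by
    have h1 := (contMDiffAt_phase hD.proj_smooth hφ (v := ⟨q, X i q⟩) hp).comp q (hXat i)
    exact (contDiff_snd.contDiffAt.contMDiffAt :
      ContMDiffAt 𝓘(ℝ, Euc n × Euc n) 𝓘(ℝ, Euc n) ∞ Prod.snd _).comp q h1
  let B : Q → (Euc n →L[ℝ] Euc n) := fun p =>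
    ∑ i, (EuclideanSpace.proj i : Euc n →L[ℝ] ℝ).smulRight (β i p)
  have hB : ContMDiffAt (𝓡 N) 𝓘(ℝ, Euc n →L[ℝ] Euc n) ∞ B q := by
    refine ContMDiffAt.sum fun i _ => ?_
    exact (ContinuousLinearMap.contMDiff (ContinuousLinearMap.smulRightL ℝ (Euc n) (Euc n)
      (EuclideanSpace.proj i : Euc n →L[ℝ] ℝ))).contMDiffAt.comp q (hβ i)
  have hBq : B q = ContinuousLinearMap.id ℝ (Euc n) := by
    ext y j
    have : ∀ i, β i q = EuclideanSpace.single i 1 := fun i => by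
      simp only [β, hXq i]
      exact redVel_horLift hD hφ hp _
    simp [B, this, Finset.sum_apply, Pi.single_apply]
  have hinv : ContMDiffAt (𝓡 N) 𝓘(ℝ, Euc n →L[ℝ] Euc n) ∞ (fun p => (B p).inverse) q := by
    have h := contDiffAt_map_inverse (𝕜 := ℝ) (n := ∞) (ContinuousLinearEquiv.refl ℝ (Euc n))
    have hBq' : B q = (ContinuousLinearEquiv.refl ℝ (Euc n) : Euc n →L[ℝ] Euc n) := hBq
    rw [← hBq'] at h
    exact h.contMDiffAt.comp q hB
  have hunit : ∀ᶠ p in 𝓝 q, ∀ c, B p ((B p).inverse c) = c := by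
    have h := (ContinuousLinearEquiv.refl ℝ (Euc n)).nhds
    have hBq' : B q = (ContinuousLinearEquiv.refl ℝ (Euc n) : Euc n →L[ℝ] Euc n) := hBq
    rw [← hBq'] at h
    filter_upwards [hB.continuousAt h] with p hp' c
    obtain ⟨e, he⟩ := hp'
    rw [← he, ContinuousLinearMap.inverse_equiv]
    exact e.apply_symm_apply c
  have hopen : ∀ᶠ p in 𝓝 q, π p ∈ φ.source :=
    hD.proj_smooth.continuous.continuousAt (φ.open_source.mem_nhds hp)
  have hOall : ∀ᶠ p in 𝓝 q, ∀ i, p ∈ O i :=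
    eventually_all.2 fun i => (hO i).mem_nhds (hqO i)
  have key : ∀ᶠ p in 𝓝 q, ∀ c, horLift D φ π p c = ∑ i, ((B p).inverse c) i • X i p := by
    filter_upwards [hunit, hopen, hOall] with p h1 h2 h3 c
    refine (eq_horLift hD hφ h2 ?_ ?_).symm
    · exact Submodule.sum_mem _ fun i _ => (D p).smul_mem _ (hXD i p (h3 i))
    · conv_rhs => rw [← h1 c]
      rw [map_sum]
      simp only [map_smul, B, _root_.sum_apply, ContinuousLinearMap.smulRight_apply]
      rfl
  refine Bundle.contMDiffAt_totalSpace.2 ⟨contMDiffAt_fst, ?_⟩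
  have h1 : ContMDiffAt ((𝓡 N).prod 𝓘(ℝ, Euc n)) 𝓘(ℝ, Euc N) ∞
      (fun p : Q × Euc n => ∑ i, ((B p.1).inverse p.2) i • x i p.1) (q, y) := by
    refine ContMDiffAt.sum fun i _ => ?_
    have h2 : ContMDiffAt ((𝓡 N).prod 𝓘(ℝ, Euc n)) 𝓘(ℝ, Euc n) ∞
        (fun p : Q × Euc n => (B p.1).inverse p.2) (q, y) :=
      ContMDiffAt.clm_apply (hinv.comp (q, y) contMDiffAt_fst) contMDiffAt_snd
    have h3 : ContMDiffAt ((𝓡 N).prod 𝓘(ℝ, Euc n)) 𝓘(ℝ, ℝ) ∞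
        (fun p : Q × Euc n => ((B p.1).inverse p.2) i) (q, y) :=
      (EuclideanSpace.proj i : Euc n →L[ℝ] ℝ).contMDiff.contMDiffAt.comp (q, y) h2
    exact h3.smul ((hx i).comp (q, y) contMDiffAt_fst)
  refine h1.congr_of_eventuallyEq ?_
  filter_upwards [continuousAt_fst.eventually key] with p hp'
  have h2 : (trivializationAt (Euc N) (TangentSpace (𝓡 N)) q (horMap D φ π p)).2 =
    tangentCoordChange (𝓡 N) p.1 q p.1 (horLift D φ π p.1 p.2) := rfl
  refine h2.trans ?_
  rw [hp' p.2]
  have aux : ∀ (T : Euc N →L[ℝ] Euc N) (c : Fin n → ℝ) (Y : Fin n → Euc N),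
      T (∑ i, c i • Y i) = ∑ i, c i • T (Y i) := fun T c Y => by simp
  exact aux (tangentCoordChange (𝓡 N) p.1 q p.1) _ fun i => X i p.1

/-! ### Vectors tangent to the constraint submanifold -/

/-- The derivative of `horMap` at `(q, y)`, as a function of the velocities `a` of `q` and `b` of
`y`. -/
def dHorMap (D : ∀ q : Q, Submodule ℝ (TangentSpace (𝓡 N) q))
    (φ : OpenPartialHomeomorph Qbar (EuclideanSpace ℝ (Fin n))) (π : Q → Qbar)
    (p : Q × Euc n) (a : TangentSpace (𝓡 N) p.1) (b : Euc n) :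
    TangentSpace (𝓡 N).tangent (horMap D φ π p) :=
  mfderiv ((𝓡 N).prod 𝓘(ℝ, Euc n)) (𝓡 N).tangent (horMap D φ π) p (a, b)

/-- The chain rule for a curve in `Q × ℝⁿ` followed by `horMap`. -/
theorem velocityWithin_horMap (hD : IsHorizontalDistribution (n := n) π D)
    (hφ : φ ∈ IsManifold.maximalAtlas (𝓡 n) ∞ Qbar) {c : ℝ → Q} {y : ℝ → Euc n} {J : Set ℝ}
    {t : ℝ} (ht : π (c t) ∈ φ.source) {a : TangentSpace (𝓡 N) (c t)} {b : Euc n}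
    (hc : HasMFDerivWithinAt 𝓘(ℝ, ℝ) (𝓡 N) c J t ((1 : ℝ →L[ℝ] ℝ).smulRight a))
    (hy : HasDerivWithinAt y b J t) :
    HasMFDerivWithinAt 𝓘(ℝ, ℝ) (𝓡 N).tangent (fun s => horMap D φ π (c s, y s)) J t
      ((1 : ℝ →L[ℝ] ℝ).smulRight (dHorMap D φ π (c t, y t) a b)) := by
  have h1 := ((contMDiffAt_horMap hD hφ (p := (c t, y t)) ht).mdifferentiableAt
    (by simp)).hasMFDerivAt
  exact HasMFDerivAt.comp_velocityWithin (c := fun s => (c s, y s)) h1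
    (velocityWithin_prodMk hc (hasMFDerivWithinAt_velocity_iff.2 hy))

theorem hasMFDerivAt_tangentProj (v : TangentBundle (𝓡 N) Q) :
    HasMFDerivAt (𝓡 N).tangent (𝓡 N) (Bundle.TotalSpace.proj : TangentBundle (𝓡 N) Q → Q) v
      (tangentProj v) :=
  (((Bundle.contMDiff_proj (IB := 𝓡 N) (n := ∞) (TangentSpace (𝓡 N) : Q → Type _)).mdifferentiable
    (by simp)) v).hasMFDerivAt

/-- The first half of the phase of `v` depends on the base point of `v` only. -/
theorem dPhase_fst (hD : IsHorizontalDistribution (n := n) π D)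
    (hφ : φ ∈ IsManifold.maximalAtlas (𝓡 n) ∞ Qbar) {v : TangentBundle (𝓡 N) Q}
    (hv : π v.proj ∈ φ.source) (W : TangentSpace (𝓡 N).tangent v) :
    (dPhase φ π v W).1 = redVel φ π v.proj (tangentProj v W) := by
  have h1 := HasMFDerivAt.comp v (hasMFDerivAt_chart_proj hD.proj_smooth hφ hv)
    (hasMFDerivAt_tangentProj v)
  have h2 : HasMFDerivAt 𝓘(ℝ, Euc n × Euc n) 𝓘(ℝ, Euc n) Prod.fst (phase φ π v)
    (ContinuousLinearMap.fst ℝ (Euc n) (Euc n)) := hasFDerivAt_fst.hasMFDerivAt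
  have h3 := HasMFDerivAt.comp v h2 (hasMFDerivAt_phase hD.proj_smooth hφ hv)
  exact congrArg (fun f => f W) (hasMFDerivAt_unique h3 h1)

theorem hasDerivWithinAt_phase {c : ℝ → TangentBundle (𝓡 N) Q} {t : ℝ}
    (hD : IsHorizontalDistribution (n := n) π D)
    (hφ : φ ∈ IsManifold.maximalAtlas (𝓡 n) ∞ Qbar) (ht : π (c t).proj ∈ φ.source)
    {W : TangentSpace (𝓡 N).tangent (c t)} {J : Set ℝ}
    (hc : HasMFDerivWithinAt 𝓘(ℝ, ℝ) (𝓡 N).tangent c J t ((1 : ℝ →L[ℝ] ℝ).smulRight W)) :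
    HasDerivWithinAt (fun s => phase φ π (c s)) (dPhase φ π (c t) W) J t :=
  hasMFDerivWithinAt_velocity_iff.1
    ((hasMFDerivAt_phase hD.proj_smooth hφ ht).comp_velocityWithin hc)

theorem hasDerivWithinAt_phase_snd {c : ℝ → TangentBundle (𝓡 N) Q} {t : ℝ}
    (hD : IsHorizontalDistribution (n := n) π D)
    (hφ : φ ∈ IsManifold.maximalAtlas (𝓡 n) ∞ Qbar) (ht : π (c t).proj ∈ φ.source)
    {W : TangentSpace (𝓡 N).tangent (c t)} {J : Set ℝ}
    (hc : HasMFDerivWithinAt 𝓘(ℝ, ℝ) (𝓡 N).tangent c J t ((1 : ℝ →L[ℝ] ℝ).smulRight W)) :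
    HasDerivWithinAt (fun s => (phase φ π (c s)).2) (dPhase φ π (c t) W).2 J t :=
  (ContinuousLinearMap.snd ℝ (Euc n) (Euc n)).hasFDerivAt.comp_hasDerivWithinAt t
    (hasDerivWithinAt_phase hD hφ ht hc)

/-- Vectors tangent to `D` are in the range of the derivative of `horMap`. -/
theorem IsTangentToConstraint.eq_dHorMap (hD : IsHorizontalDistribution (n := n) π D)
    (hφ : φ ∈ IsManifold.maximalAtlas (𝓡 n) ∞ Qbar) {p : Q × Euc n} (hp : π p.1 ∈ φ.source)
    {W : TangentSpace (𝓡 N).tangent (horMap D φ π p)}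
    (hW : IsTangentToConstraint D (horMap D φ π p) W) :
    W = dHorMap D φ π p (tangentProj _ W) (dPhase φ π _ W).2 := by
  obtain ⟨c, hc0, hcD, hc⟩ := hW
  have key : ∀ (v : TangentBundle (𝓡 N) Q) (W : TangentSpace (𝓡 N).tangent v), c 0 = v →
      HasMFDerivAt 𝓘(ℝ, ℝ) (𝓡 N).tangent c 0 ((1 : ℝ →L[ℝ] ℝ).smulRight W) →
      ∀ p : Q × Euc n, π p.1 ∈ φ.source → p = (v.proj, (phase φ π v).2) →
      (W : Euc N × Euc N) = dHorMap D φ π p (tangentProj v W) (dPhase φ π v W).2 := by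
    rintro _ W rfl hc p hp rfl
    have h1 := (hasMFDerivAt_tangentProj (c 0)).comp_velocity hc
    have h3 := hasDerivWithinAt_phase_snd hD hφ hp (hasMFDerivWithinAt_univ.2 hc)
    have h4 := velocityWithin_horMap hD hφ (c := fun s => (c s).proj) hp
      (hasMFDerivWithinAt_univ.2 h1) h3
    replace h4 := hasMFDerivWithinAt_univ.1 h4
    have h5 : (fun s => horMap D φ π ((c s).proj, (phase φ π (c s)).2)) =ᶠ[𝓝 0] c := by
      have : ∀ᶠ s in 𝓝 (0 : ℝ), π (c s).proj ∈ φ.source :=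
        (hD.proj_smooth.continuous.continuousAt.comp
          (h1.continuousAt)).eventually (φ.open_source.mem_nhds hp)
      filter_upwards [this] with s hs
      exact horMap_phase hD hφ ⟨hcD s, hs⟩
    have h6 := hc.congr_of_eventuallyEq h5
    have h7 := congrArg (fun f => f (1 : ℝ)) (hasMFDerivAt_unique h6 h4)
    have e : ∀ w : Euc N × Euc N, ((1 : ℝ →L[ℝ] ℝ).smulRight w) (1 : ℝ) = w := fun w => by simp
    exact (e _).symm.trans (h7.trans (e _))
  have h8 : p = ((horMap D φ π p).proj, (phase φ π (horMap D φ π p)).2) := by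
    rw [phase_horMap hD hφ hp]; rfl
  exact key _ W hc0 (by rw [hc0] at *; exact hc) p hp h8

theorem exists_curve_velocity (q : Q) (a : TangentSpace (𝓡 N) q) :
    ∃ c : ℝ → Q, c 0 = q ∧
      HasMFDerivAt 𝓘(ℝ, ℝ) (𝓡 N) c 0 ((1 : ℝ →L[ℝ] ℝ).smulRight (a : Euc N)) := by
  have key : ∀ x a : Euc N, HasMFDerivAt 𝓘(ℝ, Euc N) (𝓡 N) (extChartAt (𝓡 N) q).symm x
      (ContinuousLinearMap.id ℝ (Euc N)) → HasMFDerivAt 𝓘(ℝ, ℝ) (𝓡 N)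
      (fun s : ℝ => (extChartAt (𝓡 N) q).symm (x + s • a)) 0 ((1 : ℝ →L[ℝ] ℝ).smulRight a) := by
    intro x a h
    have h1 : HasDerivAt (fun s : ℝ => x + s • a) a 0 := by
      simpa using ((hasDerivAt_id (0 : ℝ)).smul_const a).const_add x
    have h0 : x = (fun s : ℝ => x + s • a) 0 := by simp
    rw [h0] at h
    exact h.comp_velocity (hasMFDerivAt_velocity_iff.2 h1)
  refine ⟨_, ?_, key (extChartAt (𝓡 N) q q) a
    (hasMFDerivAt_extChartAt_symm_self (𝓡 N) q)⟩
  have h2 : ∀ x a : Euc N, (extChartAt (𝓡 N) q).symm (x + (0 : ℝ) • a) =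
      (extChartAt (𝓡 N) q).symm x := fun x a => by rw [zero_smul, add_zero]
  exact (h2 _ _).trans ((extChartAt (𝓡 N) q).left_inv (mem_extChartAt_source q))

/-- The range of the derivative of `horMap` is tangent to `D`, and the velocities `a` and `b` are
recovered from its values. -/
theorem isTangentToConstraint_dHorMap (hD : IsHorizontalDistribution (n := n) π D)
    (hφ : φ ∈ IsManifold.maximalAtlas (𝓡 n) ∞ Qbar) {p : Q × Euc n} (hp : π p.1 ∈ φ.source)
    (a : TangentSpace (𝓡 N) p.1) (b : Euc n) :
    IsTangentToConstraint D (horMap D φ π p) (dHorMap D φ π p a b) ∧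
      tangentProj _ (dHorMap D φ π p a b) = a ∧
      dPhase φ π _ (dHorMap D φ π p a b) = (redVel φ π p.1 a, b) := by
  obtain ⟨q, y⟩ := p
  obtain ⟨c, rfl, hc⟩ := exists_curve_velocity q a
  have hy : HasDerivAt (fun s : ℝ => y + s • b) b 0 := by
    simpa using ((hasDerivAt_id (0 : ℝ)).smul_const b).const_add y
  obtain ⟨Y, hY0, hY⟩ : ∃ Y : ℝ → Euc n, Y 0 = y ∧ HasDerivAt Y b 0 := ⟨_, by simp, hy⟩
  subst hY0
  have h1 := velocityWithin_horMap hD hφ hp (hasMFDerivWithinAt_univ.2 hc) hY.hasDerivWithinAt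
  replace h1 := hasMFDerivWithinAt_univ.1 h1
  have h2 : tangentProj _ (dHorMap D φ π (c 0, Y 0) a b) = a :=
    velocity_unique (HasMFDerivAt.comp_velocity
      (c := fun s => horMap D φ π (c s, Y s)) (hasMFDerivAt_tangentProj _) h1) hc
  refine ⟨⟨_, rfl, fun s => horMap_mem _, h1⟩, h2, ?_⟩
  refine Prod.ext ?_ ?_
  · rw [dPhase_fst hD hφ hp, h2]; rfl
  · have h3 := (hasDerivWithinAt_phase_snd (c := fun s => horMap D φ π (c s, Y s)) hD hφ hp
      (hasMFDerivWithinAt_univ.2 h1))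
    rw [hasDerivWithinAt_univ] at h3
    refine h3.unique (hY.congr_of_eventuallyEq ?_)
    have : ∀ᶠ s in 𝓝 (0 : ℝ), π (c s) ∈ φ.source :=
      (hD.proj_smooth.continuous.continuousAt.comp
        (hc.continuousAt)).eventually (φ.open_source.mem_nhds hp)
    filter_upwards [this] with s hs
    rw [phase_horMap hD hφ hs]

end HorizontalLift

/-! ### The tangent spaces of the constraint submanifold -/

section ConstraintTangent

variable {N n : ℕ} {Q : Type*} [TopologicalSpace Q]
  [ChartedSpace (EuclideanSpace ℝ (Fin N)) Q] [IsManifold (𝓡 N) ∞ Q]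
  {Qbar : Type*} [TopologicalSpace Qbar]
  [ChartedSpace (EuclideanSpace ℝ (Fin n)) Qbar] [IsManifold (𝓡 n) ∞ Qbar]
  {π : Q → Qbar} {D : ∀ q : Q, Submodule ℝ (TangentSpace (𝓡 N) q)}
  {φ : OpenPartialHomeomorph Qbar (EuclideanSpace ℝ (Fin n))}
  (hD : IsHorizontalDistribution (n := n) π D) (hφ : φ ∈ IsManifold.maximalAtlas (𝓡 n) ∞ Qbar)
  {v : TangentBundle (𝓡 N) Q} (hv : v ∈ constraintSetOver π D φ)
include hD hφ hv

theorem exists_horMap_eq : ∃ p : Q × Euc n, π p.1 ∈ φ.source ∧ horMap D φ π p = v :=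
  ⟨_, hv.2, horMap_phase hD hφ hv⟩

/-- A vector tangent to `D` is determined by the velocities of the base point and of the reduced
velocity. -/
theorem IsTangentToConstraint.ext {W W' : TangentSpace (𝓡 N).tangent v}
    (hW : IsTangentToConstraint D v W) (hW' : IsTangentToConstraint D v W')
    (h1 : tangentProj v W = tangentProj v W')
    (h2 : (dPhase φ π v W).2 = (dPhase φ π v W').2) : W = W' := by
  obtain ⟨p, hp, rfl⟩ := exists_horMap_eq hD hφ hv
  rw [hW.eq_dHorMap hD hφ hp, hW'.eq_dHorMap hD hφ hp, h1, h2]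

theorem exists_isTangentToConstraint (a : TangentSpace (𝓡 N) v.proj) (b : Euc n) :
    ∃ W : TangentSpace (𝓡 N).tangent v, IsTangentToConstraint D v W ∧ tangentProj v W = a ∧
      dPhase φ π v W = (redVel φ π v.proj a, b) := by
  obtain ⟨p, hp, rfl⟩ := exists_horMap_eq hD hφ hv
  exact ⟨_, isTangentToConstraint_dHorMap hD hφ hp a b⟩

theorem IsTangentToConstraint.add {W W' : TangentSpace (𝓡 N).tangent v}
    (hW : IsTangentToConstraint D v W) (hW' : IsTangentToConstraint D v W') :
    IsTangentToConstraint D v (W + W') := by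
  obtain ⟨p, hp, rfl⟩ := exists_horMap_eq hD hφ hv
  have h : W + W' = dHorMap D φ π p (tangentProj _ W + tangentProj _ W')
      ((dPhase φ π _ W).2 + (dPhase φ π _ W').2) := by
    conv_lhs => rw [hW.eq_dHorMap hD hφ hp, hW'.eq_dHorMap hD hφ hp]
    exact (map_add (mfderiv ((𝓡 N).prod 𝓘(ℝ, Euc n)) (𝓡 N).tangent (horMap D φ π) p)
      (tangentProj _ W, (dPhase φ π _ W).2) (tangentProj _ W', (dPhase φ π _ W').2)).symm
  rw [h]
  exact (isTangentToConstraint_dHorMap hD hφ hp _ _).1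

/-- The tangent vector at `v` of the line `s ↦ v + s w` in the fiber. -/
def vertVec (v : TangentBundle (𝓡 N) Q) (w : TangentSpace (𝓡 N) v.proj) :
    TangentSpace (𝓡 N).tangent v := (((0 : Euc N), (w : Euc N)) : Euc N × Euc N)

theorem vertVec_props {w : TangentSpace (𝓡 N) v.proj} (hw : w ∈ D v.proj) :
    IsTangentToConstraint D v (vertVec v w) ∧ tangentProj v (vertVec v w) = 0 ∧
      dPhase φ π v (vertVec v w) = (0, redVel φ π v.proj w) := by
  have key : ∀ c : ℝ → TangentBundle (𝓡 N) Q, c 0 = v →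
      (∀ s, c s = ⟨v.proj, v.2 + s • w⟩) →
      HasMFDerivAt 𝓘(ℝ, ℝ) (𝓡 N).tangent c 0 ((1 : ℝ →L[ℝ] ℝ).smulRight (vertVec v w)) →
      IsTangentToConstraint D v (vertVec v w) ∧ tangentProj v (vertVec v w) = 0 ∧
      dPhase φ π v (vertVec v w) = (0, redVel φ π v.proj w) := by
    rintro c rfl hcs hc
    have hT : IsTangentToConstraint D (c 0) (vertVec (c 0) w) := by
      refine ⟨c, rfl, fun s => ?_, hc⟩
      rw [hcs s]
      exact (D _).add_mem hv.1 ((D _).smul_mem s hw)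
    have hproj : tangentProj (c 0) (vertVec (c 0) w) = 0 := by
      have h1 := (hasMFDerivAt_tangentProj (c 0)).comp_velocity hc
      have h2 : (fun s => (c s).proj) = fun _ => (c 0).proj := by
        funext s; rw [hcs s]
      have h3 : HasMFDerivAt 𝓘(ℝ, ℝ) (𝓡 N) (fun s => (c s).proj) 0
          ((1 : ℝ →L[ℝ] ℝ).smulRight (0 : TangentSpace (𝓡 N) (c 0).proj)) := by
        rw [h2]
        exact velocity_const _ _
      exact velocity_unique h1 h3
    refine ⟨hT, hproj, Prod.ext ?_ ?_⟩
    · rw [dPhase_fst hD hφ hv.2, hproj, map_zero]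
    · have h1 := hasDerivWithinAt_univ.1
        (hasDerivWithinAt_phase_snd hD hφ hv.2 (hasMFDerivWithinAt_univ.2 hc))
      have h2 : HasDerivAt (fun s => (phase φ π (c s)).2) (redVel φ π (c 0).proj w) 0 := by
        have h3 : (fun s => (phase φ π (c s)).2) = fun s : ℝ =>
            redVel φ π (c 0).proj (c 0).2 + s • redVel φ π (c 0).proj w := by
          funext s
          rw [hcs s, phase_eq]
          exact ((redVel φ π (c 0).proj).map_add _ _).trans (by rw [map_smul])
        rw [h3]
        simpa using ((hasDerivAt_id (0 : ℝ)).smul_const (redVel φ π (c 0).proj w)).const_add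
          (redVel φ π (c 0).proj (c 0).2)
      exact h1.unique h2
  have h0 := hasMFDerivAt_fiber_line v w
  have e0 : (⟨v.proj, v.2 + (0 : ℝ) • w⟩ : TangentBundle (𝓡 N) Q) = v := by
    rw [zero_smul, add_zero]
  exact key _ e0 (fun _ => rfl) h0

end ConstraintTangent

/-! ### The nonholonomic dynamics in reduced coordinates -/

/-- The mixed second derivative of a function which is quadratic on the plane spanned by `w` and
`u`. -/
theorem fderiv_fderiv_of_quadratic {E : Type*} [NormedAddCommGroup E] [NormedSpace ℝ E]
    {f : E → ℝ} {x u w : E} (hf : ContDiffAt ℝ 2 f x) {a0 a1 a2 a3 a4 a5 : ℝ}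
    (h : ∀ s t : ℝ, f (x + s • w + t • u) =
      a0 + a1 * s + a2 * t + a3 * s ^ 2 + a4 * (s * t) + a5 * t ^ 2) :
    fderiv ℝ (fun p => fderiv ℝ f p u) x w = a4 := by
  have hdf : DifferentiableAt ℝ (fun p => fderiv ℝ f p u) x :=
    ((hf.fderiv_right (m := 1) (by norm_num)).differentiableAt (by simp)).clm_apply
      (differentiableAt_const u)
  have hline : HasDerivAt (fun s : ℝ => x + s • w) w 0 := by
    simpa using ((hasDerivAt_id (0 : ℝ)).smul_const w).const_add x
  have hx0 : x + (0 : ℝ) • w = x := by simp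
  have h1 : HasDerivAt (fun s : ℝ => fderiv ℝ f (x + s • w) u)
      (fderiv ℝ (fun p => fderiv ℝ f p u) x w) 0 := by
    have hdf' : HasFDerivAt (fun p => fderiv ℝ f p u) (fderiv ℝ (fun p => fderiv ℝ f p u) x)
      (x + (0 : ℝ) • w) := by rw [hx0]; exact hdf.hasFDerivAt
    exact hdf'.comp_hasDerivAt (0 : ℝ) hline
  have hev : ∀ᶠ s : ℝ in 𝓝 0, DifferentiableAt ℝ f (x + s • w) := by
    have h2 : ∀ᶠ p in 𝓝 x, DifferentiableAt ℝ f p :=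
      (hf.eventually (by simp)).mono fun p hp => hp.differentiableAt (by simp)
    have h3 := hline.continuousAt.tendsto
    rw [hx0] at h3
    exact h3.eventually h2
  have h2 : (fun s : ℝ => fderiv ℝ f (x + s • w) u) =ᶠ[𝓝 0] fun s => a2 + a4 * s := by
    filter_upwards [hev] with s hs
    have h3 : HasDerivAt (fun t : ℝ => x + s • w + t • u) u 0 := by
      simpa using ((hasDerivAt_id (0 : ℝ)).smul_const u).const_add (x + s • w)
    have h4 : HasDerivAt (fun t : ℝ => f (x + s • w + t • u)) (fderiv ℝ f (x + s • w) u) 0 := by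
      have hs' : HasFDerivAt f (fderiv ℝ f (x + s • w)) (x + s • w + (0 : ℝ) • u) := by
        rw [zero_smul, add_zero]; exact hs.hasFDerivAt
      exact hs'.comp_hasDerivAt (0 : ℝ) h3
    refine h4.unique ?_
    simp only [h]
    have h5 : HasDerivAt (fun t : ℝ => (a0 + a1 * s + a3 * s ^ 2) + (a2 + a4 * s) * t + a5 * t ^ 2)
        (a2 + a4 * s) 0 := by
      have := (((hasDerivAt_id (0 : ℝ)).const_mul (a2 + a4 * s)).const_add
        (a0 + a1 * s + a3 * s ^ 2)).add (((hasDerivAt_id (0 : ℝ)).pow 2).const_mul a5)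
      exact this.congr_deriv (by simp)
    refine h5.congr_of_eventuallyEq (Eventually.of_forall fun t => ?_)
    ring
  refine h1.unique ((HasDerivAt.congr_of_eventuallyEq ?_ h2))
  simpa using ((hasDerivAt_id (0 : ℝ)).const_mul a4).const_add a2

section Dynamics

variable {N n : ℕ} {Q : Type*} [TopologicalSpace Q]
  [ChartedSpace (EuclideanSpace ℝ (Fin N)) Q] [IsManifold (𝓡 N) ∞ Q]
  {Qbar : Type*} [TopologicalSpace Qbar]
  [ChartedSpace (EuclideanSpace ℝ (Fin n)) Qbar] [IsManifold (𝓡 n) ∞ Qbar]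
  {π : Q → Qbar} {L : TangentBundle (𝓡 N) Q → ℝ}
  {D : ∀ q : Q, Submodule ℝ (TangentSpace (𝓡 N) q)}
  {F : ∀ v : TangentBundle (𝓡 N) Q, TangentSpace (𝓡 N) v.proj →L[ℝ] ℝ}
  {φ : OpenPartialHomeomorph Qbar (EuclideanSpace ℝ (Fin n))}
  {M K : Matrix (Fin n) (Fin n) ℝ} {b : ℝ}

/-- The nonholonomic system `(L, D, F)` reduces, in the chart `φ`, to the damped oscillator
`M z̈ + b ż + K z = 0`: its reduced Lagrangian, reduced force and unforced reduced dynamics are those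
of the oscillator. -/
structure IsDampedOscillatorReduction (π : Q → Qbar) (L : TangentBundle (𝓡 N) Q → ℝ)
    (D : ∀ q : Q, Submodule ℝ (TangentSpace (𝓡 N) q))
    (F : ∀ v : TangentBundle (𝓡 N) Q, TangentSpace (𝓡 N) v.proj →L[ℝ] ℝ)
    (φ : OpenPartialHomeomorph Qbar (EuclideanSpace ℝ (Fin n)))
    (M K : Matrix (Fin n) (Fin n) ℝ) (b : ℝ) : Prop where
  horizontal : IsHorizontalDistribution (n := n) π D
  chart : φ ∈ IsManifold.maximalAtlas (𝓡 n) ∞ Qbar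
  lagrangian_smooth : ContMDiff (𝓡 N).tangent 𝓘(ℝ, ℝ) ∞ L
  lagrangian_eq : ∀ v ∈ constraintSetOver π D φ, L v = quadraticLagrangian M K (phase φ π v)
  force_eq : ∀ v ∈ constraintSetOver π D φ, ∀ u ∈ D v.proj,
    F v u = -b * ((phase φ π v).2.ofLp ⬝ᵥ (redVel φ π v.proj u).ofLp)
  dynamics : HasQuadraticReducedDynamics π L D φ M K
  mass_posDef : M.PosDef
  stiffness_posDef : K.PosDef

/-- The vector field `(z, ż) ↦ (ż, -M⁻¹ (K z + b ż))` of the damped oscillator. -/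
def oscillatorField (M K : Matrix (Fin n) (Fin n) ℝ) (b : ℝ) (p : Euc n × Euc n) :
    Euc n × Euc n :=
  (p.2, WithLp.toLp 2 (-(M⁻¹ *ᵥ (K *ᵥ p.1.ofLp + b • p.2.ofLp))))

variable (S : IsDampedOscillatorReduction π L D F φ M K b)
  {v : TangentBundle (𝓡 N) Q} (hv : v ∈ constraintSetOver π D φ)
include S hv

/-- The Euler-Lagrange covector is affine in the acceleration. Only the values of `L` on `D` enter,
so the linear part is the mass matrix of the reduced Lagrangian. -/
theorem eulerLagrange_add_vertVec (W : TangentSpace (𝓡 N).tangent v)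
    {w u : TangentSpace (𝓡 N) v.proj} (hw : w ∈ D v.proj) (hu : u ∈ D v.proj) :
    eulerLagrange L v (W + vertVec v w) u = eulerLagrange L v W u +
      (redVel φ π v.proj w).ofLp ⬝ᵥ (M *ᵥ (redVel φ π v.proj u).ofLp) := by
  have hsymm : ∀ a b : Fin n → ℝ, a ⬝ᵥ (M *ᵥ b) = b ⬝ᵥ (M *ᵥ a) := fun a b => by
    have hM : Mᵀ = M := by simpa using S.mass_posDef.isHermitian.eq
    rw [dotProduct_mulVec, ← mulVec_transpose, hM, dotProduct_comm]
  have hadd : eulerLagrange L v (W + vertVec v w) u = eulerLagrange L v W u +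
      fderiv ℝ (fun p => fderiv ℝ (coordLagrangian L v) p ((0 : Euc N), (u : Euc N)))
        (coordPoint v) ((0 : Euc N), (w : Euc N)) := by
    have h1 := map_add (fderiv ℝ (fun p => fderiv ℝ (coordLagrangian L v) p
      ((0 : Euc N), (u : Euc N))) (coordPoint v)) W ((0 : Euc N), (w : Euc N))
    have aux : ∀ x y z c : ℝ, x = y + z → x - c = y - c + z := fun x y z c h => by linarith
    exact aux _ _ _ _ h1
  rw [hadd]
  congr 1
  set A : TangentSpace (𝓡 N) v.proj →L[ℝ] Euc n := redVel φ π v.proj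
  set B : Euc n → Euc n → ℝ := fun a c => a.ofLp ⬝ᵥ (M *ᵥ c.ofLp)
  have hB : ∀ a c, B a c = B c a := fun a c => hsymm _ _
  refine fderiv_fderiv_of_quadratic
    (a0 := (1 / 2) * B (A v.2) (A v.2) - (1 / 2) *
      ((φ (π v.proj)).ofLp ⬝ᵥ (K *ᵥ (φ (π v.proj)).ofLp)))
    (a1 := B (A v.2) (A w)) (a2 := B (A v.2) (A u)) (a3 := (1 / 2) * B (A w) (A w))
    (a5 := (1 / 2) * B (A u) (A u))
    ((contDiffAt_coordLagrangian S.lagrangian_smooth v).of_le ENat.LEInfty.out) fun s t => ?_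
  let w' : Euc N := w
  let u' : Euc N := u
  have h1 : coordLagrangian L v (coordPoint v + s • ((0 : Euc N), w') + t • ((0 : Euc N), u')) =
      L ⟨v.proj, v.2 + s • w + t • u⟩ := by
    have hline : ∀ x a c d : Euc N, (x, a) + s • ((0 : Euc N), c) + t • ((0 : Euc N), d) =
        (x, a + s • c + t • d) := fun x a c d => by simp
    exact (congrArg (coordLagrangian L v) ((congrArg (· + s • ((0 : Euc N), w') +
      t • ((0 : Euc N), u')) (coordPoint_eq v)).trans (hline _ _ _ _))).trans
      (congrArg L (extChartAt_tangent_symm_fiber v _))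
  have h2 := S.lagrangian_eq (⟨v.proj, v.2 + s • w + t • u⟩ : TangentBundle (𝓡 N) Q)
    ⟨(D _).add_mem ((D _).add_mem hv.1 ((D _).smul_mem _ hw)) ((D _).smul_mem _ hu), hv.2⟩
  have h3 : phase φ π (⟨v.proj, v.2 + s • w + t • u⟩ : TangentBundle (𝓡 N) Q) =
      (φ (π v.proj), A v.2 + s • A w + t • A u) := by
    rw [phase_eq]
    refine Prod.ext rfl ?_
    exact (map_add A _ _).trans (by rw [map_add, map_smul, map_smul])
  refine h1.trans ?_
  rw [h2, h3]
  have hl : ∀ x y z : Euc n, (1 / 2 : ℝ) * B (x + s • y + t • z) (x + s • y + t • z) =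
      (1 / 2) * B x x + B x y * s + B x z * t + (1 / 2) * B y y * s ^ 2 + B y z * (s * t)
        + (1 / 2) * B z z * t ^ 2 := by
    intro x y z
    have : B (x + s • y + t • z) (x + s • y + t • z) = B x x + s * B x y + t * B x z +
      s * (B y x + s * B y y + t * B y z) + t * (B z x + s * B z y + t * B z z) := by
      simp only [B, WithLp.ofLp_add, WithLp.ofLp_smul, mulVec_add, mulVec_smul, add_dotProduct,
        dotProduct_add, smul_dotProduct, dotProduct_smul, smul_eq_mul]
      ring
    rw [this, hB y x, hB z x, hB z y]
    ring
  have := hl (A v.2) (A w) (A u)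
  unfold quadraticLagrangian
  simp only [B] at this ⊢
  rw [this]
  ring

theorem eulerLagrange_add_right (W : TangentSpace (𝓡 N).tangent v)
    (u u' : TangentSpace (𝓡 N) v.proj) (s : ℝ) :
    eulerLagrange L v W (u + s • u') = eulerLagrange L v W u + s * eulerLagrange L v W u' := by
  have hf : ContDiffAt ℝ 2 (coordLagrangian L v) (coordPoint v) :=
    (contDiffAt_coordLagrangian S.lagrangian_smooth v).of_le ENat.LEInfty.out
  have hdf : DifferentiableAt ℝ (fderiv ℝ (coordLagrangian L v)) (coordPoint v) :=
    (hf.fderiv_right (m := 1) (by norm_num)).differentiableAt (by simp)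
  have h1 : ∀ (u : Euc N), fderiv ℝ (fun p => fderiv ℝ (coordLagrangian L v) p ((0 : Euc N), u))
      (coordPoint v) = (fderiv ℝ (fderiv ℝ (coordLagrangian L v)) (coordPoint v)).flip (0, u) := by
    intro u
    rw [fderiv_clm_apply hdf (differentiableAt_const _)]
    simp
  have key : ∀ (W : Euc N × Euc N) (u u' : Euc N),
      (fderiv ℝ (fun p => fderiv ℝ (coordLagrangian L v) p ((0 : Euc N), u + s • u'))
        (coordPoint v) W - fderiv ℝ (coordLagrangian L v) (coordPoint v) (u + s • u', 0)) =
      (fderiv ℝ (fun p => fderiv ℝ (coordLagrangian L v) p ((0 : Euc N), u))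
        (coordPoint v) W - fderiv ℝ (coordLagrangian L v) (coordPoint v) (u, 0)) +
      s * (fderiv ℝ (fun p => fderiv ℝ (coordLagrangian L v) p ((0 : Euc N), u'))
        (coordPoint v) W - fderiv ℝ (coordLagrangian L v) (coordPoint v) (u', 0)) := by
    intro W u u'
    have e1 : ((0 : Euc N), u + s • u') = (0, u) + s • ((0 : Euc N), u') := by simp
    have e2 : (u + s • u', (0 : Euc N)) = (u, 0) + s • (u', (0 : Euc N)) := by simp
    rw [h1, h1, h1, e1, e2, map_add, map_smul, map_add, map_smul]
    simp only [_root_.add_apply, _root_.smul_apply, smul_eq_mul]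
    ring
  exact key W u u'

/-- The Lagrange-d'Alembert equations say that the velocity of a second order vector tangent to `D`
is, in reduced coordinates, the oscillator field.

The reduced dynamics is known for the unforced system only, and `M⁻¹` times the force is the
difference between the two dynamics: a vertical correction by this vector turns a solution of the
forced equations into one of the unforced equations. For the converse, the vertical correction that
makes an arbitrary second order vector a solution is seen to vanish. -/
theorem isNonholonomicVector_iff (W : TangentSpace (𝓡 N).tangent v) :
    IsNonholonomicVector L D F v W ↔ IsTangentToConstraint D v W ∧ tangentProj v W = v.2 ∧
      dPhase φ π v W = oscillatorField M K b (phase φ π v) := by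
  have hD := S.horizontal
  have hφ := S.chart
  have hMu : IsUnit M.det := S.mass_posDef.isUnit.map Matrix.detMonoidHom
  have hMM : ∀ x : Fin n → ℝ, M *ᵥ (M⁻¹ *ᵥ x) = x := fun x => by
    rw [mulVec_mulVec, Matrix.mul_nonsing_inv _ hMu, one_mulVec]
  have hsymm : ∀ a c : Fin n → ℝ, a ⬝ᵥ (M *ᵥ c) = (M *ᵥ a) ⬝ᵥ c := fun a c => by
    have hM : Mᵀ = M := by simpa using S.mass_posDef.isHermitian.eq
    rw [dotProduct_mulVec, ← mulVec_transpose, hM]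
  -- a vertical correction of `W` changes the reaction covector by a given covector
  have shift : ∀ x : Euc n, ∃ w ∈ D v.proj, (redVel φ π v.proj w).ofLp = M⁻¹ *ᵥ x.ofLp ∧
      ∀ W : TangentSpace (𝓡 N).tangent v, ∀ u ∈ D v.proj,
        eulerLagrange L v (W + vertVec v w) u =
          eulerLagrange L v W u + x.ofLp ⬝ᵥ (redVel φ π v.proj u).ofLp := by
    intro x
    refine ⟨horLift D φ π v.proj (WithLp.toLp 2 (M⁻¹ *ᵥ x.ofLp)), horLift_mem _ _, ?_, ?_⟩
    · rw [redVel_horLift hD hφ hv.2]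
    · intro W u hu
      rw [eulerLagrange_add_vertVec S hv W (horLift_mem _ _) hu, redVel_horLift hD hφ hv.2,
        hsymm, hMM]
  have forward : ∀ W, IsNonholonomicVector L D F v W →
      dPhase φ π v W = oscillatorField M K b (phase φ π v) := by
    intro W hW
    obtain ⟨w, hw, hwx, hEL⟩ := shift (b • (phase φ π v).2)
    obtain ⟨hwT, hw0, hwP⟩ := vertVec_props hD hφ hv hw
    have h0 : IsNonholonomicVector L D (fun _ => 0) v (W + vertVec v w) := by
      refine ⟨hv.1, hW.2.1.add hD hφ hv hwT, ?_, fun u hu => ?_⟩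
      · rw [map_add, hw0, add_zero, hW.2.2.1]
      · rw [hEL W u hu, hW.2.2.2 u hu, S.force_eq v hv u hu]
        simp [smul_dotProduct]
    have h1 := S.dynamics v hv _ h0
    rw [← dPhase_apply hD.proj_smooth hφ hv.2] at h1
    have h2 : dPhase φ π v W + dPhase φ π v (vertVec v w) = _ := (map_add _ _ _).symm.trans h1
    rw [hwP] at h2
    rw [eq_sub_of_add_eq h2]
    refine Prod.ext ?_ ?_
    · exact sub_zero _
    · have h3 : redVel φ π v.proj w = WithLp.toLp 2 (M⁻¹ *ᵥ (b • (phase φ π v).2).ofLp) := by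
        rw [← hwx]
      change WithLp.toLp 2 (-(M⁻¹ *ᵥ (K *ᵥ (phase φ π v).1.ofLp))) - redVel φ π v.proj w = _
      rw [h3, oscillatorField, mulVec_add, neg_add]
      simp [sub_eq_add_neg]
  refine ⟨fun hW => ⟨hW.2.1, hW.2.2.1, forward W hW⟩, fun ⟨hT, h2, hP⟩ => ?_⟩
  -- the covector by which `W` fails the equations, in reduced coordinates
  set g : Euc n → ℝ := fun y => F v (horLift D φ π v.proj y) -
    eulerLagrange L v W (horLift D φ π v.proj y)
  have hlin : ∀ (y y' : Euc n) (s : ℝ), horLift D φ π v.proj (y + s • y') =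
      horLift D φ π v.proj y + s • horLift D φ π v.proj y' := fun y y' s => by
    refine (eq_horLift hD hφ hv.2 ((D _).add_mem (horLift_mem _ _)
      ((D _).smul_mem _ (horLift_mem _ _))) ?_).symm
    rw [map_add, map_smul, redVel_horLift hD hφ hv.2, redVel_horLift hD hφ hv.2]
  have hg : ∀ (y y' : Euc n) (s : ℝ), g (y + s • y') = g y + s * g y' := fun y y' s => by
    simp only [g, hlin, map_add, map_smul, eulerLagrange_add_right S hv, smul_eq_mul]
    ring
  have hg0 : g 0 = 0 := by
    have := hg 0 0 1
    simp at this
    exact this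
  let gl : Euc n →ₗ[ℝ] ℝ :=
    { toFun := g
      map_add' := fun y y' => by simpa using hg y y' 1
      map_smul' := fun s y => by simpa [hg0] using hg 0 y s }
  obtain ⟨x, hx⟩ : ∃ x : Euc n, ∀ y : Euc n, g y = x.ofLp ⬝ᵥ y.ofLp := by
    refine ⟨(InnerProductSpace.toDual ℝ (Euc n)).symm (LinearMap.toContinuousLinearMap gl),
      fun y => ?_⟩
    have h := InnerProductSpace.toDual_symm_apply (𝕜 := ℝ) (E := Euc n) (x := y)
      (y := LinearMap.toContinuousLinearMap gl)
    rw [EuclideanSpace.inner_eq_star_dotProduct] at h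
    rw [dotProduct_comm]
    simpa [gl] using h.symm
  obtain ⟨w, hw, hwx, hEL⟩ := shift x
  obtain ⟨hwT, hw0, hwP⟩ := vertVec_props hD hφ hv hw
  have hNH : IsNonholonomicVector L D F v (W + vertVec v w) := by
    refine ⟨hv.1, hT.add hD hφ hv hwT, ?_, fun u hu => ?_⟩
    · rw [map_add, hw0, add_zero, h2]
    · rw [hEL W u hu, ← hx]
      simp only [g]
      rw [← eq_horLift hD hφ hv.2 hu rfl]
      ring
  have h3 := forward _ hNH
  have h4 : dPhase φ π v W + dPhase φ π v (vertVec v w) = _ := (map_add _ _ _).symm.trans h3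
  rw [hP, hwP] at h4
  have h5 : redVel φ π v.proj w = 0 := congrArg Prod.snd (add_eq_left.1 h4)
  have h6 : w = 0 := redVel_injOn hD hφ hv.2 hw h5
  have h7 : W + vertVec v w = W := by
    rw [h6]
    exact add_zero (M := Euc N × Euc N) W
  rwa [h7] at hNH

omit hv in
/-- The equilibria are the zero vectors over the fiber of `π` over the centre of the chart. -/
theorem mem_equilibriumSet_iff : v ∈ equilibriumSet π L D F φ ↔
    v.2 = 0 ∧ π v.proj ∈ φ.source ∧ φ (π v.proj) = 0 := by
  have hK : ∀ x : Fin n → ℝ, K *ᵥ x = 0 → x = 0 := fun x hx => by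
    by_contra h
    have := S.stiffness_posDef.dotProduct_mulVec_pos h
    rw [hx] at this
    simp at this
  have hMu : IsUnit M.det := S.mass_posDef.isUnit.map Matrix.detMonoidHom
  constructor
  · rintro ⟨hv, hW⟩
    obtain ⟨-, h1, h2⟩ := (isNonholonomicVector_iff S hv 0).1 hW
    have h0 : v.2 = 0 := h1.symm.trans (map_zero _)
    refine ⟨h0, hv.2, ?_⟩
    have hy : (phase φ π v).2 = 0 := by
      rw [phase_eq]
      exact (congrArg (redVel φ π v.proj) h0).trans (map_zero _)
    have h3 : (0 : Euc n × Euc n) = oscillatorField M K b (phase φ π v) :=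
      (map_zero _).symm.trans h2
    have h4 : M⁻¹ *ᵥ (K *ᵥ (phase φ π v).1.ofLp) = 0 := by
      have h5 := congrArg (fun p : Euc n × Euc n => p.2.ofLp) h3
      simp only [oscillatorField, hy] at h5
      simpa using h5.symm
    have h6 : K *ᵥ (phase φ π v).1.ofLp = 0 := by
      have := congrArg (M *ᵥ ·) h4
      simpa [mulVec_mulVec, Matrix.mul_nonsing_inv _ hMu, ← Matrix.mul_assoc] using this
    have h7 := hK _ h6
    exact (WithLp.ofLp_injective 2) (h7.trans (by simp))
  · rintro ⟨h0, hs, hz⟩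
    have hvD : v ∈ constraintSet D := by
      change v.2 ∈ D v.proj
      rw [h0]; exact (D _).zero_mem
    have hv : v ∈ constraintSetOver π D φ := ⟨hvD, hs⟩
    have hp : phase φ π v = 0 := by
      rw [phase_eq, hz]
      exact Prod.ext rfl ((congrArg (redVel φ π v.proj) h0).trans (map_zero _))
    refine ⟨hv, (isNonholonomicVector_iff S hv 0).2 ⟨⟨fun _ => v, rfl, fun _ => hvD, ?_⟩, ?_, ?_⟩⟩
    · exact velocity_const v 0
    · exact (map_zero _).trans h0.symm
    · rw [hp]
      refine (map_zero _).trans ?_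
      simp [oscillatorField, Prod.ext_iff]

end Dynamics

/-! ### Horizontal lifts of curves -/

section CurveRegularity

variable {E H M : Type*} [NormedAddCommGroup E] [NormedSpace ℝ E] [TopologicalSpace H]
  {I : ModelWithCorners ℝ E H} [TopologicalSpace M] [ChartedSpace H M] [IsManifold I 1 M]

/-- A curve whose velocity is continuous, as a curve in the tangent bundle, is of class `C¹`. -/
theorem contMDiffOn_one_of_velocity {c : ℝ → M} {s : Set ℝ} (X : ∀ t, TangentSpace I (c t))
    (hc : ∀ t ∈ s, HasMFDerivWithinAt 𝓘(ℝ, ℝ) I c s t ((1 : ℝ →L[ℝ] ℝ).smulRight (X t)))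
    (hX : ContinuousOn (fun t => (⟨c t, X t⟩ : TangentBundle I M)) s) :
    ContMDiffOn 𝓘(ℝ, ℝ) I 1 c s := by
  intro t₀ ht₀
  have hcont : ContinuousOn c s := fun t ht => (hc t ht).continuousWithinAt
  rw [contMDiffWithinAt_iff_target]
  refine ⟨hcont t₀ ht₀, ContDiffWithinAt.contMDiffWithinAt ?_⟩
  set e := extChartAt I (c t₀)
  set u : Set ℝ := s ∩ c ⁻¹' (chartAt H (c t₀)).source
  have hu : u ∈ 𝓝[s] t₀ := inter_mem self_mem_nhdsWithin
    ((hcont t₀ ht₀) (chart_source_mem_nhds H (c t₀)))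
  let Y : ℝ → E := fun t => (trivializationAt E (TangentSpace I) (c t₀) ⟨c t, X t⟩).2
  have hY : ContinuousOn Y u := by
    have h1 : ContinuousOn (trivializationAt E (TangentSpace I : M → Type _) (c t₀))
      (trivializationAt E (TangentSpace I : M → Type _) (c t₀)).source :=
      (trivializationAt E (TangentSpace I : M → Type _) (c t₀)).continuousOn
    have h2 : ContinuousOn (fun t => trivializationAt E (TangentSpace I : M → Type _) (c t₀)
        ⟨c t, X t⟩) u := h1.comp (hX.mono inter_subset_left) fun t ht => by
      rw [TangentBundle.trivializationAt_source]; exact ht.2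
    exact continuous_snd.comp_continuousOn h2
  have hder : ∀ t ∈ u, HasDerivWithinAt (e ∘ c) (Y t) u t := by
    intro t ht
    have h2 := (mdifferentiableAt_extChartAt (I := I) ht.2).hasMFDerivAt.comp_velocityWithin
      (hc t ht.1)
    let m : E := mfderiv I 𝓘(ℝ, E) e (c t) (X t)
    let tr := trivializationAt E (TangentSpace I : M → Type _) (c t₀)
    have hb : c t ∈ tr.baseSet := by rw [TangentBundle.trivializationAt_baseSet]; exact ht.2
    have h3 : m = Y t :=
      (DFunLike.congr_fun (TangentBundle.continuousLinearMapAt_trivializationAt (I := I)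
        ht.2) (X t)).symm.trans (congrFun (tr.coe_linearMapAt_of_mem (R := ℝ) hb) (X t))
    have h4 : HasDerivWithinAt (e ∘ c) m s t :=
      (hasMFDerivWithinAt_velocity_iff (E := E) (f := fun s => e (c s)) (b := m)).1 h2
    exact (h4.congr_deriv h3).mono inter_subset_left
  have h01 : (1 : ℕ∞ω) = 0 + 1 := by norm_num
  rw [h01, contDiffWithinAt_succ_iff_hasFDerivWithinAt (by simp)]
  refine ⟨u, by rwa [insert_eq_of_mem ht₀], by simp,
    fun t => ContinuousLinearMap.toSpanSingleton ℝ (Y t), fun t ht => (hder t ht).hasFDerivWithinAt, ?_⟩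
  have ht₀u : t₀ ∈ u := ⟨ht₀, mem_chart_source _ _⟩
  refine (contDiffWithinAt_zero ht₀u).2 ⟨univ, univ_mem, ?_⟩
  rw [inter_univ]
  exact (ContinuousLinearMap.toSpanSingletonCLE (𝕜 := ℝ) (E := E)).continuous.comp_continuousOn hY

end CurveRegularity

section CurveLift

variable {N n : ℕ} {Q : Type*} [TopologicalSpace Q]
  [ChartedSpace (EuclideanSpace ℝ (Fin N)) Q] [IsManifold (𝓡 N) ∞ Q]
  {Qbar : Type*} [TopologicalSpace Qbar]
  [ChartedSpace (EuclideanSpace ℝ (Fin n)) Qbar] [IsManifold (𝓡 n) ∞ Qbar]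
  {π : Q → Qbar} {D : ∀ q : Q, Submodule ℝ (TangentSpace (𝓡 N) q)}
  {φ : OpenPartialHomeomorph Qbar (EuclideanSpace ℝ (Fin n))}

/-- On `J`, the curve `c` is a horizontal lift of the curve which in the chart `φ` is `z`, with
velocity `ζ`. -/
def IsHorizontalLiftOn (D : ∀ q : Q, Submodule ℝ (TangentSpace (𝓡 N) q))
    (φ : OpenPartialHomeomorph Qbar (EuclideanSpace ℝ (Fin n))) (π : Q → Qbar)
    (z ζ : ℝ → Euc n) (c : ℝ → Q) (J : Set ℝ) : Prop :=
  ∀ t ∈ J, π (c t) ∈ φ.source ∧ φ (π (c t)) = z t ∧ HasMFDerivWithinAt 𝓘(ℝ, ℝ) (𝓡 N) c J t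
    ((1 : ℝ →L[ℝ] ℝ).smulRight (horLift D φ π (c t) (ζ t)))

theorem IsHorizontalLiftOn.mono {z ζ : ℝ → Euc n} {c : ℝ → Q} {J J' : Set ℝ}
    (h : IsHorizontalLiftOn D φ π z ζ c J) (hJ : J' ⊆ J) :
    IsHorizontalLiftOn D φ π z ζ c J' :=
  fun t ht => ⟨(h t (hJ ht)).1, (h t (hJ ht)).2.1, (h t (hJ ht)).2.2.mono hJ⟩

/-- To be a horizontal lift is a local property in time. -/
theorem IsHorizontalLiftOn.of_local {z ζ : ℝ → Euc n} {c : ℝ → Q} {J : Set ℝ}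
    (h : ∀ t ∈ J, ∃ c' : ℝ → Q, ∃ O ∈ 𝓝 t, IsHorizontalLiftOn D φ π z ζ c' (J ∩ O) ∧
      EqOn c c' (J ∩ O)) : IsHorizontalLiftOn D φ π z ζ c J := by
  intro t ht
  obtain ⟨c', O, hO, hc', heq⟩ := h t ht
  have htO : t ∈ J ∩ O := ⟨ht, mem_of_mem_nhds hO⟩
  obtain ⟨h1, h2, h3⟩ := hc' t htO
  have e := heq htO
  have key : ∀ q : Q, c t = q → HasMFDerivWithinAt 𝓘(ℝ, ℝ) (𝓡 N) c' (J ∩ O) t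
      ((1 : ℝ →L[ℝ] ℝ).smulRight (horLift D φ π q (ζ t))) →
      HasMFDerivWithinAt 𝓘(ℝ, ℝ) (𝓡 N) c J t
      ((1 : ℝ →L[ℝ] ℝ).smulRight (horLift D φ π (c t) (ζ t))) := by
    rintro _ rfl h
    exact (hasMFDerivWithinAt_inter hO).1 (h.congr_mono heq e Subset.rfl)
  rw [e]
  exact ⟨h1, h2, e ▸ key _ e h3⟩

theorem exists_local_horizontalLift [T2Space Q] (hD : IsHorizontalDistribution (n := n) π D)
    (hφ : φ ∈ IsManifold.maximalAtlas (𝓡 n) ∞ Qbar) {z ζ : ℝ → Euc n}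
    (hz : ∀ t, HasDerivAt z (ζ t) t) (hζ : ContDiff ℝ 1 ζ) {t₀ : ℝ} {q : Q}
    (hq : π q ∈ φ.source) (hqz : φ (π q) = z t₀) :
    ∃ c : ℝ → Q, c t₀ = q ∧ ∃ δ > 0, IsHorizontalLiftOn D φ π z ζ c (Ioo (t₀ - δ) (t₀ + δ)) := by
  -- the time-dependent equation, as an autonomous equation on `Q × ℝ`
  let V : ∀ p : Q × ℝ, TangentSpace ((𝓡 N).prod 𝓘(ℝ, ℝ)) p := fun p =>
    ((horLift D φ π p.1 (ζ p.2), (1 : ℝ)) : TangentSpace (𝓡 N) p.1 × ℝ)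
  have hV : ContMDiffAt ((𝓡 N).prod 𝓘(ℝ, ℝ)) ((𝓡 N).prod 𝓘(ℝ, ℝ)).tangent 1
      (fun p => (⟨p, V p⟩ : TangentBundle ((𝓡 N).prod 𝓘(ℝ, ℝ)) (Q × ℝ))) (q, t₀) := by
    have h1 : ContMDiffAt ((𝓡 N).prod 𝓘(ℝ, ℝ)) (𝓡 N).tangent 1
        (fun p : Q × ℝ => horMap D φ π (p.1, ζ p.2)) (q, t₀) := by
      have h2 : ContMDiffAt ((𝓡 N).prod 𝓘(ℝ, Euc n)) (𝓡 N).tangent 1 (horMap D φ π)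
          (q, ζ t₀) := (contMDiffAt_horMap hD hφ (p := (q, ζ t₀)) hq).of_le ENat.LEInfty.out
      exact ContMDiffAt.comp (q, t₀) h2 (contMDiffAt_fst.prodMk
        (hζ.contMDiff.contMDiffAt.comp (q, t₀) contMDiffAt_snd))
    have h3 : ContMDiffAt ((𝓡 N).prod 𝓘(ℝ, ℝ)) 𝓘(ℝ, ℝ).tangent 1
        (fun p : Q × ℝ => (⟨p.2, (1 : ℝ)⟩ : TangentBundle 𝓘(ℝ, ℝ) ℝ)) (q, t₀) := by
      have h4 : ContMDiff 𝓘(ℝ, ℝ) 𝓘(ℝ, ℝ).tangent 1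
        (fun s : ℝ => (⟨s, (1 : ℝ)⟩ : TangentBundle 𝓘(ℝ, ℝ) ℝ)) :=
        contMDiff_vectorSpace_iff_contDiff.2 contDiff_const
      exact h4.contMDiffAt.comp (q, t₀) contMDiffAt_snd
    have h5 := (contMDiff_equivTangentBundleProd_symm (I := 𝓡 N) (M := Q) (I' := 𝓘(ℝ, ℝ))
      (M' := ℝ) (n := 1)).contMDiffAt.comp (q, t₀) (h1.prodMk h3)
    exact h5
  obtain ⟨γ, hγ0, hγ⟩ := exists_isMIntegralCurveAt_of_contMDiffAt_boundaryless t₀ hV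
  have hq' : ∀ᶠ t in 𝓝 t₀, π (γ t).1 ∈ φ.source := by
    have h1 : ContinuousAt γ t₀ := (hγ.self_of_nhds).continuousAt
    have h2 : ContinuousAt (fun t => π (γ t).1) t₀ :=
      hD.proj_smooth.continuous.continuousAt.comp (continuousAt_fst.comp h1)
    refine h2.eventually (φ.open_source.mem_nhds ?_)
    simp only [hγ0]; exact hq
  obtain ⟨δ, hδ, hball⟩ := Metric.eventually_nhds_iff_ball.1 (hγ.and hq')
  rw [Real.ball_eq_Ioo] at hball
  have hmem : t₀ ∈ Ioo (t₀ - δ) (t₀ + δ) := ⟨by linarith, by linarith⟩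
  -- the second component of the integral curve is the time
  have hsnd : ∀ t ∈ Ioo (t₀ - δ) (t₀ + δ), (γ t).2 = t := by
    have hd : ∀ t ∈ Ioo (t₀ - δ) (t₀ + δ), HasDerivAt (fun t => (γ t).2 - t) 0 t := by
      intro t ht
      have h1 := (hasMFDerivAt_snd (I := 𝓡 N) (I' := 𝓘(ℝ, ℝ)) (γ t)).comp_velocity
        (hball t ht).1
      have h2 : HasDerivAt (fun t => (γ t).2) 1 t :=
        (hasMFDerivAt_velocity_iff (E := ℝ) (f := fun t => (γ t).2) (b := 1)).1 h1
      exact (h2.sub (hasDerivAt_id t)).congr_deriv (sub_self 1)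
    intro t ht
    have h3 := eq_of_hasDerivAt_zero hd ht hmem
    simp only [hγ0, sub_self] at h3
    linarith
  have hlift : ∀ t ∈ Ioo (t₀ - δ) (t₀ + δ), HasMFDerivAt 𝓘(ℝ, ℝ) (𝓡 N) (fun t => (γ t).1) t
      ((1 : ℝ →L[ℝ] ℝ).smulRight (horLift D φ π (γ t).1 (ζ t))) := by
    intro t ht
    have h1 := (hasMFDerivAt_fst (I := 𝓡 N) (I' := 𝓘(ℝ, ℝ)) (γ t)).comp_velocity
      (hball t ht).1
    have h2 : horLift D φ π (γ t).1 (ζ t) = horLift D φ π (γ t).1 (ζ (γ t).2) := by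
      rw [hsnd t ht]
    rw [h2]
    exact h1
  refine ⟨fun t => (γ t).1, by simp only [hγ0], δ, hδ, fun t ht => ⟨(hball t ht).2, ?_,
    (hlift t ht).hasMFDerivWithinAt⟩⟩
  have hd : ∀ t ∈ Ioo (t₀ - δ) (t₀ + δ), HasDerivAt (fun t => φ (π (γ t).1) - z t) 0 t := by
    intro t ht
    have h1 := (hasMFDerivAt_chart_proj hD.proj_smooth hφ (hball t ht).2).comp_velocity
      (c := fun t => (γ t).1) (hlift t ht)
    have h2 := (hasMFDerivAt_velocity_iff (E := Euc n) (f := fun t => φ (π (γ t).1))).1 h1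
    have h3 := h2.sub (hz t)
    exact h3.congr_deriv (sub_eq_zero.2 (redVel_horLift hD hφ (hball t ht).2 _))
  have h3 := eq_of_hasDerivAt_zero hd ht hmem
  simp only [hγ0, hqz, sub_self] at h3
  exact sub_eq_zero.1 h3

end CurveLift

section GlobalLift

variable {N n k : ℕ} {Q : Type*} [TopologicalSpace Q]
  [ChartedSpace (EuclideanSpace ℝ (Fin N)) Q] [IsManifold (𝓡 N) ∞ Q]
  {Qbar : Type*} [TopologicalSpace Qbar]
  [ChartedSpace (EuclideanSpace ℝ (Fin n)) Qbar] [IsManifold (𝓡 n) ∞ Qbar]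
  {G : Type*} [TopologicalSpace G] [ChartedSpace (EuclideanSpace ℝ (Fin k)) G] [Group G]
  [LieGroup (𝓡 k) ∞ G] [MulAction G Q] [ContMDiffSMul (𝓡 k) (𝓡 N) ∞ G Q] [ProperSMul G Q]
  {π : Q → Qbar} {L : TangentBundle (𝓡 N) Q → ℝ}
  {D : ∀ q : Q, Submodule ℝ (TangentSpace (𝓡 N) q)}
  {φ : OpenPartialHomeomorph Qbar (EuclideanSpace ℝ (Fin n))}

theorem IsChaplyginSystem.isHorizontalDistribution
    (h : IsChaplyginSystem (n := n) (k := k) G π L D) :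
    IsHorizontalDistribution (n := n) π D :=
  ⟨h.proj_smooth, h.proj_submersion, h.dist_smooth, h.dist_compl⟩

theorem IsChaplyginSystem.proj_smul (h : IsChaplyginSystem (n := n) (k := k) G π L D) (g : G)
    (q : Q) : π (g • q) = π q :=
  (h.proj_fiber _ _).2 ⟨g, rfl⟩

omit [ContMDiffSMul (𝓡 k) (𝓡 N) ∞ G Q] in
theorem hasMFDerivAt_const_smul [ContMDiffSMul (𝓡 k) (𝓡 N) ∞ G Q] (g : G) (q : Q) :
    HasMFDerivAt (𝓡 N) (𝓡 N) (fun p : Q => g • p) q (mfderiv (𝓡 N) (𝓡 N) (fun p : Q => g • p) q) :=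
  ((ContMDiffSMul.contMDiff_const_smul (I := 𝓡 k) (I' := 𝓡 N) (n := ∞) (M := Q)
    g).mdifferentiable (by simp) q).hasMFDerivAt

theorem horLift_smul (h : IsChaplyginSystem (n := n) (k := k) G π L D)
    (hφ : φ ∈ IsManifold.maximalAtlas (𝓡 n) ∞ Qbar) {q : Q} (hq : π q ∈ φ.source) (g : G)
    (y : Euc n) :
    mfderiv (𝓡 N) (𝓡 N) (fun p : Q => g • p) q (horLift D φ π q y) =
      horLift D φ π (g • q) y := by
  have hD := h.isHorizontalDistribution
  have hgq : π (g • q) ∈ φ.source := by rwa [h.proj_smul]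
  refine eq_horLift hD hφ hgq ?_ ?_
  · rw [← h.dist_invariant g q]
    exact Submodule.mem_map_of_mem (horLift_mem q y)
  · have h1 := (hasMFDerivAt_chart_proj h.proj_smooth hφ hgq).comp q
      (hasMFDerivAt_const_smul (k := k) g q)
    have h2 := hasMFDerivAt_chart_proj h.proj_smooth hφ hq
    have h3 : (fun q => φ (π q)) ∘ (fun p : Q => g • p) = fun q => φ (π q) :=
      funext fun p => congrArg φ (h.proj_smul g p)
    rw [h3] at h1
    exact (DFunLike.congr_fun (hasMFDerivAt_unique h1 h2) (horLift D φ π q y)).trans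
      (redVel_horLift hD hφ hq y)

theorem IsHorizontalLiftOn.smul (h : IsChaplyginSystem (n := n) (k := k) G π L D)
    (hφ : φ ∈ IsManifold.maximalAtlas (𝓡 n) ∞ Qbar) {z ζ : ℝ → Euc n} {c : ℝ → Q} {J : Set ℝ}
    (hc : IsHorizontalLiftOn D φ π z ζ c J) (g : G) :
    IsHorizontalLiftOn D φ π z ζ (fun t => g • c t) J := by
  intro t ht
  obtain ⟨h1, h2, h3⟩ := hc t ht
  refine ⟨by rwa [h.proj_smul], by rwa [h.proj_smul], ?_⟩
  rw [← horLift_smul h hφ h1]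
  exact (hasMFDerivAt_const_smul (k := k) g (c t)).comp_velocityWithin h3

/-- Two horizontal lifts which fit together at `b` can be joined: both have there the velocity
prescribed by `ζ b`. -/
theorem IsHorizontalLiftOn.concat {z ζ : ℝ → Euc n} {c₁ c₂ : ℝ → Q} {a b d : ℝ} (hab : a ≤ b)
    (hbd : b ≤ d) (h₁ : IsHorizontalLiftOn D φ π z ζ c₁ (Icc a b))
    (h₂ : IsHorizontalLiftOn D φ π z ζ c₂ (Icc b d)) (h : c₂ b = c₁ b) :
    ∃ c, EqOn c c₁ (Icc a b) ∧ IsHorizontalLiftOn D φ π z ζ c (Icc a d) := by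
  classical
  let c : ℝ → Q := fun t => if t ≤ b then c₁ t else c₂ t
  have e₁ : EqOn c c₁ (Icc a b) := fun t ht => if_pos ht.2
  have e₂ : EqOn c c₂ (Icc b d) := fun t ht => by
    rcases ht.1.eq_or_lt with rfl | hlt
    · exact (if_pos le_rfl).trans h.symm
    · exact if_neg (not_le.2 hlt)
  have l₁ : IsHorizontalLiftOn D φ π z ζ c (Icc a b) := .of_local fun t _ =>
    ⟨c₁, univ, univ_mem, h₁.mono inter_subset_left, e₁.mono inter_subset_left⟩
  have l₂ : IsHorizontalLiftOn D φ π z ζ c (Icc b d) := .of_local fun t _ =>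
    ⟨c₂, univ, univ_mem, h₂.mono inter_subset_left, e₂.mono inter_subset_left⟩
  refine ⟨c, e₁, fun t ht => ?_⟩
  rcases lt_trichotomy t b with hlt | rfl | hlt
  · obtain ⟨i, ii, iii⟩ := l₁ t ⟨ht.1, hlt.le⟩
    refine ⟨i, ii, iii.mono_of_mem_nhdsWithin ?_⟩
    filter_upwards [self_mem_nhdsWithin, mem_nhdsWithin_of_mem_nhds (Iio_mem_nhds hlt)]
      with s hs hs' using ⟨hs.1, hs'.le⟩
  · obtain ⟨i, ii, iii⟩ := l₁ t ⟨hab, le_rfl⟩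
    refine ⟨i, ii, ?_⟩
    rw [← Icc_union_Icc_eq_Icc hab hbd]
    exact iii.union (l₂ t ⟨le_rfl, hbd⟩).2.2
  · obtain ⟨i, ii, iii⟩ := l₂ t ⟨hlt.le, ht.2⟩
    refine ⟨i, ii, iii.mono_of_mem_nhdsWithin ?_⟩
    filter_upwards [self_mem_nhdsWithin, mem_nhdsWithin_of_mem_nhds (Ioi_mem_nhds hlt)]
      with s hs hs' using ⟨le_of_lt hs', hs.2⟩

/-- Local horizontal lifts can be translated by the group, so they exist with any initial point on
an interval which does not depend on this point. -/
theorem exists_uniform_horizontalLift [T2Space Q] (h : IsChaplyginSystem (n := n) (k := k) G π L D)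
    (hφ : φ ∈ IsManifold.maximalAtlas (𝓡 n) ∞ Qbar) {z ζ : ℝ → Euc n}
    (hz : ∀ t, HasDerivAt z (ζ t) t) (hζ : ContDiff ℝ 1 ζ) {t₀ : ℝ} (ht₀ : z t₀ ∈ φ.target) :
    ∃ δ > 0, ∀ a b, t₀ - δ < a → a ≤ b → b < t₀ + δ → ∀ q, π q ∈ φ.source → φ (π q) = z a →
      ∃ c, c a = q ∧ IsHorizontalLiftOn D φ π z ζ c (Icc a b) := by
  obtain ⟨q₀, hq₀⟩ := h.proj_surjective (φ.symm (z t₀))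
  obtain ⟨c, -, δ, hδ, hc⟩ := exists_local_horizontalLift h.isHorizontalDistribution hφ hz hζ
    (t₀ := t₀) (q := q₀) (by rw [hq₀]; exact φ.map_target ht₀)
    (by rw [hq₀]; exact φ.right_inv ht₀)
  refine ⟨δ, hδ, fun a b ha hab hb q hq hqz => ?_⟩
  obtain ⟨h1, h2, -⟩ := hc a ⟨ha, hab.trans_lt hb⟩
  have h3 : π q = π (c a) := φ.injOn hq h1 (hqz.trans h2.symm)
  obtain ⟨g, hg⟩ := (h.proj_fiber _ _).1 h3
  exact ⟨fun t => g • c t, hg,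
    (hc.smul h hφ g).mono fun t ht => ⟨ha.trans_le ht.1, ht.2.trans_lt hb⟩⟩

/-- A curve in the chart has a horizontal lift on every compact interval: a partition fine enough for
the intervals of `exists_uniform_horizontalLift` gives it piece by piece. -/
theorem exists_horizontalLift_Icc [T2Space Q] (h : IsChaplyginSystem (n := n) (k := k) G π L D)
    (hφ : φ ∈ IsManifold.maximalAtlas (𝓡 n) ∞ Qbar) {z ζ : ℝ → Euc n}
    (hz : ∀ t, HasDerivAt z (ζ t) t) (hζ : ContDiff ℝ 1 ζ) {a b : ℝ} (hab : a ≤ b)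
    (hab' : ∀ t ∈ Icc a b, z t ∈ φ.target) {q : Q} (hq : π q ∈ φ.source) (hqz : φ (π q) = z a) :
    ∃ c, c a = q ∧ IsHorizontalLiftOn D φ π z ζ c (Icc a b) := by
  choose! δ hδ hlift using fun t (ht : t ∈ Icc a b) =>
    exists_uniform_horizontalLift h hφ hz hζ (hab' t ht)
  obtain ⟨τ, hτ0, hτ, ⟨m, hm⟩, hsub⟩ := exists_monotone_Icc_subset_open_cover_Icc hab
    (c := fun i : Icc a b => {t : Icc a b | (t : ℝ) ∈ Ioo ((i : ℝ) - δ i) (i + δ i)})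
    (fun i => isOpen_Ioo.preimage continuous_subtype_val)
    (fun t _ => mem_iUnion.2 ⟨t, by have := hδ t t.2; constructor <;> linarith⟩)
  have key : ∀ j, ∃ c, c a = q ∧ IsHorizontalLiftOn D φ π z ζ c (Icc a (τ j)) := by
    intro j
    induction j with
    | zero =>
      obtain ⟨c, hca, hc⟩ := hlift a ⟨le_rfl, hab⟩ a a
        (by have := hδ a ⟨le_rfl, hab⟩; linarith) le_rfl
        (by have := hδ a ⟨le_rfl, hab⟩; linarith) q hq hqz
      exact ⟨c, hca, by rwa [hτ0]⟩
    | succ j ih =>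
      obtain ⟨c, hca, hc⟩ := ih
      obtain ⟨i, hi⟩ := hsub j
      have hle : τ j ≤ τ (j + 1) := hτ (Nat.le_succ j)
      have h1 := hi (left_mem_Icc.2 hle)
      have h2 := hi (right_mem_Icc.2 hle)
      obtain ⟨h3, h4, -⟩ := hc (τ j) ⟨(τ j).2.1, le_rfl⟩
      obtain ⟨c', hc'a, hc'⟩ := hlift i i.2 (τ j) (τ (j + 1)) h1.1 hle h2.2 _ h3 h4
      obtain ⟨d, hd, hd'⟩ := hc.concat (τ j).2.1 hle hc' hc'a
      exact ⟨d, (hd ⟨le_rfl, (τ j).2.1⟩).trans hca, hd'⟩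
  obtain ⟨c, hca, hc⟩ := key m
  rw [hm m le_rfl] at hc
  exact ⟨c, hca, hc⟩

theorem exists_horizontalLift_Ici [T2Space Q] (h : IsChaplyginSystem (n := n) (k := k) G π L D)
    (hφ : φ ∈ IsManifold.maximalAtlas (𝓡 n) ∞ Qbar) {z ζ : ℝ → Euc n}
    (hz : ∀ t, HasDerivAt z (ζ t) t) (hζ : ContDiff ℝ 1 ζ)
    (htarget : ∀ t, 0 ≤ t → z t ∈ φ.target) {q : Q} (hq : π q ∈ φ.source) (hqz : φ (π q) = z 0) :
    ∃ c, c 0 = q ∧ IsHorizontalLiftOn D φ π z ζ c (Ici 0) := by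
  have ext : ∀ (m : ℕ) (c : ℝ → Q), IsHorizontalLiftOn D φ π z ζ c (Icc 0 m) →
      ∃ c', EqOn c' c (Icc 0 m) ∧ IsHorizontalLiftOn D φ π z ζ c' (Icc 0 (m + 1 : ℕ)) := by
    intro m c hc
    obtain ⟨h1, h2, -⟩ := hc m ⟨m.cast_nonneg, le_rfl⟩
    have hle : (m : ℝ) ≤ (m + 1 : ℕ) := by push_cast; linarith
    obtain ⟨c', hc'm, hc'⟩ := exists_horizontalLift_Icc h hφ hz hζ hle
      (fun t ht => htarget t (m.cast_nonneg.trans ht.1)) h1 h2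
    exact hc.concat m.cast_nonneg hle hc' hc'm
  choose! e he he' using ext
  obtain ⟨c₀, hc₀, hl₀⟩ := exists_horizontalLift_Icc h hφ hz hζ (le_refl (0 : ℝ))
    (fun t ht => htarget t ht.1) hq hqz
  let f : ℕ → ℝ → Q := fun m => Nat.rec c₀ (fun m c => e m c) m
  have hf : ∀ m : ℕ, IsHorizontalLiftOn D φ π z ζ (f m) (Icc 0 m) := by
    intro m
    induction m with
    | zero => rw [Nat.cast_zero]; exact hl₀
    | succ m ih => exact he' m (f m) ih
  have hstep : ∀ m : ℕ, EqOn (f (m + 1)) (f m) (Icc 0 m) := fun m => he m (f m) (hf m)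
  have hmono : ∀ m j : ℕ, EqOn (f (m + j)) (f m) (Icc 0 m) := by
    intro m j
    induction j with
    | zero => exact fun t _ => rfl
    | succ j ih => exact fun t ht => (hstep (m + j) ⟨ht.1, ht.2.trans (by simp)⟩).trans (ih ht)
  have hmono' : ∀ {m j : ℕ}, m ≤ j → EqOn (f j) (f m) (Icc 0 m) := fun {m j} hmj => by
    obtain ⟨i, rfl⟩ := Nat.exists_eq_add_of_le hmj
    exact hmono m i
  refine ⟨fun t => f ⌈t⌉₊ t, by simpa [f] using hc₀, .of_local fun t ht => ?_⟩
  refine ⟨f (⌈t⌉₊ + 1), Iio (t + 1), Iio_mem_nhds (by linarith), ?_, ?_⟩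
  · refine (hf (⌈t⌉₊ + 1)).mono fun s hs => ⟨hs.1, ?_⟩
    have := Nat.le_ceil t
    push_cast
    linarith [mem_Iio.1 hs.2]
  · intro s hs
    have hle : ⌈s⌉₊ ≤ ⌈t⌉₊ + 1 := by
      rw [Nat.ceil_le]
      have := Nat.le_ceil t
      push_cast
      linarith [mem_Iio.1 hs.2]
    exact (hmono' hle ⟨hs.1, Nat.le_ceil s⟩).symm

end GlobalLift

/-! ### Trivialisation of the principal bundle near a fibre -/

section InverseFunction

variable {E : Type*} [NormedAddCommGroup E] [NormedSpace ℝ E] [CompleteSpace E]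

/-- Inverse function theorem, with smoothness of the inverse on a whole neighbourhood. -/
theorem exists_smooth_localInverse {f : E → E} {O : Set E} (hO : IsOpen O)
    (hf : ContDiffOn ℝ ∞ f O) {a : E} (ha : a ∈ O)
    (hfa : HasFDerivAt f (ContinuousLinearMap.id ℝ E) a) :
    ∃ e : OpenPartialHomeomorph E E, ⇑e = f ∧ a ∈ e.source ∧ e.source ⊆ O ∧
      ContDiffOn ℝ ∞ e.symm e.target := by
  have hfa' : HasFDerivAt f ((ContinuousLinearEquiv.refl ℝ E : E ≃L[ℝ] E) : E →L[ℝ] E) a := hfa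
  have hat : ∀ x ∈ O, ContDiffAt ℝ ∞ f x := fun x hx => hf.contDiffAt (hO.mem_nhds hx)
  have hcont : ContinuousOn (fderiv ℝ f) O := hf.continuousOn_fderiv_of_isOpen hO (by simp)
  have hinv : fderiv ℝ f ⁻¹' (range ((↑) : (E ≃L[ℝ] E) → E →L[ℝ] E)) ∈ 𝓝 a := by
    refine (hcont.continuousAt (hO.mem_nhds ha)) ?_
    rw [hfa'.fderiv]
    exact ContinuousLinearEquiv.nhds _
  obtain ⟨O', hO'sub, hO', haO'⟩ := mem_nhds_iff.1 (inter_mem hinv (hO.mem_nhds ha))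
  let e₀ := (hat a ha).toOpenPartialHomeomorph f hfa' (by simp)
  have ha₀ : a ∈ e₀.source := (hat a ha).mem_toOpenPartialHomeomorph_source hfa' (by simp)
  refine ⟨e₀.restrOpen O' hO', rfl, ⟨ha₀, haO'⟩, fun x hx => (hO'sub hx.2).2, ?_⟩
  intro y hy
  obtain ⟨A, hA⟩ := (hO'sub ((e₀.restrOpen O' hO').map_target hy).2).1
  have hmem := (hO'sub ((e₀.restrOpen O' hO').map_target hy).2).2
  refine (OpenPartialHomeomorph.contDiffAt_symm (f₀' := A) _ hy ?_ (hat _ hmem)).contDiffWithinAt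
  rw [hA]
  exact ((hat _ hmem).differentiableAt (by simp)).hasFDerivAt

end InverseFunction

section Trivialization

variable {N n k : ℕ} {Q : Type*} [TopologicalSpace Q]
  [ChartedSpace (EuclideanSpace ℝ (Fin N)) Q] [IsManifold (𝓡 N) ∞ Q]
  {Qbar : Type*} [TopologicalSpace Qbar]
  [ChartedSpace (EuclideanSpace ℝ (Fin n)) Qbar] [IsManifold (𝓡 n) ∞ Qbar]
  {G : Type*} [TopologicalSpace G] [ChartedSpace (EuclideanSpace ℝ (Fin k)) G] [Group G]
  [LieGroup (𝓡 k) ∞ G] [MulAction G Q] [ContMDiffSMul (𝓡 k) (𝓡 N) ∞ G Q] [ProperSMul G Q]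
  {π : Q → Qbar} {L : TangentBundle (𝓡 N) Q → ℝ}
  {D : ∀ q : Q, Submodule ℝ (TangentSpace (𝓡 N) q)}
  {φ : OpenPartialHomeomorph Qbar (EuclideanSpace ℝ (Fin n))}

/-- The submersion `π` has local sections, written as functions of the coordinates `z` of the chart. -/
theorem exists_localSection (hD : IsHorizontalDistribution (n := n) π D)
    (hφ : φ ∈ IsManifold.maximalAtlas (𝓡 n) ∞ Qbar) {q : Q} (hq : π q ∈ φ.source) :
    ∃ σ : Euc n → Q, σ (φ (π q)) = q ∧ ∀ᶠ z in 𝓝 (φ (π q)), π (σ z) ∈ φ.source ∧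
      φ (π (σ z)) = z ∧ ContMDiffAt 𝓘(ℝ, Euc n) (𝓡 N) ∞ σ z := by
  let ψ := extChartAt (𝓡 N) q
  -- a right inverse of the derivative of the projection
  have hsurj : Function.Surjective (redVel φ π q) := fun y =>
    ⟨_, redVel_horLift hD hφ hq y⟩
  obtain ⟨R, hR⟩ := (redVel φ π q : Euc N →L[ℝ] Euc n).toLinearMap.exists_rightInverse_of_surjective
    (LinearMap.range_eq_top.2 hsurj)
  let z₀ := φ (π q)
  let R' : Euc n →L[ℝ] Euc N := LinearMap.toContinuousLinearMap R
  let s : Euc n → Euc N := fun z => ψ q + R' (z - z₀)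
  have hs : ContDiff ℝ ∞ s := by fun_prop
  have hs0 : s z₀ = ψ q := by simp [s]
  let O : Set (Euc n) := s ⁻¹' (ψ.target ∩ ψ.symm ⁻¹' (π ⁻¹' φ.source))
  have hVopen : IsOpen (ψ.target ∩ ψ.symm ⁻¹' (π ⁻¹' φ.source)) :=
    (continuousOn_extChartAt_symm q).isOpen_inter_preimage (isOpen_extChartAt_target q)
      (φ.open_source.preimage hD.proj_smooth.continuous)
  have hO : IsOpen O := hVopen.preimage hs.continuous
  have hz₀ : z₀ ∈ O := by
    rw [mem_preimage, hs0]
    refine ⟨mem_extChartAt_target q, ?_⟩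
    change π (ψ.symm (ψ q)) ∈ φ.source
    rw [extChartAt_to_inv]; exact hq
  have hτ : ∀ z ∈ O, ContMDiffAt 𝓘(ℝ, Euc n) (𝓡 N) ∞ (fun z => ψ.symm (s z)) z := fun z hz =>
    ((contMDiffOn_extChartAt_symm q).contMDiffAt
      ((isOpen_extChartAt_target q).mem_nhds hz.1)).comp z hs.contMDiff.contMDiffAt
  let f : Euc n → Euc n := fun z => φ (π (ψ.symm (s z)))
  have hf : ContDiffOn ℝ ∞ f O := fun z hz => by
    have h1 := ContMDiffAt.comp (g := fun q => φ (π q)) z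
      (contMDiffAt_chart_proj hD.proj_smooth hφ (q := ψ.symm (s z)) hz.2) (hτ z hz)
    exact h1.contDiffAt.contDiffWithinAt
  have hfz : HasFDerivAt f (ContinuousLinearMap.id ℝ (Euc n)) z₀ := by
    have h1 := hasMFDerivAt_extChartAt_symm_self (𝓡 N) q
    have h2 : HasFDerivAt (fun x => φ (π (ψ.symm x))) (redVel φ π q : Euc N →L[ℝ] Euc n) (ψ q) := by
      have key : ∀ q' : Q, q' = q → HasMFDerivAt (𝓡 N) 𝓘(ℝ, Euc n) (fun q => φ (π q)) q'
          (redVel φ π q : Euc N →L[ℝ] Euc n) := by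
        rintro _ rfl
        exact hasMFDerivAt_chart_proj hD.proj_smooth hφ hq
      exact ((key _ (extChartAt_to_inv (I := 𝓡 N) q)).comp (ψ q) h1).hasFDerivAt
    have h3 : HasFDerivAt s R' z₀ := by
      exact (R'.hasFDerivAt.comp (f := fun z => z - z₀) z₀
        ((hasFDerivAt_id z₀).sub_const z₀)).const_add (ψ q)
    rw [← hs0] at h2
    have h4 := h2.comp z₀ h3
    have h5 : (redVel φ π q : Euc N →L[ℝ] Euc n).comp R' = ContinuousLinearMap.id ℝ (Euc n) :=
      ContinuousLinearMap.ext fun y => LinearMap.congr_fun hR y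
    exact h5 ▸ h4
  obtain ⟨e, hef, hze, heO, hesymm⟩ := exists_smooth_localInverse hO hf hz₀ hfz
  have hf0 : f z₀ = z₀ := by
    change φ (π (ψ.symm (s z₀))) = z₀
    rw [hs0, extChartAt_to_inv]
  have hz₀t : z₀ ∈ e.target := by
    have := e.map_source hze
    rwa [hef, hf0] at this
  have hez : e.symm z₀ = z₀ := by
    have := e.left_inv hze
    rwa [hef, hf0] at this
  refine ⟨fun z => ψ.symm (s (e.symm z)), ?_, ?_⟩
  · change ψ.symm (s (e.symm z₀)) = q
    rw [hez, hs0, extChartAt_to_inv]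
  · filter_upwards [e.open_target.mem_nhds hz₀t] with z hz
    have hzO := heO (e.map_target hz)
    refine ⟨hzO.2, ?_, ?_⟩
    · have := e.right_inv hz
      rwa [hef] at this
    · exact (hτ _ hzO).comp z
        (hesymm.contDiffAt (e.open_target.mem_nhds hz)).contMDiffAt

/-- Orbit maps of a free smooth action are immersions: the kernel of the derivative would be
spanned by a left-invariant vector field, along whose integral curves the orbit map is constant. -/
theorem eq_zero_of_mfderiv_orbit_eq_zero (hfree : ∀ (g : G) (q : Q), g • q = q → g = 1) (q : Q)
    (ξ : TangentSpace (𝓡 k) (1 : G))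
    (hξ : mfderiv (𝓡 k) (𝓡 N) (fun g : G => g • q) 1 ξ = 0) : ξ = 0 := by
  have : LieGroup (𝓡 k) (minSmoothness ℝ 3) G :=
    LieGroup.of_le (n := ∞) (by simp [minSmoothness_of_isRCLikeNormedField]; exact ENat.LEInfty.out)
  have hα : ContMDiff (𝓡 k) (𝓡 N) ∞ (fun g : G => g • q) :=
    contMDiff_id.smul contMDiff_const
  have hX := (contMDiff_mulInvariantVectorField (I := 𝓡 k) (G := G) ξ).of_le
    (show (1 : ℕ∞ω) ≤ minSmoothness ℝ 2 by simp [minSmoothness_of_isRCLikeNormedField])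
  obtain ⟨c, hc0, hc⟩ := exists_isMIntegralCurveAt_of_contMDiffAt_boundaryless (0 : ℝ)
    (hX.contMDiffAt (x := 1))
  -- by equivariance the left-invariant vector field is in the kernel everywhere
  have hker : ∀ g : G, mfderiv (𝓡 k) (𝓡 N) (fun g : G => g • q) g
      (mulInvariantVectorField (I := 𝓡 k) ξ g) = 0 := by
    intro g
    have h1 : HasMFDerivAt (𝓡 k) (𝓡 k) (fun x : G => g * x) 1
        (mfderiv (𝓡 k) (𝓡 k) (fun x : G => g * x) 1) :=
      ((contMDiff_mul_left (I := 𝓡 k) (n := ∞) (a := g)).mdifferentiable (by simp)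
        1).hasMFDerivAt
    have h2 := (hasMFDerivAt_const_smul (k := k) g ((1 : G) • q)).comp 1
      ((hα.mdifferentiable (by simp)) 1).hasMFDerivAt
    have h3 : ∀ g' : G, g' = g → HasMFDerivAt (𝓡 k) (𝓡 N) (fun g : G => g • q) g'
        (mfderiv (𝓡 k) (𝓡 N) (fun g : G => g • q) g : Euc k →L[ℝ] Euc N) := by
      rintro _ rfl
      exact ((hα.mdifferentiable (by simp)) _).hasMFDerivAt
    have h4 := (h3 (g * 1) (mul_one g)).comp 1 h1
    have h5 : (fun g : G => g • q) ∘ (fun x : G => g * x) =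
      (fun p : Q => g • p) ∘ fun g : G => g • q := funext fun x => mul_smul g x q
    rw [h5] at h4
    have h6 := DFunLike.congr_fun (hasMFDerivAt_unique h4 h2) ξ
    refine h6.trans ((congrArg (mfderiv (𝓡 N) (𝓡 N) (fun p : Q => g • p) ((1 : G) • q))
      hξ).trans (map_zero _))
  have hα0 : ∀ᶠ t in 𝓝 (0 : ℝ), HasMFDerivAt 𝓘(ℝ, ℝ) (𝓡 N) (fun s => c s • q) t
      ((1 : ℝ →L[ℝ] ℝ).smulRight (0 : TangentSpace (𝓡 N) (c t • q))) := by
    filter_upwards [hc] with t ht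
    have h1 := HasMFDerivAt.comp_velocity (f := fun g : G => g • q)
      ((hα.mdifferentiable (by simp)) (c t)).hasMFDerivAt ht
    exact (hker (c t)) ▸ h1
  -- in a chart, the image of the integral curve under the orbit map is constant
  let ψ := extChartAt (𝓡 N) q
  have hcont : ContinuousAt (fun t => c t • q) 0 := hα0.self_of_nhds.continuousAt
  have hc0q : c 0 • q = q := by rw [hc0, one_smul]
  have hsrc : ∀ᶠ t in 𝓝 (0 : ℝ), c t • q ∈ (chartAt (Euc N) q).source :=
    hcont.eventually ((chartAt (Euc N) q).open_source.mem_nhds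
      (by simp only [hc0q]; exact mem_chart_source _ q))
  obtain ⟨δ, hδ, hball⟩ := Metric.eventually_nhds_iff_ball.1 (hα0.and hsrc)
  rw [Real.ball_eq_Ioo] at hball
  have hmem : (0 : ℝ) ∈ Ioo (0 - δ) (0 + δ) := ⟨by linarith, by linarith⟩
  have hd : ∀ t ∈ Ioo (0 - δ) (0 + δ), HasDerivAt (fun t => ψ (c t • q)) 0 t := by
    intro t ht
    have h1 := HasMFDerivAt.comp_velocity (c := fun t => c t • q)
      (mdifferentiableAt_extChartAt (I := 𝓡 N) (hball t ht).2).hasMFDerivAt (hball t ht).1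
    have h2 := (hasMFDerivAt_velocity_iff (E := Euc N) (f := fun t => ψ (c t • q))).1 h1
    exact h2.congr_deriv (map_zero (mfderiv (𝓡 N) 𝓘(ℝ, Euc N) ψ (c t • q)))
  have hconst : ∀ᶠ t in 𝓝 (0 : ℝ), c t = 1 := by
    filter_upwards [Ioo_mem_nhds hmem.1 hmem.2] with t ht
    have h3 := eq_of_hasDerivAt_zero hd ht hmem
    have h4 : c t • q = c 0 • q := (extChartAt (𝓡 N) q).injOn
      (by rw [extChartAt_source]; exact (hball t ht).2)
      (by rw [extChartAt_source]; exact (hball 0 hmem).2) h3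
    exact hfree _ q (h4.trans hc0q)
  have h1 : HasMFDerivAt 𝓘(ℝ, ℝ) (𝓡 k) c 0 ((1 : ℝ →L[ℝ] ℝ).smulRight
      (0 : TangentSpace (𝓡 k) (c 0))) := by
    have h2 := (velocity_const (I := 𝓡 k) (1 : G) 0).congr_of_eventuallyEq hconst
    exact h2
  have h2 := velocity_unique hc.self_of_nhds h1
  have h3 : (mulInvariantVectorField (I := 𝓡 k) ξ (c 0) : Euc k) =
      mulInvariantVectorField (I := 𝓡 k) ξ (1 : G) := by rw [hc0]
  have h4 : mulInvariantVectorField (I := 𝓡 k) ξ (1 : G) = ξ := by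
    have h5 : (fun x : G => 1 * x) = id := funext one_mul
    have h6 : HasMFDerivAt (𝓡 k) (𝓡 k) (fun x : G => 1 * x) 1
        (ContinuousLinearMap.id ℝ (TangentSpace (𝓡 k) (1 : G))) := by
      rw [h5]; exact hasMFDerivAt_id 1
    exact DFunLike.congr_fun h6.mfderiv ξ
  exact h4.symm.trans (h3.symm.trans h2)

end Trivialization

section Trivialization

variable {N n k : ℕ} {Q : Type*} [TopologicalSpace Q]
  [ChartedSpace (EuclideanSpace ℝ (Fin N)) Q] [IsManifold (𝓡 N) ∞ Q]
  {Qbar : Type*} [TopologicalSpace Qbar]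
  [ChartedSpace (EuclideanSpace ℝ (Fin n)) Qbar] [IsManifold (𝓡 n) ∞ Qbar]
  {G : Type*} [TopologicalSpace G] [ChartedSpace (EuclideanSpace ℝ (Fin k)) G] [Group G]
  [LieGroup (𝓡 k) ∞ G] [MulAction G Q] [ContMDiffSMul (𝓡 k) (𝓡 N) ∞ G Q] [ProperSMul G Q]
  {π : Q → Qbar} {L : TangentBundle (𝓡 N) Q → ℝ}
  {D : ∀ q : Q, Submodule ℝ (TangentSpace (𝓡 N) q)}
  {φ : OpenPartialHomeomorph Qbar (EuclideanSpace ℝ (Fin n))}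

omit [ChartedSpace (EuclideanSpace ℝ (Fin k)) G] [LieGroup (𝓡 k) ∞ G]
  [ContMDiffSMul (𝓡 k) (𝓡 N) ∞ G Q] in
/-- For a free proper action, the group element which moves one point to another depends
continuously on the two points. -/
theorem continuousAt_of_smul_eq (hfree : ∀ (g : G) (q : Q), g • q = q → g = 1) {τ : Q → Q}
    {γ : Q → G} {q : Q} (hτ : ContinuousAt τ q) (h : ∀ᶠ p in 𝓝 q, γ p • τ p = p) :
    ContinuousAt γ q := by
  have hP := ProperSMul.isProperMap_smul_pair (G := G) (X := Q)
  have hinj : Function.Injective (fun gx => (gx.1 • gx.2, gx.2) : G × Q → Q × Q) := by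
    rintro ⟨g, x⟩ ⟨g', x'⟩ he
    simp only [Prod.mk.injEq] at he
    obtain ⟨he, rfl⟩ := he
    have h1 : (g'⁻¹ * g) • x = x := by rw [mul_smul, he, inv_smul_smul]
    have h2 := hfree _ _ h1
    rw [inv_mul_eq_one] at h2
    rw [h2]
  have hemb := Topology.IsClosedEmbedding.of_continuous_injective_isClosedMap hP.continuous hinj
    hP.isClosedMap
  have h1 : ContinuousAt (fun p => (γ p, τ p)) q := by
    rw [hemb.isInducing.continuousAt_iff]
    refine (continuousAt_id.prodMk hτ).congr ?_
    filter_upwards [h] with p hp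
    exact Prod.ext hp.symm rfl
  exact continuousAt_fst.comp h1

/-- The group component `γ` of a point relative to a local section `σ` is smooth near the section:
the map `(g, z) ↦ g • σ z` is an immersion at the unit, so it has a smooth left inverse. -/
theorem contMDiffAt_of_smul_eq (h : IsChaplyginSystem (n := n) (k := k) G π L D)
    (hφ : φ ∈ IsManifold.maximalAtlas (𝓡 n) ∞ Qbar) {q₀ : Q} (hq₀ : π q₀ ∈ φ.source)
    (hq₀z : φ (π q₀) = 0) {σ : Euc n → Q} (hσ0 : σ 0 = q₀)
    (hσ : ∀ᶠ z in 𝓝 (0 : Euc n), π (σ z) ∈ φ.source ∧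
      φ (π (σ z)) = z ∧ ContMDiffAt 𝓘(ℝ, Euc n) (𝓡 N) ∞ σ z) {γ : Q → G}
    (hγ : ∀ᶠ q in 𝓝 q₀, γ q • σ (φ (π q)) = q) :
    ∀ᶠ q in 𝓝 q₀, ContMDiffAt (𝓡 N) (𝓡 k) ∞ γ q := by
  let ψ := extChartAt (𝓡 N) q₀
  let χ := extChartAt (𝓡 k) (1 : G)
  let x₀ : Euc k × Euc n := (χ 1, 0)
  obtain ⟨B, hBsub, hB, h0B⟩ := mem_nhds_iff.1 hσ
  let m : Euc k × Euc n → Q := fun x => χ.symm x.1 • σ x.2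
  have hm : ∀ x ∈ χ.target ×ˢ B, ContMDiffAt 𝓘(ℝ, Euc k × Euc n) (𝓡 N) ∞ m x := by
    rintro x ⟨hx1, hx2⟩
    have h1 : ContMDiffAt 𝓘(ℝ, Euc k × Euc n) (𝓡 k) ∞ (fun x => χ.symm x.1) x :=
      ContMDiffAt.comp (g := χ.symm) x ((contMDiffOn_extChartAt_symm (1 : G)).contMDiffAt
        ((isOpen_extChartAt_target (1 : G)).mem_nhds hx1)) contDiff_fst.contMDiff.contMDiffAt
    have h2 : ContMDiffAt 𝓘(ℝ, Euc k × Euc n) (𝓡 N) ∞ (fun x => σ x.2) x :=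
      ContMDiffAt.comp (g := σ) x (hBsub hx2).2.2 contDiff_snd.contMDiff.contMDiffAt
    exact h1.smul h2
  have hopen : IsOpen (χ.target ×ˢ B) := (isOpen_extChartAt_target (1 : G)).prod hB
  let O : Set (Euc k × Euc n) := (χ.target ×ˢ B) ∩ m ⁻¹' ψ.source
  have hO : IsOpen O := ContinuousOn.isOpen_inter_preimage
    (fun x hx => (hm x hx).continuousAt.continuousWithinAt) hopen (isOpen_extChartAt_source q₀)
  have hm0 : m x₀ = q₀ := by
    change χ.symm (χ 1) • σ 0 = q₀
    rw [extChartAt_to_inv, one_smul, hσ0]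
  have hx₀ : x₀ ∈ O := ⟨⟨mem_extChartAt_target _, h0B⟩, by
    rw [mem_preimage, hm0]; exact mem_extChartAt_source q₀⟩
  let f₁ : Euc k × Euc n → Euc N := fun x => ψ (m x)
  have hf₁ : ContDiffOn ℝ ∞ f₁ O := fun x hx => by
    have h1 := ContMDiffAt.comp (g := ψ) x (contMDiffAt_extChartAt' (I := 𝓡 N) (n := ∞)
      (x := q₀) (by rw [← extChartAt_source (𝓡 N)]; exact hx.2)) (hm x hx.1)
    exact h1.contDiffAt.contDiffWithinAt
  let A₁ := fderiv ℝ f₁ x₀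
  have hA₁ : HasFDerivAt f₁ A₁ x₀ :=
    ((hf₁.contDiffAt (hO.mem_nhds hx₀)).differentiableAt (by simp)).hasFDerivAt
  have hf₁0 : f₁ x₀ = ψ q₀ := congrArg ψ hm0
  have hψ := hasMFDerivAt_extChartAt_symm_self (𝓡 N) q₀
  have hχ := hasMFDerivAt_extChartAt_symm_self (𝓡 k) (1 : G)
  -- the derivative of `m` at the unit
  have hm' : HasMFDerivAt 𝓘(ℝ, Euc k × Euc n) (𝓡 N) m x₀ A₁ := by
    rw [← hf₁0] at hψ
    have h1 := hψ.comp x₀ hA₁.hasMFDerivAt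
    refine (h1.congr_of_eventuallyEq ?_)
    filter_upwards [hO.mem_nhds hx₀] with x hx
    exact (ψ.left_inv hx.2).symm
  have hker : ∀ x, A₁ x = 0 → x = 0 := by
    rintro ⟨ξ, w⟩ hx
    have hw : w = 0 := by
      have h1 : HasMFDerivAt (𝓡 N) 𝓘(ℝ, Euc n) (fun q => φ (π q)) (m x₀)
          (redVel φ π q₀ : Euc N →L[ℝ] Euc n) := by
        rw [hm0]; exact hasMFDerivAt_chart_proj h.proj_smooth hφ hq₀
      have h2 : HasFDerivAt (fun x => φ (π (m x)))
        ((redVel φ π q₀ : Euc N →L[ℝ] Euc n).comp A₁) x₀ := (h1.comp x₀ hm').hasFDerivAt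
      have h3 : HasFDerivAt (fun x => φ (π (m x))) (ContinuousLinearMap.snd ℝ (Euc k) (Euc n))
          x₀ := by
        refine (hasFDerivAt_snd).congr_of_eventuallyEq ?_
        filter_upwards [hO.mem_nhds hx₀] with x hx
        change φ (π (χ.symm x.1 • σ x.2)) = x.2
        rw [h.proj_smul]
        exact (hBsub hx.1.2).2.1
      have h4 := DFunLike.congr_fun (h3.unique h2) (ξ, w)
      exact h4.trans ((congrArg (redVel φ π q₀ : Euc N →L[ℝ] Euc n) hx).trans (map_zero _))
    subst hw
    have h1 : HasMFDerivAt (𝓡 k) (𝓡 N) (fun g : G => g • q₀) (χ.symm (χ 1))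
        (mfderiv (𝓡 k) (𝓡 N) (fun g : G => g • q₀) 1 : Euc k →L[ℝ] Euc N) := by
      rw [extChartAt_to_inv]
      exact (((contMDiff_id.smul contMDiff_const : ContMDiff (𝓡 k) (𝓡 N) ∞
        (fun g : G => g • q₀)).mdifferentiable (by simp)) 1).hasMFDerivAt
    have h2 := h1.comp (χ 1) hχ
    have h3 : HasMFDerivAt 𝓘(ℝ, Euc k) 𝓘(ℝ, Euc k × Euc n) (fun a : Euc k => (a, (0 : Euc n)))
        (χ 1) (ContinuousLinearMap.inl ℝ (Euc k) (Euc n)) :=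
      (hasFDerivAt_prodMk_left (χ 1) (0 : Euc n)).hasMFDerivAt
    have h4 := HasMFDerivAt.comp (g := m) (χ 1) hm' h3
    have h5 : m ∘ (fun a : Euc k => (a, (0 : Euc n))) = (fun g : G => g • q₀) ∘ χ.symm :=
      funext fun a => by simp [m, hσ0]
    rw [h5] at h4
    have h6 := DFunLike.congr_fun (hasMFDerivAt_unique h2 h4) ξ
    have h7 : ξ = 0 := eq_zero_of_mfderiv_orbit_eq_zero h.free q₀ ξ (h6.trans hx)
    rw [h7]; rfl
  obtain ⟨A, hA⟩ := A₁.toLinearMap.exists_leftInverse_of_injective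
    (LinearMap.ker_eq_bot'.2 hker)
  let A' : Euc N →L[ℝ] Euc k × Euc n := LinearMap.toContinuousLinearMap A
  have hf : ContDiffOn ℝ ∞ (fun x => A' (f₁ x)) O := A'.contDiff.comp_contDiffOn hf₁
  have hfx : HasFDerivAt (fun x => A' (f₁ x)) (ContinuousLinearMap.id ℝ (Euc k × Euc n)) x₀ := by
    have h1 : A'.comp A₁ = ContinuousLinearMap.id ℝ (Euc k × Euc n) :=
      ContinuousLinearMap.ext fun x => LinearMap.congr_fun hA x
    exact h1 ▸ A'.hasFDerivAt.comp x₀ hA₁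
  obtain ⟨e, hef, hxe, heO, hesymm⟩ := exists_smooth_localInverse hO hf hx₀ hfx
  have hef' : ∀ x, e x = A' (ψ (m x)) := fun x => congrFun hef x
  have hq₀e : A' (ψ q₀) ∈ e.target := by
    have := e.map_source hxe
    rwa [hef', hm0] at this
  have hq₀e' : e.symm (A' (ψ q₀)) = x₀ := by
    have := e.left_inv hxe
    rwa [hef', hm0] at this
  have hψc : ContinuousAt ψ q₀ := continuousAt_extChartAt q₀
  have hpc : ContinuousAt (fun q => φ (π q)) q₀ :=
    (contMDiffAt_chart_proj h.proj_smooth hφ hq₀).continuousAt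
  have hγc : ContinuousAt γ q₀ := by
    refine continuousAt_of_smul_eq (τ := fun q => σ (φ (π q))) h.free ?_ hγ
    refine ContinuousAt.comp (g := σ) ?_ hpc
    rw [hq₀z]
    exact hσ.self_of_nhds.2.2.continuousAt
  have hγ1 : γ q₀ = 1 := by
    have := hγ.self_of_nhds
    rw [hq₀z, hσ0] at this
    exact h.free _ _ this
  have heq : ∀ᶠ q in 𝓝 q₀, γ q = χ.symm (e.symm (A' (ψ q))).1 := by
    have h1 : ContinuousAt (fun q => (χ (γ q), φ (π q))) q₀ := by
      refine ContinuousAt.prodMk (ContinuousAt.comp (g := χ) ?_ hγc) hpc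
      rw [hγ1]
      exact continuousAt_extChartAt _
    have h2 : ∀ᶠ q in 𝓝 q₀, (χ (γ q), φ (π q)) ∈ e.source := by
      refine h1.eventually (e.open_source.mem_nhds ?_)
      simp only [hγ1, hq₀z]
      exact hxe
    have h3 : ∀ᶠ q in 𝓝 q₀, γ q ∈ χ.source :=
      hγc.eventually ((isOpen_extChartAt_source (1 : G)).mem_nhds
        (by rw [hγ1]; exact mem_extChartAt_source _))
    filter_upwards [h2, h3, hγ] with q h2 h3 h4
    have h5 : m (χ (γ q), φ (π q)) = q := by
      change χ.symm (χ (γ q)) • σ (φ (π q)) = q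
      rw [χ.left_inv h3, h4]
    have h6 := e.left_inv h2
    rw [hef', h5] at h6
    rw [h6, χ.left_inv h3]
  have hsrc : ∀ᶠ q in 𝓝 q₀, q ∈ ψ.source ∧ A' (ψ q) ∈ e.target ∧
      (e.symm (A' (ψ q))).1 ∈ χ.target := by
    have h1 : ContinuousAt (fun q => A' (ψ q)) q₀ := A'.continuous.continuousAt.comp hψc
    have h2 : ContinuousAt (fun q => (e.symm (A' (ψ q))).1) q₀ :=
      continuousAt_fst.comp (ContinuousAt.comp (g := e.symm) (e.continuousAt_symm hq₀e) h1)
    have h3 : ∀ᶠ q in 𝓝 q₀, q ∈ ψ.source := extChartAt_source_mem_nhds q₀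
    refine h3.and ((h1.eventually (e.open_target.mem_nhds hq₀e)).and
      (h2.eventually ((isOpen_extChartAt_target (1 : G)).mem_nhds ?_)))
    simp only [hq₀e']
    exact mem_extChartAt_target _
  filter_upwards [heq.eventually_nhds, hsrc] with q hq1 ⟨hq2, hq3, hq4⟩
  refine ContMDiffAt.congr_of_eventuallyEq ?_ hq1
  have h1 : ContMDiffAt (𝓡 N) 𝓘(ℝ, Euc N) ∞ ψ q := contMDiffAt_extChartAt'
    (by rw [← extChartAt_source (𝓡 N)]; exact hq2)
  have h2 : ContMDiffAt (𝓡 N) 𝓘(ℝ, Euc k × Euc n) ∞ (fun q => A' (ψ q)) q :=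
    A'.contMDiff.contMDiffAt.comp q h1
  have h3 : ContMDiffAt (𝓡 N) 𝓘(ℝ, Euc k × Euc n) ∞ (fun q => e.symm (A' (ψ q))) q :=
    ContMDiffAt.comp (g := e.symm) q
      (hesymm.contDiffAt (e.open_target.mem_nhds hq3)).contMDiffAt h2
  have h4 : ContMDiffAt (𝓡 N) 𝓘(ℝ, Euc k) ∞ (fun q => (e.symm (A' (ψ q))).1) q :=
    ContMDiffAt.comp (g := (Prod.fst : Euc k × Euc n → Euc k)) q
      contDiff_fst.contMDiff.contMDiffAt h3
  exact ContMDiffAt.comp (g := χ.symm) q ((contMDiffOn_extChartAt_symm (1 : G)).contMDiffAt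
    ((isOpen_extChartAt_target (1 : G)).mem_nhds hq4)) h4

/-- Over a ball around the origin of the chart, the projection is a trivial principal bundle: there
are a smooth section `σ` and a smooth map `γ` to the group with `q = γ q • σ (φ (π q))`. -/
theorem exists_trivialization (h : IsChaplyginSystem (n := n) (k := k) G π L D)
    (hφ : φ ∈ IsManifold.maximalAtlas (𝓡 n) ∞ Qbar) (h0 : 0 ∈ φ.target) :
    ∃ (σ : Euc n → Q) (γ : Q → G) (r : ℝ), 0 < r ∧
      (∀ z ∈ Metric.ball (0 : Euc n) r, π (σ z) ∈ φ.source ∧ φ (π (σ z)) = z ∧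
        ContMDiffAt 𝓘(ℝ, Euc n) (𝓡 N) ∞ σ z) ∧
      ∀ q, π q ∈ φ.source → φ (π q) ∈ Metric.ball (0 : Euc n) r →
        γ q • σ (φ (π q)) = q ∧ ContMDiffAt (𝓡 N) (𝓡 k) ∞ γ q := by
  classical
  obtain ⟨q₀, hq₀⟩ := h.proj_surjective (φ.symm 0)
  have hq₀s : π q₀ ∈ φ.source := by rw [hq₀]; exact φ.map_target h0
  have hq₀z : φ (π q₀) = 0 := by rw [hq₀]; exact φ.right_inv h0
  obtain ⟨σ, hσ0, hσ⟩ := exists_localSection h.isHorizontalDistribution hφ hq₀s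
  rw [hq₀z] at hσ0 hσ
  let γ : Q → G := fun q => if hg : ∃ g : G, g • σ (φ (π q)) = q then hg.choose else 1
  obtain ⟨r₀, hr₀, hball⟩ := Metric.eventually_nhds_iff_ball.1 hσ
  have hγ : ∀ q, π q ∈ φ.source → φ (π q) ∈ Metric.ball (0 : Euc n) r₀ →
      γ q • σ (φ (π q)) = q := by
    intro q hq hqr
    obtain ⟨h1, h2, -⟩ := hball _ hqr
    have hg : ∃ g : G, g • σ (φ (π q)) = q := (h.proj_fiber _ _).1 (φ.injOn hq h1 h2.symm)
    change (if hg : ∃ g : G, g • σ (φ (π q)) = q then hg.choose else 1) • σ (φ (π q)) = q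
    rw [dif_pos hg]
    exact hg.choose_spec
  have hnhds : ∀ q, π q ∈ φ.source → φ (π q) ∈ Metric.ball (0 : Euc n) r₀ →
      ∀ᶠ p in 𝓝 q, γ p • σ (φ (π p)) = p := by
    intro q hq hqr
    filter_upwards [h.proj_smooth.continuous.continuousAt.eventually (φ.open_source.mem_nhds hq),
      (contMDiffAt_chart_proj h.proj_smooth hφ hq).continuousAt.eventually
        (Metric.isOpen_ball.mem_nhds hqr)] with p hp hp' using hγ p hp hp'
  have hsmooth := contMDiffAt_of_smul_eq h hφ hq₀s hq₀z hσ0 hσ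
    (hnhds q₀ hq₀s (by rw [hq₀z]; exact Metric.mem_ball_self hr₀))
  rw [← hσ0] at hsmooth
  obtain ⟨r, hr, hrsub⟩ := Metric.eventually_nhds_iff_ball.1
    ((hσ.self_of_nhds.2.2.continuousAt.eventually hsmooth).and
      (Metric.ball_mem_nhds (0 : Euc n) hr₀))
  refine ⟨σ, γ, r, hr, fun z hz => hball z (hrsub z hz).2, fun q hq hqr => ?_⟩
  have hqr₀ := (hrsub _ hqr).2
  refine ⟨hγ q hq hqr₀, ?_⟩
  -- near `q`, the map `γ` is a translate of its restriction to a neighbourhood of the section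
  let g := γ q
  have hg : g • σ (φ (π q)) = q := hγ q hq hqr₀
  have hg' : g⁻¹ • q = σ (φ (π q)) := by rw [inv_smul_eq_iff, hg]
  have h1 : ContMDiffAt (𝓡 N) (𝓡 k) ∞ (fun p => g * γ (g⁻¹ • p)) q := by
    refine (contMDiff_mul_left (I := 𝓡 k) (a := g)).contMDiffAt.comp q ?_
    refine ContMDiffAt.comp (g := γ) q ?_
      (ContMDiffSMul.contMDiff_const_smul (I := 𝓡 k) (I' := 𝓡 N) g⁻¹).contMDiffAt
    rw [hg']
    exact (hrsub _ hqr).1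
  refine h1.congr_of_eventuallyEq ?_
  have h2 : ∀ᶠ p in 𝓝 q, γ (g⁻¹ • p) • σ (φ (π (g⁻¹ • p))) = g⁻¹ • p :=
    (ContMDiffSMul.contMDiff_const_smul (I := 𝓡 k) (I' := 𝓡 N) (n := ∞) (M := Q)
      g⁻¹).continuous.continuousAt.eventually
      (hnhds (g⁻¹ • q) (by rwa [h.proj_smul]) (by rwa [h.proj_smul]))
  filter_upwards [hnhds q hq hqr₀, h2] with p hp hp2
  rw [h.proj_smul] at hp2
  have h3 : (γ p)⁻¹ • ((g * γ (g⁻¹ • p)) • σ (φ (π p))) = σ (φ (π p)) := by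
    rw [mul_smul, hp2, smul_inv_smul, inv_smul_eq_iff, hp]
  rw [← mul_smul] at h3
  exact inv_mul_eq_one.1 (h.free _ _ h3)

end Trivialization

/-! ### Tubular neighbourhoods of the set of equilibria -/

section Tube

variable {N n k : ℕ} {Q : Type*} [TopologicalSpace Q]
  [ChartedSpace (EuclideanSpace ℝ (Fin N)) Q] [IsManifold (𝓡 N) ∞ Q]
  {Qbar : Type*} [TopologicalSpace Qbar]
  [ChartedSpace (EuclideanSpace ℝ (Fin n)) Qbar] [IsManifold (𝓡 n) ∞ Qbar]
  {G : Type*} [TopologicalSpace G] [ChartedSpace (EuclideanSpace ℝ (Fin k)) G] [Group G]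
  [LieGroup (𝓡 k) ∞ G] [MulAction G Q] [ContMDiffSMul (𝓡 k) (𝓡 N) ∞ G Q] [ProperSMul G Q]
  {π : Q → Qbar} {L : TangentBundle (𝓡 N) Q → ℝ}
  {D : ∀ q : Q, Submodule ℝ (TangentSpace (𝓡 N) q)}
  {F : ∀ v : TangentBundle (𝓡 N) Q, TangentSpace (𝓡 N) v.proj →L[ℝ] ℝ}
  {φ : OpenPartialHomeomorph Qbar (EuclideanSpace ℝ (Fin n))}
  {M K : Matrix (Fin n) (Fin n) ℝ} {b : ℝ}

/-- The part of `D` over the domain of `φ` where the reduced phase is in the ball of radius `r`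
around the equilibrium. -/
def phaseTube (D : ∀ q : Q, Submodule ℝ (TangentSpace (𝓡 N) q))
    (φ : OpenPartialHomeomorph Qbar (EuclideanSpace ℝ (Fin n))) (π : Q → Qbar) (r : ℝ) :
    Set (TangentBundle (𝓡 N) Q) :=
  {v | v ∈ constraintSetOver π D φ ∧ phase φ π v ∈ Metric.ball (0 : Euc n × Euc n) r}

theorem isOpen_phase_preimage (hD : IsHorizontalDistribution (n := n) π D)
    (hφ : φ ∈ IsManifold.maximalAtlas (𝓡 n) ∞ Qbar) {B : Set (Euc n × Euc n)} (hB : IsOpen B) :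
    IsOpen ({v : TangentBundle (𝓡 N) Q | π v.proj ∈ φ.source} ∩ phase φ π ⁻¹' B) :=
  ContinuousOn.isOpen_inter_preimage
    (fun _ hv => (contMDiffAt_phase hD.proj_smooth hφ hv).continuousAt.continuousWithinAt)
    (φ.open_source.preimage (hD.proj_smooth.continuous.comp
      (FiberBundle.continuous_proj (Euc N) (TangentSpace (𝓡 N) : Q → Type _)))) hB

theorem horLift_zero (hD : IsHorizontalDistribution (n := n) π D)
    (hφ : φ ∈ IsManifold.maximalAtlas (𝓡 n) ∞ Qbar) {q : Q} (hq : π q ∈ φ.source) :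
    horLift D φ π q 0 = 0 :=
  (eq_horLift hD hφ hq (D q).zero_mem (map_zero _)).symm

theorem contMDiffAt_proj_comp {E H M : Type*} [NormedAddCommGroup E] [NormedSpace ℝ E]
    [TopologicalSpace H] {I : ModelWithCorners ℝ E H} [TopologicalSpace M] [ChartedSpace H M]
    {f : Q → M} {v : TangentBundle (𝓡 N) Q} (hf : ContMDiffAt (𝓡 N) I ∞ f v.proj) :
    ContMDiffAt (𝓡 N).tangent I ∞ (fun v : TangentBundle (𝓡 N) Q => f v.proj) v :=
  ContMDiffAt.comp (g := f) v hf
    (Bundle.contMDiff_proj (IB := 𝓡 N) (n := ∞) (TangentSpace (𝓡 N) : Q → Type _)).contMDiffAt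

theorem contMDiffAt_tubeMap (hD : IsHorizontalDistribution (n := n) π D)
    (hφ : φ ∈ IsManifold.maximalAtlas (𝓡 n) ∞ Qbar) {σ : Euc n → Q} {γ : Q → G}
    {s : TangentBundle (𝓡 N) Q} {p : Euc n × Euc n} (hγ : ContMDiffAt (𝓡 N) (𝓡 k) ∞ γ s.proj)
    (hσ : ContMDiffAt 𝓘(ℝ, Euc n) (𝓡 N) ∞ σ p.1) (hs : π (γ s.proj • σ p.1) ∈ φ.source) :
    ContMDiffAt ((𝓡 N).tangent.prod 𝓘(ℝ, Euc n × Euc n)) (𝓡 N).tangent ∞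
      (fun p : TangentBundle (𝓡 N) Q × (Euc n × Euc n) =>
        horMap D φ π (γ p.1.proj • σ p.2.1, p.2.2)) (s, p) := by
  have h1 : ContMDiffAt ((𝓡 N).tangent.prod 𝓘(ℝ, Euc n × Euc n)) (𝓡 k) ∞
      (fun p : TangentBundle (𝓡 N) Q × (Euc n × Euc n) => γ p.1.proj) (s, p) :=
    ContMDiffAt.comp (g := fun v : TangentBundle (𝓡 N) Q => γ v.proj) (s, p)
      (contMDiffAt_proj_comp hγ) contMDiffAt_fst
  have h2 : ContMDiffAt ((𝓡 N).tangent.prod 𝓘(ℝ, Euc n × Euc n)) (𝓡 N) ∞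
      (fun p : TangentBundle (𝓡 N) Q × (Euc n × Euc n) => σ p.2.1) (s, p) :=
    ContMDiffAt.comp (g := fun p : Euc n × Euc n => σ p.1) (s, p)
      (ContMDiffAt.comp (g := σ) p hσ contDiff_fst.contMDiff.contMDiffAt) contMDiffAt_snd
  have h3 : ContMDiffAt ((𝓡 N).tangent.prod 𝓘(ℝ, Euc n × Euc n)) 𝓘(ℝ, Euc n) ∞
      (fun p : TangentBundle (𝓡 N) Q × (Euc n × Euc n) => p.2.2) (s, p) :=
    ContMDiffAt.comp (g := fun p : Euc n × Euc n => p.2) (s, p)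
      contDiff_snd.contMDiff.contMDiffAt contMDiffAt_snd
  exact ContMDiffAt.comp (g := horMap D φ π) (s, p)
    (contMDiffAt_horMap hD hφ (p := (γ s.proj • σ p.1, p.2)) hs) ((h1.smul h2).prodMk h3)

theorem contMDiffAt_tubeCoord (hD : IsHorizontalDistribution (n := n) π D)
    (hφ : φ ∈ IsManifold.maximalAtlas (𝓡 n) ∞ Qbar) {q₀ : Q} {γ : Q → G}
    {v : TangentBundle (𝓡 N) Q} (hγ : ContMDiffAt (𝓡 N) (𝓡 k) ∞ γ v.proj)
    (hv : π v.proj ∈ φ.source) :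
    ContMDiffAt (𝓡 N).tangent ((𝓡 N).tangent.prod 𝓘(ℝ, Euc n × Euc n)) ∞
      (fun v : TangentBundle (𝓡 N) Q =>
        ((⟨γ v.proj • q₀, (0 : Euc N)⟩ : TangentBundle (𝓡 N) Q), phase φ π v)) v := by
  have h2 : ContMDiff (𝓡 N) (𝓡 N).tangent ∞
      (fun q : Q => (⟨q, (0 : Euc N)⟩ : TangentBundle (𝓡 N) Q)) :=
    Bundle.contMDiff_zeroSection ℝ (TangentSpace (𝓡 N) : Q → Type _)
  have h3 : ContMDiffAt (𝓡 N) (𝓡 N) ∞ (fun q : Q => γ q • q₀) v.proj :=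
    hγ.smul contMDiffAt_const
  exact (ContMDiffAt.comp (g := fun q : Q => (⟨q, (0 : Euc N)⟩ : TangentBundle (𝓡 N) Q)) v
    h2.contMDiffAt (contMDiffAt_proj_comp h3)).prodMk (contMDiffAt_phase hD.proj_smooth hφ hv)

/-- With `q = γ q • σ (φ (π q))` as in `exists_trivialization`, the point `v` of the tube corresponds
to the equilibrium at `γ q • σ 0`, where `q` is the base point of `v`, and to the phase of `v`. -/
theorem isTubularNeighborhood_phaseTube (h : IsChaplyginSystem (n := n) (k := k) G π L D)
    (S : IsDampedOscillatorReduction π L D F φ M K b) (h0 : 0 ∈ φ.target) :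
    ∃ r₀ > 0, ∀ r, 0 < r → r ≤ r₀ → IsTubularNeighborhood (𝓡 N).tangent (Euc n × Euc n)
      (constraintSet D) (equilibriumSet π L D F φ) (phaseTube D φ π r) := by
  have hD := S.horizontal
  have hφ := S.chart
  obtain ⟨σ, γ, r₀, hr₀, hσ, hγ⟩ := exists_trivialization h hφ h0
  refine ⟨r₀, hr₀, fun r hr hrr₀ => ?_⟩
  have hz0 : (0 : Euc n) ∈ Metric.ball (0 : Euc n) r₀ := Metric.mem_ball_self hr₀
  have hball : ∀ p ∈ Metric.ball (0 : Euc n × Euc n) r, p.1 ∈ Metric.ball (0 : Euc n) r₀ := by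
    intro p hp
    rw [mem_ball_zero_iff] at hp ⊢
    exact (norm_fst_le p).trans_lt (hp.trans_le hrr₀)
  have hEP : ∀ s ∈ equilibriumSet π L D F φ, s.2 = 0 ∧ π s.proj ∈ φ.source ∧
      φ (π s.proj) = 0 := fun s hs => (mem_equilibriumSet_iff S).1 hs
  have hEPeq : ∀ s ∈ equilibriumSet π L D F φ, (⟨s.proj, (0 : Euc N)⟩ : TangentBundle (𝓡 N) Q) = s :=
    fun s hs => Bundle.TotalSpace.ext rfl (heq_of_eq (hEP s hs).1.symm)
  have hγs : ∀ s ∈ equilibriumSet π L D F φ, γ s.proj • σ 0 = s.proj := fun s hs => by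
    have := (hγ s.proj (hEP s hs).2.1 (by rw [(hEP s hs).2.2]; exact hz0)).1
    rwa [(hEP s hs).2.2] at this
  have hproj : ∀ (g : G), ∀ z ∈ Metric.ball (0 : Euc n) r₀, π (g • σ z) ∈ φ.source ∧
      φ (π (g • σ z)) = z := fun g z hz => by
    rw [h.proj_smul]; exact ⟨(hσ z hz).1, (hσ z hz).2.1⟩
  have hγσ : ∀ (g : G), ∀ z ∈ Metric.ball (0 : Euc n) r₀, γ (g • σ z) = g := fun g z hz => by
    have h1 := (hγ (g • σ z) (hproj g z hz).1 (by rw [(hproj g z hz).2]; exact hz)).1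
    rw [(hproj g z hz).2] at h1
    have h2 : (g⁻¹ * γ (g • σ z)) • σ z = σ z := by rw [mul_smul, h1, inv_smul_smul]
    exact (inv_mul_eq_one.1 (h.free _ _ h2)).symm
  let Ψ : TangentBundle (𝓡 N) Q × (Euc n × Euc n) → TangentBundle (𝓡 N) Q :=
    fun p => horMap D φ π (γ p.1.proj • σ p.2.1, p.2.2)
  let Θ : TangentBundle (𝓡 N) Q → TangentBundle (𝓡 N) Q × (Euc n × Euc n) :=
    fun v => (⟨γ v.proj • σ 0, (0 : Euc N)⟩, phase φ π v)
  refine ⟨fun s hs => ?_, ⟨_, isOpen_phase_preimage hD hφ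
    (Metric.isOpen_ball (x := (0 : Euc n × Euc n)) (ε := r)), ?_⟩, r, hr, Ψ, Θ,
    ?_, ?_, ?_, ?_, ?_, ?_, ?_⟩
  · obtain ⟨h1, h2, h3⟩ := hEP s hs
    refine ⟨hs.1, ?_⟩
    have h4 : phase φ π s = 0 := Prod.ext h3
      ((congrArg (redVel φ π s.proj) h1).trans (map_zero _))
    rw [h4]
    exact Metric.mem_ball_self hr
  · ext v
    exact ⟨fun hv => ⟨hv.1.1, hv.1.2, hv.2⟩, fun hv => ⟨⟨hv.1, hv.2.1⟩, hv.2.2⟩⟩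
  · rintro ⟨s, p⟩ ⟨hs, hp⟩
    have h1 := hproj (γ s.proj) p.1 (hball p hp)
    refine ⟨⟨horMap_mem _, h1.1⟩, ?_⟩
    have h2 : phase φ π (Ψ (s, p)) = p :=
      (phase_horMap hD hφ (p := (γ s.proj • σ p.1, p.2)) h1.1).trans (Prod.ext h1.2 rfl)
    rw [h2]; exact hp
  · intro v hv
    refine ⟨(mem_equilibriumSet_iff S).2 ⟨rfl, ?_⟩, hv.2⟩
    exact hproj _ 0 hz0
  · rintro ⟨s, p⟩ ⟨hs, hp⟩
    have h1 := hproj (γ s.proj) p.1 (hball p hp)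
    refine Prod.ext ?_ ?_
    · have h2 : γ (γ s.proj • σ p.1) • σ 0 = s.proj := by
        rw [hγσ _ _ (hball p hp), hγs s hs]
      exact (congrArg (fun q : Q => (⟨q, (0 : Euc N)⟩ : TangentBundle (𝓡 N) Q)) h2).trans
        (hEPeq s hs)
    · exact (phase_horMap hD hφ (p := (γ s.proj • σ p.1, p.2)) h1.1).trans (Prod.ext h1.2 rfl)
  · intro v hv
    have h1 : γ (γ v.proj • σ 0) • σ (φ (π v.proj)) = v.proj := by
      rw [hγσ _ _ hz0]
      exact (hγ _ hv.1.2 (hball (phase φ π v) hv.2)).1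
    change horMap D φ π (γ (γ v.proj • σ 0) • σ (φ (π v.proj)), (phase φ π v).2) = v
    rw [h1]
    exact horMap_phase hD hφ hv.1
  · rintro ⟨s, p⟩ ⟨hs, hp⟩
    have h1 := (hγ s.proj (hEP s hs).2.1 (by rw [(hEP s hs).2.2]; exact hz0)).2
    have h2 := (hσ p.1 (hball p hp)).2.2
    have h3 := (hproj (γ s.proj) p.1 (hball p hp)).1
    have h4 := contMDiffAt_tubeMap (σ := σ) (γ := γ) (s := s) (p := p) hD hφ h1 h2 h3
    exact h4.contMDiffWithinAt
  · intro v hv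
    exact (contMDiffAt_tubeCoord hD hφ (hγ v.proj hv.1.2 (hball (phase φ π v) hv.2)).2
      hv.1.2).contMDiffWithinAt
  · intro s hs
    have h1 : Ψ (s, 0) = horMap D φ π (s.proj, 0) :=
      congrArg (fun q : Q => horMap D φ π (q, 0)) (hγs s hs)
    have h2 : horMap D φ π (s.proj, 0) = (⟨s.proj, (0 : Euc N)⟩ : TangentBundle (𝓡 N) Q) :=
      Bundle.TotalSpace.ext rfl (heq_of_eq (horLift_zero hD hφ (hEP s hs).2.1))
    exact h1.trans (h2.trans (hEPeq s hs))

end Tube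

/-! ### The damped linear oscillator -/

section Oscillator

/-- A continuous function which is positive away from the origin and homogeneous of degree `2` is
bounded below by a multiple of the square of the norm. -/
theorem exists_pos_mul_sq_le {E : Type*} [NormedAddCommGroup E] [NormedSpace ℝ E]
    [FiniteDimensional ℝ E] {f : E → ℝ} (hf : Continuous f)
    (hhom : ∀ (t : ℝ) x, f (t • x) = t ^ 2 * f x) (hpos : ∀ x, x ≠ 0 → 0 < f x) :
    ∃ c > 0, ∀ x, c * ‖x‖ ^ 2 ≤ f x := by
  have hf0 : f 0 = 0 := by simpa using hhom 0 0
  rcases (Metric.sphere (0 : E) 1).eq_empty_or_nonempty with he | hne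
  · refine ⟨1, one_pos, fun x => ?_⟩
    have hx : x = 0 := by
      by_contra h
      have : ‖x‖⁻¹ • x ∈ Metric.sphere (0 : E) 1 := by
        rw [mem_sphere_zero_iff_norm, norm_smul, norm_inv, norm_norm,
          inv_mul_cancel₀ (norm_ne_zero_iff.2 h)]
      rw [he] at this
      exact this
    rw [hx, hf0]; simp
  · obtain ⟨x₀, hx₀, hmin⟩ := (isCompact_sphere (0 : E) 1).exists_isMinOn hne hf.continuousOn
    have hx₀' : x₀ ≠ 0 := by
      rintro rfl
      simp at hx₀
    refine ⟨f x₀, hpos x₀ hx₀', fun x => ?_⟩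
    rcases eq_or_ne x 0 with rfl | hx
    · rw [hf0]; simp
    · have h1 : ‖x‖⁻¹ • x ∈ Metric.sphere (0 : E) 1 := by
        rw [mem_sphere_zero_iff_norm, norm_smul, norm_inv, norm_norm,
          inv_mul_cancel₀ (norm_ne_zero_iff.2 hx)]
      have h2 : f x = ‖x‖ ^ 2 * f (‖x‖⁻¹ • x) := by
        rw [← hhom, smul_inv_smul₀ (norm_ne_zero_iff.2 hx)]
      rw [h2, mul_comm]
      exact mul_le_mul_of_nonneg_left (hmin h1) (sq_nonneg _)

theorem exists_le_mul_sq {E : Type*} [NormedAddCommGroup E] [NormedSpace ℝ E]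
    [FiniteDimensional ℝ E] {f : E → ℝ} (hf : Continuous f)
    (hhom : ∀ (t : ℝ) x, f (t • x) = t ^ 2 * f x) :
    ∃ C > 0, ∀ x, f x ≤ C * ‖x‖ ^ 2 := by
  obtain ⟨B, hB⟩ := (isCompact_sphere (0 : E) 1).bddAbove_image hf.continuousOn
  have hf0 : f 0 = 0 := by simpa using hhom 0 0
  refine ⟨max B 1, by positivity, fun x => ?_⟩
  rcases eq_or_ne x 0 with rfl | hx
  · rw [hf0]; simp
  · have h1 : ‖x‖⁻¹ • x ∈ Metric.sphere (0 : E) 1 := by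
      rw [mem_sphere_zero_iff_norm, norm_smul, norm_inv, norm_norm,
        inv_mul_cancel₀ (norm_ne_zero_iff.2 hx)]
    have h2 : f x = ‖x‖ ^ 2 * f (‖x‖⁻¹ • x) := by
      rw [← hhom, smul_inv_smul₀ (norm_ne_zero_iff.2 hx)]
    rw [h2, mul_comm]
    exact mul_le_mul_of_nonneg_right ((hB (mem_image_of_mem f h1)).trans (le_max_left _ _))
      (sq_nonneg _)

variable {n : ℕ} {M K : Matrix (Fin n) (Fin n) ℝ} {b : ℝ}

theorem exists_posDef_bounds (hM : M.PosDef) :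
    ∃ m > 0, ∀ x : Euc n, m * ‖x‖ ^ 2 ≤ x.ofLp ⬝ᵥ (M *ᵥ x.ofLp) :=
  exists_pos_mul_sq_le (f := fun x : Euc n => x.ofLp ⬝ᵥ (M *ᵥ x.ofLp)) (by
    simp only [dotProduct, mulVec]; fun_prop) (fun t x => by
    simp only [WithLp.ofLp_smul, mulVec_smul, smul_dotProduct, dotProduct_smul, smul_eq_mul]; ring)
    (fun x hx => by
      have := hM.dotProduct_mulVec_pos (x := x.ofLp) (by simpa using hx)
      simpa using this)

theorem exists_abs_dotProduct_le (M : Matrix (Fin n) (Fin n) ℝ) :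
    ∃ C > 0, ∀ x y : Euc n, |x.ofLp ⬝ᵥ (M *ᵥ y.ofLp)| ≤ C * (‖x‖ * ‖y‖) := by
  let A : Euc n →L[ℝ] Euc n := LinearMap.toContinuousLinearMap (Matrix.toEuclideanLin M)
  refine ⟨‖A‖ + 1, by positivity, fun x y => ?_⟩
  have h1 : x.ofLp ⬝ᵥ (M *ᵥ y.ofLp) = inner ℝ (A y) x := by
    simp [A, EuclideanSpace.inner_eq_star_dotProduct]
  rw [h1]
  calc |inner ℝ (A y) x| ≤ ‖A y‖ * ‖x‖ := abs_real_inner_le_norm _ _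
    _ ≤ (‖A‖ * ‖y‖) * ‖x‖ := by gcongr; exact A.le_opNorm y
    _ ≤ (‖A‖ + 1) * (‖x‖ * ‖y‖) := by
      have := mul_nonneg (norm_nonneg x) (norm_nonneg y)
      linarith

/-- The energy with a small cross term, a strict Lyapunov function of the damped oscillator. -/
def lyapunov (M K : Matrix (Fin n) (Fin n) ℝ) (δ : ℝ) (p : Euc n × Euc n) : ℝ :=
  (1 / 2) * (p.2.ofLp ⬝ᵥ (M *ᵥ p.2.ofLp)) + (1 / 2) * (p.1.ofLp ⬝ᵥ (K *ᵥ p.1.ofLp)) +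
    δ * (p.1.ofLp ⬝ᵥ (M *ᵥ p.2.ofLp))

theorem continuous_lyapunov (δ : ℝ) : Continuous (lyapunov M K δ) := by
  unfold lyapunov dotProduct mulVec dotProduct; fun_prop

theorem hasDerivWithinAt_dotProduct_mulVec {x y : ℝ → Euc n} {x' y' : Euc n} {J : Set ℝ} {t : ℝ}
    (hx : HasDerivWithinAt x x' J t) (hy : HasDerivWithinAt y y' J t) :
    HasDerivWithinAt (fun t => (x t).ofLp ⬝ᵥ (M *ᵥ (y t).ofLp))
      (x'.ofLp ⬝ᵥ (M *ᵥ (y t).ofLp) + (x t).ofLp ⬝ᵥ (M *ᵥ y'.ofLp)) J t := by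
  let A : Euc n →L[ℝ] Euc n := LinearMap.toContinuousLinearMap (Matrix.toEuclideanLin M)
  have h1 : ∀ x y : Euc n, x.ofLp ⬝ᵥ (M *ᵥ y.ofLp) = inner ℝ x (A y) := fun x y => by
    simp [A, EuclideanSpace.inner_eq_star_dotProduct, dotProduct_comm]
  simp only [h1]
  exact ((hx.inner ℝ (A.hasFDerivAt.comp_hasDerivWithinAt t hy)).congr_deriv (add_comm _ _))

/-- The derivative of the Lyapunov function along solutions. The damping gives a negative definite
form in the velocity, and the cross term one in the position. -/
theorem hasDerivWithinAt_lyapunov (hM : M.PosDef) (hK : K.PosDef) (δ : ℝ)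
    {x : ℝ → Euc n × Euc n} {J : Set ℝ} {t : ℝ}
    (hx : HasDerivWithinAt x (oscillatorField M K b (x t)) J t) :
    HasDerivWithinAt (fun t => lyapunov M K δ (x t))
      (-b * ((x t).2.ofLp ⬝ᵥ (x t).2.ofLp) + δ * ((x t).2.ofLp ⬝ᵥ (M *ᵥ (x t).2.ofLp)) -
        δ * ((x t).1.ofLp ⬝ᵥ (K *ᵥ (x t).1.ofLp)) - δ * b * ((x t).1.ofLp ⬝ᵥ (x t).2.ofLp)) J t := by
  have hMu : IsUnit M.det := hM.isUnit.map Matrix.detMonoidHom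
  have hMM : ∀ x : Fin n → ℝ, M *ᵥ (M⁻¹ *ᵥ x) = x := fun x => by
    rw [mulVec_mulVec, Matrix.mul_nonsing_inv _ hMu, one_mulVec]
  have hsymm : ∀ A : Matrix (Fin n) (Fin n) ℝ, A.PosDef → ∀ a c : Fin n → ℝ,
      a ⬝ᵥ (A *ᵥ c) = c ⬝ᵥ (A *ᵥ a) := fun A hA a c => by
    have hA : Aᵀ = A := by simpa using hA.isHermitian.eq
    rw [dotProduct_mulVec, ← mulVec_transpose, hA, dotProduct_comm]
  have h1 : HasDerivWithinAt (fun t => (x t).1) (x t).2 J t :=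
    (ContinuousLinearMap.fst ℝ (Euc n) (Euc n)).hasFDerivAt.comp_hasDerivWithinAt t hx
  have h2 : HasDerivWithinAt (fun t => (x t).2) (oscillatorField M K b (x t)).2 J t :=
    (ContinuousLinearMap.snd ℝ (Euc n) (Euc n)).hasFDerivAt.comp_hasDerivWithinAt t hx
  refine ((((hasDerivWithinAt_dotProduct_mulVec (M := M) h2 h2).const_mul (1 / 2)).add
    ((hasDerivWithinAt_dotProduct_mulVec (M := K) h1 h1).const_mul (1 / 2))).add
    ((hasDerivWithinAt_dotProduct_mulVec (M := M) h1 h2).const_mul δ)).congr_deriv ?_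
  have h3 : (oscillatorField M K b (x t)).2.ofLp =
    -(M⁻¹ *ᵥ (K *ᵥ (x t).1.ofLp + b • (x t).2.ofLp)) := rfl
  rw [hsymm M hM _ (x t).2.ofLp, h3, hsymm K hK (x t).2.ofLp]
  simp only [mulVec_neg, hMM, dotProduct_neg, dotProduct_add, dotProduct_smul, smul_eq_mul]
  rw [hsymm K hK (x t).2.ofLp]
  ring

/-- `lyapunov M K δ` is comparable with the square of the norm, with constants `c` and `C`, and
decays with the exponential rate `2 * rate` along solutions of the oscillator; the left-hand side of
`decay` is the derivative computed in `hasDerivWithinAt_lyapunov`. -/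
structure IsLyapunovDecay (M K : Matrix (Fin n) (Fin n) ℝ) (b δ c C rate : ℝ) : Prop where
  lower_pos : 0 < c
  upper_pos : 0 < C
  rate_pos : 0 < rate
  lower : ∀ p, c * ‖p‖ ^ 2 ≤ lyapunov M K δ p
  upper : ∀ p, lyapunov M K δ p ≤ C * ‖p‖ ^ 2
  decay : ∀ p : Euc n × Euc n, -b * (p.2.ofLp ⬝ᵥ p.2.ofLp) +
    δ * (p.2.ofLp ⬝ᵥ (M *ᵥ p.2.ofLp)) - δ * (p.1.ofLp ⬝ᵥ (K *ᵥ p.1.ofLp)) -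
    δ * b * (p.1.ofLp ⬝ᵥ p.2.ofLp) ≤ -(2 * rate) * lyapunov M K δ p

theorem exists_isLyapunovDecay (hM : M.PosDef) (hK : K.PosDef) (hb : 0 < b) :
    ∃ δ c C rate, IsLyapunovDecay M K b δ c C rate := by
  obtain ⟨m, hm, hmM⟩ := exists_posDef_bounds hM
  obtain ⟨κ, hκ, hκK⟩ := exists_posDef_bounds hK
  obtain ⟨μ, hμ, hμM⟩ := exists_abs_dotProduct_le M
  -- the cross term must be dominated by the energy, and its derivative by the damping
  obtain ⟨δ, hδ, hδ1, hδ2, hδ3⟩ : ∃ δ > 0, δ * μ ≤ m / 2 ∧ δ * μ ≤ κ / 2 ∧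
      δ * (μ + b ^ 2 / (2 * κ)) ≤ b / 2 := by
    refine ⟨min (min (m / 2 / μ) (κ / 2 / μ)) (b / 2 / (μ + b ^ 2 / (2 * κ))), by positivity,
      ?_, ?_, ?_⟩
    · rw [← le_div_iff₀ hμ]; exact (min_le_left _ _).trans (min_le_left _ _)
    · rw [← le_div_iff₀ hμ]; exact (min_le_left _ _).trans (min_le_right _ _)
    · rw [← le_div_iff₀ (by positivity)]; exact min_le_right _ _
  obtain ⟨C, hC, hCV⟩ := exists_le_mul_sq (continuous_lyapunov (M := M) (K := K) δ)
    (fun t p => by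
      simp only [lyapunov, Prod.smul_fst, Prod.smul_snd, WithLp.ofLp_smul, mulVec_smul,
        smul_dotProduct, dotProduct_smul, smul_eq_mul]; ring)
  have hnorm : ∀ p : Euc n × Euc n, ‖p‖ ^ 2 ≤ ‖p.1‖ ^ 2 + ‖p.2‖ ^ 2 := fun p => by
    rw [Prod.norm_def]
    rcases max_choice ‖p.1‖ ‖p.2‖ with h | h <;> rw [h] <;> nlinarith [sq_nonneg ‖p.1‖,
      sq_nonneg ‖p.2‖]
  have hself : ∀ x : Euc n, x.ofLp ⬝ᵥ x.ofLp = ‖x‖ ^ 2 := fun x => by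
    rw [← real_inner_self_eq_norm_sq, EuclideanSpace.inner_eq_star_dotProduct]; simp
  have hxy : ∀ x y : Euc n, |x.ofLp ⬝ᵥ y.ofLp| ≤ ‖x‖ * ‖y‖ := fun x y => by
    have := abs_real_inner_le_norm y x
    rw [EuclideanSpace.inner_eq_star_dotProduct] at this
    simpa [mul_comm] using this
  let c' := min (b / 2) (δ * κ / 2)
  have hc' : 0 < c' := by positivity
  refine ⟨δ, min m κ / 4, C, c' / (2 * C), by positivity, hC, by positivity, fun p => ?_, hCV,
    fun p => ?_⟩
  · have h1 := hmM p.2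
    have h2 := hκK p.1
    have h3 := abs_le.1 (hμM p.1 p.2)
    have h4 : ‖p.1‖ * ‖p.2‖ ≤ (‖p.1‖ ^ 2 + ‖p.2‖ ^ 2) / 2 := by
      nlinarith [sq_nonneg (‖p.1‖ - ‖p.2‖)]
    have h5 : -(δ * μ * ((‖p.1‖ ^ 2 + ‖p.2‖ ^ 2) / 2)) ≤ δ * (p.1.ofLp ⬝ᵥ (M *ᵥ p.2.ofLp)) := by
      have : μ * (‖p.1‖ * ‖p.2‖) ≤ μ * ((‖p.1‖ ^ 2 + ‖p.2‖ ^ 2) / 2) := by gcongr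
      nlinarith
    have h6 : δ * μ * ‖p.1‖ ^ 2 ≤ κ / 2 * ‖p.1‖ ^ 2 := by gcongr
    have h7 : δ * μ * ‖p.2‖ ^ 2 ≤ m / 2 * ‖p.2‖ ^ 2 := by gcongr
    have h8 : min m κ / 4 * ‖p‖ ^ 2 ≤ min m κ / 4 * (‖p.1‖ ^ 2 + ‖p.2‖ ^ 2) := by
      gcongr; exact hnorm p
    have h9 : min m κ * ‖p.1‖ ^ 2 ≤ κ * ‖p.1‖ ^ 2 := by gcongr; exact min_le_right _ _
    have h10 : min m κ * ‖p.2‖ ^ 2 ≤ m * ‖p.2‖ ^ 2 := by gcongr; exact min_le_left _ _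
    unfold lyapunov
    linarith
  · have h0 : -(2 * (c' / (2 * C))) * lyapunov M K δ p ≥ -(c' * ‖p‖ ^ 2) := by
      have h1 : 2 * (c' / (2 * C)) = c' / C := by field_simp
      have h2 : c' / C * lyapunov M K δ p ≤ c' / C * (C * ‖p‖ ^ 2) := by gcongr; exact hCV p
      have h3 : c' / C * (C * ‖p‖ ^ 2) = c' * ‖p‖ ^ 2 := by field_simp
      rw [h1]; linarith
    refine le_trans ?_ h0
    have h1 := abs_le.1 (hμM p.2 p.2)
    have h2 := hκK p.1
    have h3 := abs_le.1 (hxy p.1 p.2)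
    rw [hself]
    have h4 : b * (‖p.1‖ * ‖p.2‖) ≤ κ / 2 * ‖p.1‖ ^ 2 + b ^ 2 / (2 * κ) * ‖p.2‖ ^ 2 := by
      have : κ / 2 * ‖p.1‖ ^ 2 + b ^ 2 / (2 * κ) * ‖p.2‖ ^ 2 - b * (‖p.1‖ * ‖p.2‖) =
          (κ * ‖p.1‖ - b * ‖p.2‖) ^ 2 / (2 * κ) := by field_simp; ring
      have h5 : 0 ≤ (κ * ‖p.1‖ - b * ‖p.2‖) ^ 2 / (2 * κ) := by positivity
      linarith
    have h5 : -(δ * b * (p.1.ofLp ⬝ᵥ p.2.ofLp)) ≤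
        δ * (κ / 2 * ‖p.1‖ ^ 2 + b ^ 2 / (2 * κ) * ‖p.2‖ ^ 2) := by
      have : -(p.1.ofLp ⬝ᵥ p.2.ofLp) ≤ ‖p.1‖ * ‖p.2‖ := by linarith
      have h6 : b * -(p.1.ofLp ⬝ᵥ p.2.ofLp) ≤ b * (‖p.1‖ * ‖p.2‖) := by gcongr
      have h7 : δ * (b * -(p.1.ofLp ⬝ᵥ p.2.ofLp)) ≤
        δ * (κ / 2 * ‖p.1‖ ^ 2 + b ^ 2 / (2 * κ) * ‖p.2‖ ^ 2) := by gcongr; linarith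
      linarith
    have h6 : δ * (p.2.ofLp ⬝ᵥ (M *ᵥ p.2.ofLp)) ≤ δ * (μ * ‖p.2‖ ^ 2) := by
      gcongr; nlinarith
    have h7 : δ * (κ * ‖p.1‖ ^ 2) ≤ δ * (p.1.ofLp ⬝ᵥ (K *ᵥ p.1.ofLp)) := by gcongr
    have h8 : δ * (μ + b ^ 2 / (2 * κ)) * ‖p.2‖ ^ 2 ≤ b / 2 * ‖p.2‖ ^ 2 := by gcongr
    have h9 : c' * ‖p‖ ^ 2 ≤ c' * (‖p.1‖ ^ 2 + ‖p.2‖ ^ 2) := by gcongr; exact hnorm p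
    have h10 : c' * ‖p.2‖ ^ 2 ≤ b / 2 * ‖p.2‖ ^ 2 := by gcongr; exact min_le_left _ _
    have h11 : c' * ‖p.1‖ ^ 2 ≤ δ * κ / 2 * ‖p.1‖ ^ 2 := by gcongr; exact min_le_right _ _
    nlinarith

theorem IsLyapunovDecay.le_exp {δ c C rate : ℝ} (hV : IsLyapunovDecay M K b δ c C rate)
    (hM : M.PosDef) (hK : K.PosDef) {x : ℝ → Euc n × Euc n} {T : ℝ} (hT : 0 ≤ T)
    (hx : ∀ t ∈ Icc 0 T, HasDerivWithinAt x (oscillatorField M K b (x t)) (Icc 0 T) t) :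
    lyapunov M K δ (x T) ≤ Real.exp (-(2 * rate) * T) * lyapunov M K δ (x 0) := by
  have hd := fun t ht => ((hasDerivAt_id t).const_mul (2 * rate)).exp.hasDerivWithinAt.mul
    (hasDerivWithinAt_lyapunov hM hK δ (hx t ht))
  have hanti : AntitoneOn (fun t => Real.exp (2 * rate * t) * lyapunov M K δ (x t)) (Icc 0 T) := by
    refine antitoneOn_of_deriv_nonpos (convex_Icc 0 T) (fun t ht => (hd t ht).continuousWithinAt)
      (fun t ht => ?_) (fun t ht => ?_)
    · exact ((hd t (interior_subset ht)).mono interior_subset).differentiableWithinAt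
    · have h1 := (hd t (interior_subset ht)).hasDerivAt
        (mem_interior_iff_mem_nhds.1 ht)
      refine (h1.deriv).trans_le ?_
      have h2 := mul_le_mul_of_nonneg_left (hV.decay (x t)) (Real.exp_pos (2 * rate * t)).le
      simp only [id, mul_one]
      linarith
  have h1 := hanti ⟨le_rfl, hT⟩ ⟨hT, le_rfl⟩ hT
  simp only [mul_zero, Real.exp_zero, one_mul] at h1
  rw [neg_mul, Real.exp_neg, inv_mul_eq_div, le_div_iff₀ (Real.exp_pos _), mul_comm]
  exact h1

/-- Solutions of the damped oscillator exist for all times. -/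
theorem exists_oscillator_solution (M K : Matrix (Fin n) (Fin n) ℝ) (b : ℝ) (p : Euc n × Euc n) :
    ∃ x : ℝ → Euc n × Euc n, x 0 = p ∧ (∀ t, HasDerivAt x (oscillatorField M K b (x t)) t) ∧
      ContDiff ℝ 1 x := by
  let A₀ : (Euc n × Euc n) →ₗ[ℝ] (Euc n × Euc n) :=
    { toFun := oscillatorField M K b
      map_add' := fun x y => by
        refine Prod.ext rfl ?_
        ext i
        simp [oscillatorField, mulVec_add, mulVec_smul]; ring
      map_smul' := fun a x => by
        refine Prod.ext rfl ?_
        ext i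
        simp [oscillatorField, mulVec_add, mulVec_smul]; ring }
  let A : (Euc n × Euc n) →L[ℝ] (Euc n × Euc n) := LinearMap.toContinuousLinearMap A₀
  have hd : ∀ t : ℝ, HasDerivAt (fun t : ℝ => NormedSpace.exp (t • A) p)
      (oscillatorField M K b (NormedSpace.exp (t • A) p)) t := by
    intro t
    have h1 := hasDerivAt_exp_smul_const' (𝕂 := ℝ) A t
    exact (ContinuousLinearMap.apply ℝ (Euc n × Euc n) p).hasFDerivAt.comp_hasDerivAt t h1
  have h0 : NormedSpace.exp ((0 : ℝ) • A) p = p := by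
    have h1 : NormedSpace.exp ((0 : ℝ) • A) = 1 :=
      (congrArg NormedSpace.exp (zero_smul ℝ A)).trans NormedSpace.exp_zero
    exact DFunLike.congr_fun h1 p
  refine ⟨fun t => NormedSpace.exp (t • A) p, h0, hd, ?_⟩
  rw [contDiff_one_iff_deriv]
  refine ⟨fun t => (hd t).differentiableAt, ?_⟩
  have h1 : deriv (fun t : ℝ => NormedSpace.exp (t • A) p) =
    fun t => A (NormedSpace.exp (t • A) p) := funext fun t => (hd t).deriv
  rw [h1]
  exact A.continuous.comp (continuous_iff_continuousAt.2 fun t => (hd t).continuousAt)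

end Oscillator

/-! ### Nonholonomic trajectories near the equilibria -/

/-- A curve that starts in the open set `I`, inside the closed set `A`, either stays in `I` or
leaves it through `A \ I`. -/
theorem stays_or_exits {X : Type*} [TopologicalSpace X] {I A : Set X} (hI : IsOpen I)
    (hA : IsClosed A) (hIA : I ⊆ A) {c : ℝ → X} {T : ℝ} (hc : ContinuousOn c (Icc 0 T))
    (h0 : c 0 ∈ I) :
    (∀ t ∈ Icc 0 T, c t ∈ I) ∨ ∃ s ∈ Icc 0 T, (∀ t ∈ Ico 0 s, c t ∈ I) ∧ c s ∈ A \ I := by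
  by_contra! hcon
  obtain ⟨⟨t₀, ht₀, ht₀I⟩, hcon⟩ := hcon
  have hclosed : IsClosed (Icc 0 T ∩ c ⁻¹' Iᶜ) :=
    hc.preimage_isClosed_of_isClosed isClosed_Icc hI.isClosed_compl
  have hcomp : IsCompact (Icc 0 T ∩ c ⁻¹' Iᶜ) :=
    isCompact_Icc.of_isClosed_subset hclosed inter_subset_left
  obtain ⟨s, ⟨hs, hsI⟩, hmin⟩ := hcomp.exists_isLeast ⟨t₀, ht₀, ht₀I⟩
  have hlt : ∀ t ∈ Ico 0 s, c t ∈ I := fun t ht => by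
    by_contra h
    exact absurd (hmin ⟨⟨ht.1, ht.2.le.trans hs.2⟩, h⟩) (not_le.2 ht.2)
  have hs0 : 0 < s := lt_of_le_of_ne hs.1 (by rintro rfl; exact hsI h0)
  refine hcon s hs hlt ⟨?_, hsI⟩
  have h1 : s ∈ closure (Ico 0 s) := by
    rw [closure_Ico hs0.ne]; exact ⟨hs0.le, le_rfl⟩
  have h2 : ContinuousWithinAt c (Ico 0 s) s :=
    (hc s hs).mono fun t ht => ⟨ht.1, ht.2.le.trans hs.2⟩
  have h3 : c '' Ico 0 s ⊆ A := by
    rintro _ ⟨t, ht, rfl⟩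
    exact hIA (hlt t ht)
  exact hA.closure_subset_iff.2 h3 (h2.mem_closure_image h1)

section Trajectories

variable {N n k : ℕ} {Q : Type*} [TopologicalSpace Q]
  [ChartedSpace (EuclideanSpace ℝ (Fin N)) Q] [IsManifold (𝓡 N) ∞ Q]
  {Qbar : Type*} [TopologicalSpace Qbar]
  [ChartedSpace (EuclideanSpace ℝ (Fin n)) Qbar] [IsManifold (𝓡 n) ∞ Qbar]
  {G : Type*} [TopologicalSpace G] [ChartedSpace (EuclideanSpace ℝ (Fin k)) G] [Group G]
  [LieGroup (𝓡 k) ∞ G] [MulAction G Q] [ContMDiffSMul (𝓡 k) (𝓡 N) ∞ G Q] [ProperSMul G Q]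
  {π : Q → Qbar} {L : TangentBundle (𝓡 N) Q → ℝ}
  {D : ∀ q : Q, Submodule ℝ (TangentSpace (𝓡 N) q)}
  {F : ∀ v : TangentBundle (𝓡 N) Q, TangentSpace (𝓡 N) v.proj →L[ℝ] ℝ}
  {φ : OpenPartialHomeomorph Qbar (EuclideanSpace ℝ (Fin n))}
  {M K : Matrix (Fin n) (Fin n) ℝ} {b : ℝ}

/-- The closed tube is closed in all of `TQ`, not only over the domain of the chart: its projection
is in the image of a compact ball. -/
theorem isClosed_phase_norm_le [T2Space Qbar] (hD : IsHorizontalDistribution (n := n) π D)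
    (hφ : φ ∈ IsManifold.maximalAtlas (𝓡 n) ∞ Qbar) {R : ℝ}
    (hR : Metric.closedBall (0 : Euc n) R ⊆ φ.target) :
    IsClosed {v : TangentBundle (𝓡 N) Q | π v.proj ∈ φ.source ∧ ‖phase φ π v‖ ≤ R} := by
  have hcomp : IsCompact (φ.symm '' Metric.closedBall (0 : Euc n) R) :=
    (isCompact_closedBall _ _).image_of_continuousOn (φ.continuousOn_symm.mono hR)
  have hcont : Continuous fun v : TangentBundle (𝓡 N) Q => π v.proj :=
    hD.proj_smooth.continuous.comp
      (FiberBundle.continuous_proj (Euc N) (TangentSpace (𝓡 N) : Q → Type _))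
  have hclosed := hcomp.isClosed.preimage hcont
  have hsub : ∀ v : TangentBundle (𝓡 N) Q, π v.proj ∈ φ.symm '' Metric.closedBall (0 : Euc n) R →
      π v.proj ∈ φ.source := by
    rintro v ⟨z, hz, hzv⟩
    rw [← hzv]; exact φ.map_target (hR hz)
  have hph : ContinuousOn (phase φ π)
      ((fun v : TangentBundle (𝓡 N) Q => π v.proj) ⁻¹'
        (φ.symm '' Metric.closedBall (0 : Euc n) R)) := fun v hv =>
    (contMDiffAt_phase hD.proj_smooth hφ (hsub v hv)).continuousAt.continuousWithinAt
  convert hph.preimage_isClosed_of_isClosed hclosed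
    (Metric.isClosed_closedBall (x := (0 : Euc n × Euc n)) (ε := R)) using 1
  ext v
  constructor
  · rintro ⟨h1, h2⟩
    refine ⟨⟨φ (π v.proj), ?_, φ.left_inv h1⟩, mem_closedBall_zero_iff.2 h2⟩
    exact mem_closedBall_zero_iff.2 ((norm_fst_le (phase φ π v)).trans h2)
  · rintro ⟨h1, h2⟩
    exact ⟨hsub v h1, mem_closedBall_zero_iff.1 h2⟩

/-- A curve that starts in the tube of radius `R` around the equilibria either stays in it, or
reaches its boundary. -/
theorem phase_stays_or_exits [T2Space Qbar] (hD : IsHorizontalDistribution (n := n) π D)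
    (hφ : φ ∈ IsManifold.maximalAtlas (𝓡 n) ∞ Qbar) {R : ℝ}
    (hR : Metric.closedBall (0 : Euc n) R ⊆ φ.target) {c : ℝ → TangentBundle (𝓡 N) Q} {T : ℝ}
    (hc : ContinuousOn c (Icc 0 T)) (h0 : π (c 0).proj ∈ φ.source) (h0R : ‖phase φ π (c 0)‖ < R) :
    (∀ t ∈ Icc 0 T, π (c t).proj ∈ φ.source ∧ ‖phase φ π (c t)‖ < R) ∨
      ∃ s ∈ Icc 0 T, (∀ t ∈ Icc 0 s, π (c t).proj ∈ φ.source) ∧ ‖phase φ π (c s)‖ = R := by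
  have hopen : IsOpen {v : TangentBundle (𝓡 N) Q | π v.proj ∈ φ.source ∧ ‖phase φ π v‖ < R} := by
    have := isOpen_phase_preimage (N := N) hD hφ
      (Metric.isOpen_ball (x := (0 : Euc n × Euc n)) (ε := R))
    convert this using 1
    ext v
    exact and_congr_right fun _ => mem_ball_zero_iff.symm
  rcases stays_or_exits hopen (isClosed_phase_norm_le hD hφ hR)
    (fun v hv => ⟨hv.1, hv.2.le⟩) hc ⟨h0, h0R⟩ with h | ⟨s, hs, h1, h2, h3⟩
  · exact Or.inl h
  · refine Or.inr ⟨s, hs, fun t ht => ?_, ?_⟩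
    · rcases ht.2.eq_or_lt with rfl | hlt
      · exact h2.1
      · exact (h1 t ⟨ht.1, hlt⟩).1
    · exact le_antisymm h2.2 (not_lt.1 fun h => h3 ⟨h2.1, h⟩)

variable (S : IsDampedOscillatorReduction π L D F φ M K b)
include S

/-- The phase of a nonholonomic trajectory is a solution of the damped oscillator. -/
theorem hasDerivWithinAt_phase_trajectory {γ : ℝ → TangentBundle (𝓡 N) Q} {J : Set ℝ}
    (hγ : IsNonholonomicTrajectoryOn L D F γ J) {t : ℝ} (ht : t ∈ J)
    (hs : π (γ t).proj ∈ φ.source) :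
    HasDerivWithinAt (fun t => phase φ π (γ t)) (oscillatorField M K b (phase φ π (γ t))) J t := by
  obtain ⟨W, hW, hd⟩ := hγ t ht
  have h1 := ((isNonholonomicVector_iff S ⟨hW.1, hs⟩ W).1 hW).2.2
  exact (hasDerivWithinAt_phase S.horizontal S.chart hs hd).congr_deriv h1

/-- Trajectories which start near the equilibria stay near them, and their phases decay. -/
theorem phase_trajectory_decay [T2Space Qbar] {δ c C rate R : ℝ}
    (hV : IsLyapunovDecay M K b δ c C rate)
    (hR : Metric.closedBall (0 : Euc n) R ⊆ φ.target) (hR0 : 0 < R)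
    {γ : ℝ → TangentBundle (𝓡 N) Q} {J : Set ℝ} (hJ : J.OrdConnected) (h0J : 0 ∈ J)
    (hγ : IsNonholonomicTrajectoryOn L D F γ J) (h0 : π (γ 0).proj ∈ φ.source)
    (h0R : lyapunov M K δ (phase φ π (γ 0)) < c * R ^ 2) {t : ℝ} (ht : t ∈ J) (ht0 : 0 ≤ t) :
    γ t ∈ phaseTube D φ π R ∧ lyapunov M K δ (phase φ π (γ t)) ≤
      Real.exp (-(2 * rate) * t) * lyapunov M K δ (phase φ π (γ 0)) := by
  have hsub : Icc 0 t ⊆ J := hJ.out h0J ht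
  have hcont : ContinuousOn γ (Icc 0 t) := fun s hs => by
    obtain ⟨W, -, hW⟩ := hγ s (hsub hs)
    exact hW.continuousWithinAt.mono hsub
  have hdecay : ∀ s ∈ Icc 0 t, (∀ τ ∈ Icc 0 s, π (γ τ).proj ∈ φ.source) →
      lyapunov M K δ (phase φ π (γ s)) ≤
        Real.exp (-(2 * rate) * s) * lyapunov M K δ (phase φ π (γ 0)) := by
    intro s hs hsrc
    have hsub' : Icc 0 s ⊆ J := (Icc_subset_Icc_right hs.2).trans hsub
    exact hV.le_exp S.mass_posDef S.stiffness_posDef (x := fun t => phase φ π (γ t)) hs.1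
      fun τ hτ => (hasDerivWithinAt_phase_trajectory S hγ (hsub' hτ) (hsrc τ hτ)).mono hsub'
  have hnonneg : 0 ≤ lyapunov M K δ (phase φ π (γ 0)) :=
    (mul_nonneg hV.lower_pos.le (sq_nonneg _)).trans (hV.lower _)
  have hlt : ∀ p, lyapunov M K δ p < c * R ^ 2 → ‖p‖ < R := fun p hp => by
    have h1 := (hV.lower p).trans_lt hp
    exact lt_of_pow_lt_pow_left₀ 2 hR0.le (lt_of_mul_lt_mul_left h1 hV.lower_pos.le)
  rcases phase_stays_or_exits S.horizontal S.chart hR hcont h0 (hlt _ h0R) with h | ⟨s, hs, h1, h2⟩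
  · obtain ⟨W, hW, -⟩ := hγ t ht
    exact ⟨⟨⟨hW.1, (h t ⟨ht0, le_rfl⟩).1⟩, mem_ball_zero_iff.2 (h t ⟨ht0, le_rfl⟩).2⟩,
      hdecay t ⟨ht0, le_rfl⟩ fun τ hτ => (h τ hτ).1⟩
  · exfalso
    have h3 := hdecay s hs h1
    have h4 : Real.exp (-(2 * rate) * s) ≤ 1 := by
      rw [Real.exp_le_one_iff]
      nlinarith [hV.rate_pos, hs.1]
    have h5 := hlt _ ((h3.trans (mul_le_of_le_one_left hnonneg h4)).trans_lt h0R)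
    exact h5.ne h2

/-- Near the equilibria there are trajectories for all positive times: the horizontal lifts of the
solutions of the damped oscillator. -/
theorem exists_trajectory [T2Space Q] (h : IsChaplyginSystem (n := n) (k := k) G π L D)
    {δ c C rate R : ℝ} (hV : IsLyapunovDecay M K b δ c C rate)
    (hR : Metric.closedBall (0 : Euc n) R ⊆ φ.target) (hR0 : 0 < R)
    {v : TangentBundle (𝓡 N) Q} (hv : v ∈ constraintSetOver π D φ)
    (hvR : lyapunov M K δ (phase φ π v) < c * R ^ 2) :
    ∃ γ : ℝ → TangentBundle (𝓡 N) Q, γ 0 = v ∧ IsNonholonomicTrajectoryOn L D F γ (Ici 0) := by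
  have hD := S.horizontal
  have hφ := S.chart
  obtain ⟨x, hx0, hx, hx1⟩ := exists_oscillator_solution M K b (phase φ π v)
  have hxV : ∀ t, 0 ≤ t → (x t).1 ∈ φ.target := by
    intro t ht
    have h1 := hV.le_exp S.mass_posDef S.stiffness_posDef ht
      (fun s _ => (hx s).hasDerivWithinAt)
    have h2 : Real.exp (-(2 * rate) * t) ≤ 1 := by
      rw [Real.exp_le_one_iff]
      nlinarith [hV.rate_pos]
    have hnonneg : 0 ≤ lyapunov M K δ (x 0) :=
      (mul_nonneg hV.lower_pos.le (sq_nonneg _)).trans (hV.lower _)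
    rw [← hx0] at hvR
    have h3 := ((hV.lower _).trans (h1.trans (mul_le_of_le_one_left hnonneg h2))).trans_lt hvR
    have h4 : ‖x t‖ < R :=
      lt_of_pow_lt_pow_left₀ 2 hR0.le (lt_of_mul_lt_mul_left h3 hV.lower_pos.le)
    exact hR (mem_closedBall_zero_iff.2 ((norm_fst_le _).trans h4.le))
  have hz : ∀ t, HasDerivAt (fun t => (x t).1) (x t).2 t := fun t =>
    (ContinuousLinearMap.fst ℝ (Euc n) (Euc n)).hasFDerivAt.comp_hasDerivAt t (hx t)
  have hζ : ∀ t, HasDerivAt (fun t => (x t).2) (oscillatorField M K b (x t)).2 t := fun t =>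
    (ContinuousLinearMap.snd ℝ (Euc n) (Euc n)).hasFDerivAt.comp_hasDerivAt t (hx t)
  have hx0' : φ (π v.proj) = (x 0).1 := by rw [hx0]; rfl
  obtain ⟨c, hc0, hc⟩ := exists_horizontalLift_Ici h hφ hz (contDiff_snd.comp hx1) hxV
    (q := v.proj) hv.2 hx0'
  refine ⟨fun t => horMap D φ π (c t, (x t).2), ?_, fun t ht => ?_⟩
  · change horMap D φ π (c 0, (x 0).2) = v
    rw [hc0, hx0]
    exact horMap_phase hD hφ hv
  · obtain ⟨h1, h2, h3⟩ := hc t ht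
    obtain ⟨h4, h5, h6⟩ := isTangentToConstraint_dHorMap hD hφ (p := (c t, (x t).2)) h1
      (horLift D φ π (c t) (x t).2) (oscillatorField M K b (x t)).2
    refine ⟨_, (isNonholonomicVector_iff S (v := horMap D φ π (c t, (x t).2))
      ⟨horMap_mem (c t, (x t).2), h1⟩ _).2 ⟨h4, h5, h6.trans ?_⟩,
      velocityWithin_horMap hD hφ h1 h3 (hζ t).hasDerivWithinAt⟩
    have h7 : phase φ π (horMap D φ π (c t, (x t).2)) = x t :=
      (phase_horMap hD hφ (p := (c t, (x t).2)) h1).trans (Prod.ext h2 rfl)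
    rw [h7]
    exact Prod.ext (redVel_horLift hD hφ h1 _) rfl

end Trajectories

/-! ### The distances defined by a horizontal lift of the contraction metric -/

section ContractionMetric

variable {n : ℕ} {M K : Matrix (Fin n) (Fin n) ℝ} {b ε : ℝ}

theorem continuous_contractionMetric :
    Continuous fun p : Euc n × Euc n => contractionMetric M K b ε p p := by
  simp only [contractionMetric, dotProduct, mulVec, Fintype.sum_sum_type, Sum.elim_inl,
    Sum.elim_inr]
  fun_prop

theorem contractionMetric_smul (t : ℝ) (p : Euc n × Euc n) :
    contractionMetric M K b ε (t • p) (t • p) = t ^ 2 * contractionMetric M K b ε p p := by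
  have h1 : Sum.elim (t • p).1.ofLp (t • p).2.ofLp = t • Sum.elim p.1.ofLp p.2.ofLp := by
    ext i; rcases i with i | i <;> simp
  rw [contractionMetric, h1, mulVec_smul, smul_dotProduct, dotProduct_smul, contractionMetric]
  simp only [smul_eq_mul]
  ring

theorem exists_contractionMetric_bounds (h : (contractionMatrix M K b ε).PosDef) :
    ∃ a > 0, ∃ A > 0, ∀ p : Euc n × Euc n, a * ‖p‖ ^ 2 ≤ contractionMetric M K b ε p p ∧
      contractionMetric M K b ε p p ≤ A * ‖p‖ ^ 2 := by
  obtain ⟨a, ha, ha'⟩ := exists_pos_mul_sq_le (continuous_contractionMetric (M := M) (K := K)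
    (b := b) (ε := ε)) contractionMetric_smul (fun p hp => by
      have h0 : Sum.elim p.1.ofLp p.2.ofLp ≠ 0 := fun h0 => hp (Prod.ext
        (PiLp.ext fun i => congrFun h0 (Sum.inl i)) (PiLp.ext fun i => congrFun h0 (Sum.inr i)))
      have h1 := h.dotProduct_mulVec_pos h0
      rwa [star_trivial] at h1)
  obtain ⟨A, hA, hA'⟩ := exists_le_mul_sq (continuous_contractionMetric (M := M) (K := K)
    (b := b) (ε := ε)) contractionMetric_smul
  exact ⟨a, ha, A, hA, fun p => ⟨ha' p, hA' p⟩⟩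

end ContractionMetric

section Distances

variable {N n k : ℕ} {Q : Type*} [TopologicalSpace Q]
  [ChartedSpace (EuclideanSpace ℝ (Fin N)) Q] [IsManifold (𝓡 N) ∞ Q]
  {Qbar : Type*} [TopologicalSpace Qbar]
  [ChartedSpace (EuclideanSpace ℝ (Fin n)) Qbar] [IsManifold (𝓡 n) ∞ Qbar]
  {G : Type*} [TopologicalSpace G] [ChartedSpace (EuclideanSpace ℝ (Fin k)) G] [Group G]
  [LieGroup (𝓡 k) ∞ G] [MulAction G Q] [ContMDiffSMul (𝓡 k) (𝓡 N) ∞ G Q] [ProperSMul G Q]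
  {π : Q → Qbar} {L : TangentBundle (𝓡 N) Q → ℝ}
  {D : ∀ q : Q, Submodule ℝ (TangentSpace (𝓡 N) q)}
  {F : ∀ v : TangentBundle (𝓡 N) Q, TangentSpace (𝓡 N) v.proj →L[ℝ] ℝ}
  {φ : OpenPartialHomeomorph Qbar (EuclideanSpace ℝ (Fin n))}
  {M K : Matrix (Fin n) (Fin n) ℝ} {b ε : ℝ} {𝒢 : TangentBundleMetric N Q}

theorem IsHorizontalLiftMetric.inner_eq (hD : IsHorizontalDistribution (n := n) π D)
    (hφ : φ ∈ IsManifold.maximalAtlas (𝓡 n) ∞ Qbar)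
    (h𝒢 : IsHorizontalLiftMetric π D φ M K b ε 𝒢) {v : TangentBundle (𝓡 N) Q}
    (hv : v ∈ constraintSetOver π D φ) {X : TangentSpace (𝓡 N).tangent v}
    (hX : IsHorizontalVector D v X) :
    𝒢.inner v X X = contractionMetric M K b ε (dPhase φ π v X) (dPhase φ π v X) := by
  rw [dPhase_apply hD.proj_smooth hφ hv.2]
  exact (h𝒢 v hv X hX).1 X hX

/-- The differential of the phase does not increase lengths: split a vector into a horizontal vector
and a vector in the kernel of `T(Tπ)`, which are orthogonal. -/
theorem IsHorizontalLiftMetric.contractionMetric_le (hD : IsHorizontalDistribution (n := n) π D)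
    (hφ : φ ∈ IsManifold.maximalAtlas (𝓡 n) ∞ Qbar)
    (h𝒢 : IsHorizontalLiftMetric π D φ M K b ε 𝒢) {v : TangentBundle (𝓡 N) Q}
    (hv : v ∈ constraintSetOver π D φ) (W : TangentSpace (𝓡 N).tangent v) :
    contractionMetric M K b ε (dPhase φ π v W) (dPhase φ π v W) ≤ 𝒢.inner v W W := by
  obtain ⟨X, hXt, hXp, hX⟩ := exists_isTangentToConstraint hD hφ hv
    (horLift D φ π v.proj (dPhase φ π v W).1) (dPhase φ π v W).2
  have hXh : IsHorizontalVector D v X := ⟨hXt, by rw [hXp]; exact horLift_mem _ _⟩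
  have hXW : dPhase φ π v X = dPhase φ π v W :=
    hX.trans (Prod.ext (redVel_horLift hD hφ hv.2 _) rfl)
  have hZ : tangentTangentMap (n := n) π v (W - X) = 0 := by
    refine (dPhase_eq_zero_iff hD.proj_smooth hφ hv.2 _).1 ?_
    rw [map_sub, hXW, sub_self]
  have h1 := h𝒢.inner_eq hD hφ hv hXh
  have h2 := (h𝒢 v hv X hXh).2 _ hZ
  have h3 : 0 ≤ 𝒢.inner v (W - X) (W - X) := by
    by_cases h : W - X = 0
    · rw [h, map_zero]
    · exact (𝒢.pos v _ h).le
  have h4 : 𝒢.inner v W W = 𝒢.inner v X X + 2 * 𝒢.inner v X (W - X) +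
      𝒢.inner v (W - X) (W - X) := by
    have h5 : 𝒢.inner v (W - X) X = 𝒢.inner v X (W - X) := 𝒢.symm v _ _
    have h6 : 𝒢.inner v W W = 𝒢.inner v (X + (W - X)) (X + (W - X)) := by
      rw [add_sub_cancel]
    rw [h6]
    simp only [map_add, _root_.add_apply]
    rw [h5]; ring
  rw [← hXW, ← h1, h4, h2]
  linarith

theorem metricEDist_le_constraintEDist (v w : TangentBundle (𝓡 N) Q) :
    metricEDist 𝒢 v w ≤ constraintEDist D 𝒢 v w := by
  let _ : ∀ u : TangentBundle (𝓡 N) Q, ENorm (TangentSpace (𝓡 N).tangent u) := metricENorm 𝒢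
  have : ∀ u : TangentBundle (𝓡 N) Q, ENormSMulClass ℝ (TangentSpace (𝓡 N).tangent u) :=
    fun u => ⟨fun r W => by
      have h1 : 𝒢.inner u (r • W) (r • W) = r ^ 2 * 𝒢.inner u W W := by
        simp only [map_smul, _root_.smul_apply, smul_eq_mul]; ring
      have h2 : √(𝒢.inner u (r • W) (r • W)) = ‖r‖ * √(𝒢.inner u W W) := by
        rw [h1, Real.sqrt_mul (sq_nonneg r), Real.sqrt_sq_eq_abs, Real.norm_eq_abs]
      have h3 := congrArg ENNReal.ofReal h2
      rw [ENNReal.ofReal_mul (norm_nonneg r), ofReal_norm] at h3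
      exact h3⟩
  refine le_iInf₂ fun c hc => ?_
  exact Manifold.riemannianEDist_le_pathELength hc.2.2.2 hc.1 hc.2.1 zero_le_one

variable (S : IsDampedOscillatorReduction π L D F φ M K b)
include S

/-- Near the equilibria, the norm of the phase is controlled by the distance to them. A path from
`v` to an equilibrium may leave the tube of radius `R`, but then the phase has already moved by at
least `R / 2`, hence by more than its initial norm. -/
theorem ofReal_phase_le_constraintEDist [T2Space Qbar] {a R : ℝ} (ha : 0 < a)
    (ha' : ∀ p : Euc n × Euc n, a * ‖p‖ ^ 2 ≤ contractionMetric M K b ε p p)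
    (hR : Metric.closedBall (0 : Euc n) R ⊆ φ.target)
    (h𝒢 : IsHorizontalLiftMetric π D φ M K b ε 𝒢) {v w : TangentBundle (𝓡 N) Q}
    (hv : v ∈ phaseTube D φ π (R / 2)) (hw : w ∈ equilibriumSet π L D F φ) :
    ENNReal.ofReal (√a * ‖phase φ π v‖) ≤ constraintEDist D 𝒢 v w := by
  have hD := S.horizontal
  have hφ := S.chart
  let _ : ∀ u : TangentBundle (𝓡 N) Q, ENorm (TangentSpace (𝓡 N).tangent u) := metricENorm 𝒢
  refine le_iInf₂ fun c hc => ?_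
  obtain ⟨hc0, hc1, hcD, hc⟩ := hc
  have hvR : ‖phase φ π v‖ < R / 2 := mem_ball_zero_iff.1 hv.2
  have hR0 : 0 < R := by linarith [norm_nonneg (phase φ π v)]
  obtain ⟨s, hs, hsrc, hle⟩ : ∃ s ∈ Icc (0 : ℝ) 1, (∀ t ∈ Icc 0 s, π (c t).proj ∈ φ.source) ∧
      ‖phase φ π v‖ ≤ ‖phase φ π (c s) - phase φ π (c 0)‖ := by
    rcases phase_stays_or_exits hD hφ hR hc.continuousOn (by rw [hc0]; exact hv.1.2)
      (by rw [hc0]; linarith) with h | ⟨s, hs, h1, h2⟩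
    · refine ⟨1, ⟨zero_le_one, le_rfl⟩, fun t ht => (h t ht).1, ?_⟩
      obtain ⟨h1, h2, h3⟩ := (mem_equilibriumSet_iff S).1 hw
      have h4 : phase φ π w = 0 := Prod.ext h3
        ((congrArg (redVel φ π w.proj) h1).trans (map_zero _))
      rw [hc1, h4, hc0, zero_sub, norm_neg]
    · refine ⟨s, hs, h1, ?_⟩
      have h3 := norm_sub_norm_le (phase φ π (c s)) (phase φ π (c 0))
      rw [hc0] at h3 ⊢
      linarith
  have hsub : Icc 0 s ⊆ Icc (0 : ℝ) 1 := Icc_subset_Icc_right hs.2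
  let f : ℝ → Euc n × Euc n := fun t => phase φ π (c t)
  have hf : ContDiffOn ℝ 1 f (Icc 0 s) := fun t ht => by
    have h1 : ContMDiffAt (𝓡 N).tangent 𝓘(ℝ, Euc n × Euc n) 1 (phase φ π) (c t) :=
      (contMDiffAt_phase hD.proj_smooth hφ (hsrc t ht)).of_le ENat.LEInfty.out
    exact (ContMDiffAt.comp_contMDiffWithinAt t h1 ((hc t (hsub ht)).mono hsub)).contDiffWithinAt
  have hspeed : ∀ t ∈ Ioo 0 s, ENNReal.ofReal (√a) * ‖deriv f t‖ₑ ≤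
      ‖mfderiv 𝓘(ℝ, ℝ) (𝓡 N).tangent c t (1 : ℝ)‖ₑ := by
    intro t ht
    have ht1 : t ∈ Icc 0 s := ⟨ht.1.le, ht.2.le⟩
    have hmd : MDifferentiableAt 𝓘(ℝ, ℝ) (𝓡 N).tangent c t :=
      ((hc t (hsub ht1)).contMDiffAt (Icc_mem_nhds ht.1 (ht.2.trans_le hs.2))).mdifferentiableAt
        one_ne_zero
    have aux : ∀ g : ℝ →L[ℝ] Euc N × Euc N, g = (1 : ℝ →L[ℝ] ℝ).smulRight (g 1) := fun g => by
      ext <;> simp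
    have e := aux (mfderiv 𝓘(ℝ, ℝ) (𝓡 N).tangent c t)
    have hder : HasDerivAt f (dPhase φ π (c t) (mfderiv 𝓘(ℝ, ℝ) (𝓡 N).tangent c t (1 : ℝ))) t := by
      have h1 := hmd.hasMFDerivAt
      exact hasDerivWithinAt_univ.1 (hasDerivWithinAt_phase hD hφ (hsrc t ht1)
        (hasMFDerivWithinAt_univ.2 (e ▸ h1)))
    rw [hder.deriv]
    have h2 := h𝒢.contractionMetric_le hD hφ ⟨hcD t (hsub ht1), hsrc t ht1⟩
      (mfderiv 𝓘(ℝ, ℝ) (𝓡 N).tangent c t (1 : ℝ))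
    have h3 := (ha' _).trans h2
    rw [← ofReal_norm, ← ENNReal.ofReal_mul (Real.sqrt_nonneg a)]
    refine ENNReal.ofReal_le_ofReal ?_
    refine (le_of_eq ?_).trans (Real.sqrt_le_sqrt h3)
    rw [Real.sqrt_mul ha.le, Real.sqrt_sq (norm_nonneg _)]
  calc ENNReal.ofReal (√a * ‖phase φ π v‖)
      ≤ ENNReal.ofReal (√a * ‖f s - f 0‖) := by gcongr
    _ = ENNReal.ofReal (√a) * ‖f s - f 0‖ₑ := by
        rw [ENNReal.ofReal_mul (Real.sqrt_nonneg a), ofReal_norm]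
    _ ≤ ENNReal.ofReal (√a) * ∫⁻ t in Icc 0 s, ‖deriv f t‖ₑ := by
        gcongr
        exact enorm_sub_le_lintegral_deriv_of_contDiffOn_Icc hf hs.1
    _ = ∫⁻ t in Ioo 0 s, ENNReal.ofReal (√a) * ‖deriv f t‖ₑ := by
        rw [MeasureTheory.restrict_Ioo_eq_restrict_Icc,
          MeasureTheory.lintegral_const_mul' _ _ ENNReal.ofReal_ne_top]
    _ ≤ ∫⁻ t in Ioo 0 s, ‖mfderiv 𝓘(ℝ, ℝ) (𝓡 N).tangent c t (1 : ℝ)‖ₑ :=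
        MeasureTheory.setLIntegral_mono' measurableSet_Ioo hspeed
    _ = Manifold.pathELength (𝓡 N).tangent c 0 s :=
        Manifold.pathELength_eq_lintegral_mfderiv_Ioo.symm
    _ ≤ Manifold.pathELength (𝓡 N).tangent c 0 1 := Manifold.pathELength_mono le_rfl hs.2

/-- The distance to the equilibria is controlled by the norm of the phase: the horizontal lift of
the segment from the phase to the origin leads to an equilibrium. -/
theorem exists_constraintEDist_le [T2Space Q]
    (h : IsChaplyginSystem (n := n) (k := k) G π L D) {A R : ℝ} (hA : 0 < A)
    (hA' : ∀ p : Euc n × Euc n, contractionMetric M K b ε p p ≤ A * ‖p‖ ^ 2)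
    (hR : Metric.closedBall (0 : Euc n) R ⊆ φ.target)
    (h𝒢 : IsHorizontalLiftMetric π D φ M K b ε 𝒢) {v : TangentBundle (𝓡 N) Q}
    (hv : v ∈ phaseTube D φ π R) :
    ∃ w ∈ equilibriumSet π L D F φ,
      constraintEDist D 𝒢 v w ≤ ENNReal.ofReal (√A * ‖phase φ π v‖) := by
  have hD := S.horizontal
  have hφ := S.chart
  let _ : ∀ u : TangentBundle (𝓡 N) Q, ENorm (TangentSpace (𝓡 N).tangent u) := metricENorm 𝒢
  obtain ⟨z, y, hzy⟩ : ∃ z y, phase φ π v = (z, y) := ⟨_, _, rfl⟩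
  have hline : ∀ (x : Euc n) (t : ℝ), HasDerivAt (fun t : ℝ => (1 - t) • x) (-x) t := fun x t => by
    simpa using ((hasDerivAt_id t).const_sub 1).smul_const x
  have hztarget : ∀ t ∈ Icc (0 : ℝ) 1, (1 - t) • z ∈ φ.target := fun t ht => by
    refine hR (mem_closedBall_zero_iff.2 ?_)
    have h1 : ‖z‖ ≤ ‖phase φ π v‖ := by rw [hzy]; exact norm_fst_le (z, y)
    have h2 : ‖phase φ π v‖ < R := mem_ball_zero_iff.1 hv.2
    rw [norm_smul, Real.norm_of_nonneg (by linarith [ht.2])]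
    nlinarith [norm_nonneg z, ht.1, ht.2]
  have hz0 : φ (π v.proj) = (1 - (0 : ℝ)) • z := by
    rw [sub_zero, one_smul]; exact congrArg Prod.fst hzy
  obtain ⟨q, hq0, hq⟩ := exists_horizontalLift_Icc h hφ (hline z) contDiff_const
    (zero_le_one' ℝ) hztarget hv.1.2 hz0
  have hqcont : ContinuousOn q (Icc 0 1) := fun t ht => (hq t ht).2.2.continuousWithinAt
  have hq1 : ContMDiffOn 𝓘(ℝ, ℝ) (𝓡 N) 1 q (Icc 0 1) := by
    have : IsManifold (𝓡 N) 1 Q := IsManifold.of_le (n := ∞) ENat.LEInfty.out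
    refine contMDiffOn_one_of_velocity (fun t => horLift D φ π (q t) (-z))
      (fun t ht => (hq t ht).2.2) fun t ht => ?_
    have h1 : ContinuousAt (horMap D φ π) (q t, -z) :=
      (contMDiffAt_horMap hD hφ (p := (q t, -z)) (hq t ht).1).continuousAt
    exact ContinuousAt.comp_continuousWithinAt (f := fun t => (q t, -z)) h1
      ((hqcont t ht).prodMk continuousWithinAt_const)
  let c : ℝ → TangentBundle (𝓡 N) Q := fun t => horMap D φ π (q t, (1 - t) • y)
  have hc : ContMDiffOn 𝓘(ℝ, ℝ) (𝓡 N).tangent 1 c (Icc 0 1) := fun t ht => by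
    have h1 : ContMDiffAt ((𝓡 N).prod 𝓘(ℝ, Euc n)) (𝓡 N).tangent 1 (horMap D φ π)
        (q t, (1 - t) • y) :=
      (contMDiffAt_horMap hD hφ (p := (q t, (1 - t) • y)) (hq t ht).1).of_le ENat.LEInfty.out
    have h2 : ContDiff ℝ 1 fun t : ℝ => (1 - t) • y := by fun_prop
    exact ContMDiffAt.comp_contMDiffWithinAt (f := fun t => (q t, (1 - t) • y)) t h1
      ((hq1 t ht).prodMk h2.contMDiff.contMDiffAt.contMDiffWithinAt)
  have hc0 : c 0 = v := by
    have h1 : (1 - (0 : ℝ)) • y = (phase φ π v).2 := by rw [hzy, sub_zero, one_smul]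
    change horMap D φ π (q 0, (1 - (0 : ℝ)) • y) = v
    rw [hq0, h1]
    exact horMap_phase hD hφ hv.1
  have hcEP : c 1 ∈ equilibriumSet π L D F φ := by
    obtain ⟨h1, h2, -⟩ := hq 1 ⟨zero_le_one, le_rfl⟩
    simp only [sub_self, zero_smul] at h2
    refine (mem_equilibriumSet_iff S).2 ⟨?_, h1, h2⟩
    have h3 : c 1 = horMap D φ π (q 1, 0) := by
      change horMap D φ π (q 1, (1 - (1 : ℝ)) • y) = _
      rw [sub_self, zero_smul]
    rw [h3]
    exact horLift_zero hD hφ h1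
  have hspeed : ∀ t ∈ Ioo (0 : ℝ) 1, ‖mfderiv 𝓘(ℝ, ℝ) (𝓡 N).tangent c t (1 : ℝ)‖ₑ ≤
      ENNReal.ofReal (√A * ‖phase φ π v‖) := by
    intro t ht
    obtain ⟨h1, h2, h3⟩ := hq t ⟨ht.1.le, ht.2.le⟩
    obtain ⟨h4, h5, h6⟩ := isTangentToConstraint_dHorMap hD hφ (p := (q t, (1 - t) • y)) h1
      (horLift D φ π (q t) (-z)) (-y)
    have h7 := (velocityWithin_horMap hD hφ h1 h3
      (hline y t).hasDerivWithinAt).hasMFDerivAt (Icc_mem_nhds ht.1 ht.2)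
    have h8 : mfderiv 𝓘(ℝ, ℝ) (𝓡 N).tangent c t (1 : ℝ) =
        dHorMap D φ π (q t, (1 - t) • y) (horLift D φ π (q t) (-z)) (-y) := by
      have h9 := DFunLike.congr_fun h7.mfderiv (1 : ℝ)
      have e : ∀ w : Euc N × Euc N, ((1 : ℝ →L[ℝ] ℝ).smulRight w) (1 : ℝ) = w := fun w => by simp
      exact h9.trans (e _)
    have h10 := h𝒢.inner_eq hD hφ (v := c t) ⟨horMap_mem (q t, (1 - t) • y), h1⟩
      (X := dHorMap D φ π (q t, (1 - t) • y) (horLift D φ π (q t) (-z)) (-y))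
      ⟨h4, by rw [h5]; exact horLift_mem _ _⟩
    have h11 : dPhase φ π (c t) (dHorMap D φ π (q t, (1 - t) • y)
        (horLift D φ π (q t) (-z)) (-y)) = -phase φ π v :=
      h6.trans (Prod.ext ((redVel_horLift hD hφ h1 _).trans
        (congrArg (fun p => -Prod.fst p) hzy).symm) (congrArg (fun p => -Prod.snd p) hzy).symm)
    rw [h8]
    refine ENNReal.ofReal_le_ofReal ?_
    refine (Real.sqrt_le_sqrt (h10.trans_le (hA' _))).trans (le_of_eq ?_)
    rw [h11, norm_neg, Real.sqrt_mul hA.le, Real.sqrt_sq (norm_nonneg _)]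
  refine ⟨c 1, hcEP, (iInf₂_le c ⟨hc0, rfl, fun s _ => horMap_mem _, hc⟩).trans ?_⟩
  calc Manifold.pathELength (𝓡 N).tangent c 0 1
      = ∫⁻ t in Ioo (0 : ℝ) 1, ‖mfderiv 𝓘(ℝ, ℝ) (𝓡 N).tangent c t (1 : ℝ)‖ₑ :=
        Manifold.pathELength_eq_lintegral_mfderiv_Ioo
    _ ≤ ∫⁻ _ in Ioo (0 : ℝ) 1, ENNReal.ofReal (√A * ‖phase φ π v‖) :=
        MeasureTheory.setLIntegral_mono' measurableSet_Ioo hspeed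
    _ = ENNReal.ofReal (√A * ‖phase φ π v‖) := by simp

end Distances

/-! ### The convergence theorem -/

section Convergence

variable {N n k : ℕ} {Q : Type*} [TopologicalSpace Q]
  [ChartedSpace (EuclideanSpace ℝ (Fin N)) Q] [IsManifold (𝓡 N) ∞ Q]
  {Qbar : Type*} [TopologicalSpace Qbar]
  [ChartedSpace (EuclideanSpace ℝ (Fin n)) Qbar] [IsManifold (𝓡 n) ∞ Qbar]
  {G : Type*} [TopologicalSpace G] [ChartedSpace (EuclideanSpace ℝ (Fin k)) G] [Group G]
  [LieGroup (𝓡 k) ∞ G] [MulAction G Q] [ContMDiffSMul (𝓡 k) (𝓡 N) ∞ G Q] [ProperSMul G Q]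
  {π : Q → Qbar} {L : TangentBundle (𝓡 N) Q → ℝ}
  {D : ∀ q : Q, Submodule ℝ (TangentSpace (𝓡 N) q)}
  {F : ∀ v : TangentBundle (𝓡 N) Q, TangentSpace (𝓡 N) v.proj →L[ℝ] ℝ}
  {l : TangentBundle (𝓡 n) Qbar → ℝ}
  {f : ∀ w : TangentBundle (𝓡 n) Qbar, TangentSpace (𝓡 n) w.proj →L[ℝ] ℝ}
  {φ : OpenPartialHomeomorph Qbar (EuclideanSpace ℝ (Fin n))}
  {M K : Matrix (Fin n) (Fin n) ℝ} {b ε : ℝ} {𝒢 : TangentBundleMetric N Q}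

theorem IsChaplyginSystem.isDampedOscillatorReduction
    (h : IsChaplyginSystem (n := n) (k := k) G π L D)
    (hl : IsReducedLagrangian π D L l) (hf : IsReducedForce π D F f)
    (hφ : φ ∈ IsManifold.maximalAtlas (𝓡 n) ∞ Qbar) (hM : M.PosDef) (hK : K.PosDef)
    (hlφ : ∀ w : TangentBundle (𝓡 n) Qbar, w.proj ∈ φ.source →
      l w = quadraticLagrangian M K (phaseCoord φ w))
    (hdyn : HasQuadraticReducedDynamics π L D φ M K) (hfφ : IsDissipativeInChart φ b f) :
    IsDampedOscillatorReduction π L D F φ M K b where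
  horizontal := h.isHorizontalDistribution
  chart := hφ
  lagrangian_smooth := h.lagrangian_smooth
  lagrangian_eq v hv := (hl v hv.1).symm.trans (hlφ _ hv.2)
  force_eq v hv u hu := (hf v hv.1 u hu).symm.trans (hfφ _ hv.2 _)
  dynamics := hdyn
  mass_posDef := hM
  stiffness_posDef := hK

variable (S : IsDampedOscillatorReduction π L D F φ M K b)
include S

/-- The norm of the phase of a trajectory decays exponentially. -/
theorem norm_phase_trajectory_le [T2Space Qbar] {δ c C rate R r : ℝ}
    (hV : IsLyapunovDecay M K b δ c C rate)
    (hR : Metric.closedBall (0 : Euc n) R ⊆ φ.target) (hR0 : 0 < R)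
    (hrR : C * r ^ 2 ≤ c * R ^ 2)
    {γ : ℝ → TangentBundle (𝓡 N) Q} {J : Set ℝ} (hJ : J.OrdConnected) (h0J : 0 ∈ J)
    (hγ : IsNonholonomicTrajectoryOn L D F γ J) (h0 : γ 0 ∈ phaseTube D φ π r)
    {t : ℝ} (ht : t ∈ J) (ht0 : 0 ≤ t) :
    γ t ∈ phaseTube D φ π R ∧
      ‖phase φ π (γ t)‖ ≤ √(C / c) * Real.exp (-rate * t) * ‖phase φ π (γ 0)‖ := by
  have hc := hV.lower_pos
  have h0r : ‖phase φ π (γ 0)‖ < r := mem_ball_zero_iff.1 h0.2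
  have h0R : lyapunov M K δ (phase φ π (γ 0)) < c * R ^ 2 := by
    refine (hV.upper _).trans_lt (lt_of_lt_of_le ?_ hrR)
    have := hV.upper_pos
    gcongr
  obtain ⟨h1, h2⟩ := phase_trajectory_decay S hV hR hR0 hJ h0J hγ h0.1.2 h0R ht ht0
  refine ⟨h1, ?_⟩
  have h3 : c * ‖phase φ π (γ t)‖ ^ 2 ≤
      Real.exp (-(2 * rate) * t) * (C * ‖phase φ π (γ 0)‖ ^ 2) :=
    (hV.lower _).trans (h2.trans (mul_le_mul_of_nonneg_left (hV.upper _) (Real.exp_pos _).le))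
  have h4 : Real.exp (-(2 * rate) * t) = Real.exp (-rate * t) ^ 2 := by
    rw [← Real.exp_nat_mul]; congr 1; push_cast; ring
  have hC := hV.upper_pos
  refine le_of_pow_le_pow_left₀ two_ne_zero (by positivity) ?_
  rw [mul_pow, mul_pow, Real.sq_sqrt (by positivity), ← h4]
  have h5 : C / c * Real.exp (-(2 * rate) * t) * ‖phase φ π (γ 0)‖ ^ 2 =
      Real.exp (-(2 * rate) * t) * (C * ‖phase φ π (γ 0)‖ ^ 2) / c := by field_simp
  rw [h5, le_div_iff₀ hc, mul_comm]
  exact h3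

/-- Convergence to the set of equilibria, in the distances of a horizontal lift of the contraction
metric. The first bound on `B` serves the absolute estimate, where the initial phase is smaller than
`r`, and the second one the estimate relative to the initial distance. -/
theorem edist_trajectory_le [T2Space Q] [T2Space Qbar]
    (h : IsChaplyginSystem (n := n) (k := k) G π L D) {δ c C rate R r : ℝ}
    (hV : IsLyapunovDecay M K b δ c C rate)
    (hR : Metric.closedBall (0 : Euc n) R ⊆ φ.target) (hR0 : 0 < R)
    (hrR : C * r ^ 2 ≤ c * R ^ 2) (hrR2 : r ≤ R / 2)
    {a A : ℝ} (ha : 0 < a) (hA : 0 < A)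
    (haA : ∀ p : Euc n × Euc n, a * ‖p‖ ^ 2 ≤ contractionMetric M K b ε p p ∧
      contractionMetric M K b ε p p ≤ A * ‖p‖ ^ 2)
    (h𝒢 : IsHorizontalLiftMetric π D φ M K b ε 𝒢)
    {γ : ℝ → TangentBundle (𝓡 N) Q} {J : Set ℝ} (hJ : J.OrdConnected) (h0J : 0 ∈ J)
    (hγ : IsNonholonomicTrajectoryOn L D F γ J) (h0 : γ 0 ∈ phaseTube D φ π r)
    {t : ℝ} (ht : t ∈ J) (ht0 : 0 ≤ t) {B : ℝ} (hB : √A * √(C / c) * r ≤ B)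
    (hB' : √A * √(C / c) / √a ≤ B) :
    (⨅ w ∈ equilibriumSet π L D F φ, metricEDist 𝒢 (γ t) w) ≤
        ENNReal.ofReal (B * Real.exp (-rate * t)) ∧
      (⨅ w ∈ equilibriumSet π L D F φ, constraintEDist D 𝒢 (γ t) w) ≤
        ENNReal.ofReal (B * Real.exp (-rate * t)) *
          ⨅ w ∈ equilibriumSet π L D F φ, constraintEDist D 𝒢 (γ 0) w := by
  obtain ⟨hmem, hdecay⟩ := norm_phase_trajectory_le S hV hR hR0 hrR hJ h0J hγ h0 ht ht0
  obtain ⟨w, hw, hdist⟩ := exists_constraintEDist_le S h hA (fun p => (haA p).2) hR h𝒢 hmem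
  have h0r : ‖phase φ π (γ 0)‖ < r := mem_ball_zero_iff.1 h0.2
  have hsa : 0 < √a := Real.sqrt_pos.2 ha
  have hupper : √A * ‖phase φ π (γ t)‖ ≤
      √A * √(C / c) * Real.exp (-rate * t) * ‖phase φ π (γ 0)‖ := by
    rw [mul_assoc (√A), mul_assoc (√A)]
    exact mul_le_mul_of_nonneg_left hdecay (Real.sqrt_nonneg A)
  constructor
  · refine (iInf₂_le w hw).trans ((metricEDist_le_constraintEDist (D := D) _ _).trans
      (hdist.trans (ENNReal.ofReal_le_ofReal (hupper.trans ?_))))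
    calc √A * √(C / c) * Real.exp (-rate * t) * ‖phase φ π (γ 0)‖
        ≤ √A * √(C / c) * Real.exp (-rate * t) * r := by gcongr
      _ = √A * √(C / c) * r * Real.exp (-rate * t) := by ring
      _ ≤ B * Real.exp (-rate * t) := by gcongr
  · have hlower : ENNReal.ofReal (√a * ‖phase φ π (γ 0)‖) ≤
        ⨅ w ∈ equilibriumSet π L D F φ, constraintEDist D 𝒢 (γ 0) w :=
      le_iInf₂ fun w hw => ofReal_phase_le_constraintEDist S ha (fun p => (haA p).1) hR h𝒢
        ⟨h0.1, mem_ball_zero_iff.2 (h0r.trans_le hrR2)⟩ hw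
    have hB0 : 0 ≤ B := le_trans (by positivity) hB'
    refine (iInf₂_le w hw).trans (hdist.trans ((ENNReal.ofReal_le_ofReal (hupper.trans ?_)).trans
      ((ENNReal.ofReal_mul (q := √a * ‖phase φ π (γ 0)‖) (by positivity)).le.trans
      (mul_le_mul_right hlower (ENNReal.ofReal (B * Real.exp (-rate * t)))))))
    calc √A * √(C / c) * Real.exp (-rate * t) * ‖phase φ π (γ 0)‖
        = √A * √(C / c) / √a * Real.exp (-rate * t) * (√a * ‖phase φ π (γ 0)‖) := by
          field_simp
      _ ≤ B * Real.exp (-rate * t) * (√a * ‖phase φ π (γ 0)‖) := by gcongr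

end Convergence

end

theorem mainTheorem4 {N n k : ℕ}
    {Q : Type*} [TopologicalSpace Q] [T2Space Q] [SecondCountableTopology Q]
    [ChartedSpace (EuclideanSpace ℝ (Fin N)) Q] [IsManifold (𝓡 N) ∞ Q]
    {Qbar : Type*} [TopologicalSpace Qbar] [T2Space Qbar] [SecondCountableTopology Qbar]
    [ChartedSpace (EuclideanSpace ℝ (Fin n)) Qbar] [IsManifold (𝓡 n) ∞ Qbar]
    {G : Type*} [TopologicalSpace G] [T2Space G] [SecondCountableTopology G]
    [ChartedSpace (EuclideanSpace ℝ (Fin k)) G] [Group G] [LieGroup (𝓡 k) ∞ G]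
    [MulAction G Q] [ContMDiffSMul (𝓡 k) (𝓡 N) ∞ G Q] [ProperSMul G Q]
    -- the Chaplygin system and the force
    (π : Q → Qbar) (L : TangentBundle (𝓡 N) Q → ℝ)
    (D : ∀ q : Q, Submodule ℝ (TangentSpace (𝓡 N) q))
    (hLD : IsChaplyginSystem (n := n) (k := k) G π L D)
    (F : ∀ v : TangentBundle (𝓡 N) Q, TangentSpace (𝓡 N) v.proj →L[ℝ] ℝ)
    (hF : IsCyclicForce G F)
    -- the reduced Lagrangian and the reduced force
    (l : TangentBundle (𝓡 n) Qbar → ℝ) (hl : IsReducedLagrangian π D L l)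
    (f : ∀ w : TangentBundle (𝓡 n) Qbar, TangentSpace (𝓡 n) w.proj →L[ℝ] ℝ)
    (hf : IsReducedForce π D F f)
    -- a chart of the reduced space, centred at the equilibrium
    (φ : OpenPartialHomeomorph Qbar (EuclideanSpace ℝ (Fin n)))
    (hφ : φ ∈ IsManifold.maximalAtlas (𝓡 n) ∞ Qbar) (hφ0 : 0 ∈ φ.target)
    -- the form of the reduced system in the chart
    (M K : Matrix (Fin n) (Fin n) ℝ) (hM : M.PosDef) (hK : K.PosDef) (b : ℝ) (hb : 0 < b)
    (hlφ : ∀ w : TangentBundle (𝓡 n) Qbar, w.proj ∈ φ.source →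
      l w = quadraticLagrangian M K (phaseCoord φ w))
    (hdyn : HasQuadraticReducedDynamics π L D φ M K)
    (hfφ : IsDissipativeInChart φ b f) :
    ∃ U : Set (TangentBundle (𝓡 N) Q),
      IsTubularNeighborhood (𝓡 N).tangent
        (EuclideanSpace ℝ (Fin n) × EuclideanSpace ℝ (Fin n))
        (constraintSet D) (equilibriumSet π L D F φ) U ∧
      (∀ v ∈ U, ∃ γ : ℝ → TangentBundle (𝓡 N) Q,
        γ 0 = v ∧ IsNonholonomicTrajectoryOn L D F γ (Ici 0)) ∧
      ∃ rate : ℝ, 0 < rate ∧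
        ∀ ε : ℝ, (contractionMatrix M K b ε).PosDef →
        ∃ C : ℝ, 0 < C ∧
        ∀ 𝒢 : TangentBundleMetric N Q, IsHorizontalLiftMetric π D φ M K b ε 𝒢 →
        ∀ (γ : ℝ → TangentBundle (𝓡 N) Q) (J : Set ℝ), J.OrdConnected → 0 ∈ J →
          IsNonholonomicTrajectoryOn L D F γ J → γ 0 ∈ U →
          ∀ t ∈ J, 0 ≤ t →
            (⨅ w ∈ equilibriumSet π L D F φ, metricEDist 𝒢 (γ t) w) ≤
              ENNReal.ofReal (C * Real.exp (-rate * t)) ∧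
            (⨅ w ∈ equilibriumSet π L D F φ, constraintEDist D 𝒢 (γ t) w) ≤
              ENNReal.ofReal (C * Real.exp (-rate * t)) *
                ⨅ w ∈ equilibriumSet π L D F φ, constraintEDist D 𝒢 (γ 0) w := by
  have S := hLD.isDampedOscillatorReduction hl hf hφ hM hK hlφ hdyn hfφ
  obtain ⟨δ, c, C, rate, hV⟩ := exists_isLyapunovDecay hM hK hb
  obtain ⟨r₀, hr₀, htube⟩ := isTubularNeighborhood_phaseTube hLD S hφ0
  obtain ⟨R, hR0, hR⟩ := Metric.nhds_basis_closedBall.mem_iff.1 (φ.open_target.mem_nhds hφ0)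
  have hc := hV.lower_pos
  have hC := hV.upper_pos
  -- trajectories which start in the tube of radius `r` do not leave the one of radius `R`
  let r := min (min r₀ (R / 2)) (R * √(c / C))
  have hr : 0 < r := by positivity
  have hrR : C * r ^ 2 ≤ c * R ^ 2 := by
    calc C * r ^ 2 ≤ C * (R * √(c / C)) ^ 2 := by gcongr; exact min_le_right _ _
      _ = c * R ^ 2 := by rw [mul_pow, Real.sq_sqrt (by positivity)]; field_simp
  refine ⟨phaseTube D φ π r, htube r hr ((min_le_left _ _).trans (min_le_left _ _)),
    fun v hv => ?_, rate, hV.rate_pos, fun ε hε => ?_⟩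
  · refine exists_trajectory S hLD hV hR hR0 hv.1 ((hV.upper _).trans_lt (lt_of_lt_of_le ?_ hrR))
    have : ‖phase φ π v‖ < r := mem_ball_zero_iff.1 hv.2
    gcongr
  · obtain ⟨a, ha, A, hA, haA⟩ := exists_contractionMetric_bounds hε
    refine ⟨max (√A * √(C / c) * r) (√A * √(C / c) / √a), by positivity,
      fun 𝒢 h𝒢 γ J hJ h0J hγ h0 t ht ht0 => ?_⟩
    exact edist_trajectory_le S hLD hV hR hR0 hrR
      ((min_le_left _ _).trans (min_le_right _ _)) ha hA haA h𝒢 hJ h0J hγ h0 ht ht0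
      (le_max_left _ _) (le_max_right _ _)
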